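/- Let $G$ be a connected real reductive Lie group (that is, a connected real Lie group whose Lie algebra is reductive), with Lie algebra $\mathfrak g(\mathbb R)$ and complexified Lie algebra $\mathfrak g$. An element $x\in\mathfrak g(\mathbb R)$ is hyperbolic if $\operatorname{ad}(x)$ is diagonalizable with real eigenvalues; a parabolic subgroup is the normalizer in the group of $\mathfrak p(\mathbb R)$, the sum of the eigenspaces of $\operatorname{ad}(x)$ with eigenvalue $\ge 0$, for some hyperbolic $x$. Let $P\subset G$ be a parabolic subgroup, let $i:G'\hookrightarrow G$ be a reductive (Lie) subgroup, and suppose that $P'=P\cap G'$ is a parabolic subgroup of $G'$. Let $V$ and $V'$ be finite-dimensional complex (continuous) representations of $P$ and $P'$. Let $\operatorname{Ind}_P^G(V)=\{f\in C^\infty(G,V): f(gp)=p^{-1}\cdot f(g)\ (g\in G,\ p\in P)\}$ be the space of smooth sections of $\mathcal V=G\times_P V\to G/P$, with $G$ acting by left translations, and similarly $\operatorname{Ind}_{P'}^{G'}(V')$, the space of smooth sections of $\mathcal V'=G'\times_{P'}V'\to G'/P'$. Let $J^k_e(G,V)^P$ be the space of $k$-jets at $e\in G$ of elements of $\operatorname{Ind}_P^G(V)$,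 so that the $k$-th jet bundle of $\mathcal V$ is $J^k\mathcal V=G\times_P J^k_e(G,V)^P$, and write $i:G'/P'\to G/P$ also for the induced map. A linear map $D:\operatorname{Ind}_P^G(V)\to\operatorname{Ind}_{P'}^{G'}(V')$ is a differential operator if, for some $k\in\mathbb N$, there is a smooth bundle map $Q:i^*J^k\mathcal V\to\mathcal V'$ over $G'/P'$ with $D=Q\circ i^*\circ J^k$. Let $M_{\mathfrak p}^{\mathfrak g}(V^\vee)=U(\mathfrak g)\otimes_{U(\mathfrak p)}V^\vee$ be the generalized Verma module of the contragredient representation $V^\vee$, with $\mathfrak g$ acting by left multiplication and $P$ by $p\cdot(u\otimes\nu)=\operatorname{Ad}(p)u\otimes p\cdot\nu$, and similarly $M_{\mathfrak p'}^{\mathfrak g'}(V'^\vee)$. For $X\in\mathfrak g(\mathbb R)$ let $(\partial_Xf)(g)=\frac{d}{dt}\big|_{t=0}f(g\exp tX)$. **Theorem.** The prescription $$\langle X_1\cdots X_r\otimes\nu,\ f\rangle=\nu\big((\partial_{X_1}\cdots\partial_{X_r}f)(e)\big)\qquad(X_j\in\mathfrak g(\mathbb R),\ \nu\in V^\vee,\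 f\in\operatorname{Ind}_P^G(V))$$ gives a well-defined complex bilinear pairing between $M_{\mathfrak p}^{\mathfrak g}(V^\vee)$ and $\operatorname{Ind}_P^G(V)$, and there is a $\mathbb C$-linear bijection $D\mapsto\varphi_D$ from the space of all $G'$-equivariant differential operators $D:\operatorname{Ind}_P^G(V)\to\operatorname{Ind}_{P'}^{G'}(V')$ onto the space of all $(\mathfrak g',P')$-homomorphisms $M_{\mathfrak p'}^{\mathfrak g'}(V'^\vee)\to M_{\mathfrak p}^{\mathfrak g}(V^\vee)$ such that $$\langle\varphi_D(1\otimes\nu),\ f\rangle=\nu\big((Df)(e)\big)\qquad(\nu\in V'^\vee,\ f\in\operatorname{Ind}_P^G(V)).$$ -/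

import Mathlib

open scoped Manifold ContDiff TensorProduct

set_option linter.unusedSectionVars false

noncomputable section

namespace FlagOperator

/-! ## Lie groups, the adjoint action, one-parameter subgroups, parabolic subgroups -/

section LieGroups

/-- A smooth real Lie group has the smoothness that Mathlib asks for in order to define the
bracket on its tangent space at the identity. -/
instance instLieGroupMinSmoothness {E : Type*} [NormedAddCommGroup E] [NormedSpace ℝ E]
    {G : Type*} [TopologicalSpace G] [ChartedSpace E G] [Group G] [LieGroup 𝓘(ℝ, E) ∞ G] :
    LieGroup 𝓘(ℝ, E) (minSmoothness ℝ 3) G := by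
  rw [minSmoothness_of_isRCLikeNormedField]
  infer_instance

instance instCompleteSpaceOfFiniteDimensional {E : Type*} [NormedAddCommGroup E]
    [NormedSpace ℝ E] [FiniteDimensional ℝ E] : CompleteSpace E :=
  FiniteDimensional.complete ℝ E

variable (E : Type*) [NormedAddCommGroup E] [NormedSpace ℝ E] [FiniteDimensional ℝ E]
  {G : Type*} [TopologicalSpace G] [ChartedSpace E G] [Group G]

/-- The adjoint action `Ad g` on the real Lie algebra `𝔤(ℝ) = T₁G`: the differential at `1` of the
conjugation `h ↦ g h g⁻¹`. -/
def Ad (g : G) : GroupLieAlgebra 𝓘(ℝ, E) G →ₗ[ℝ] GroupLieAlgebra 𝓘(ℝ, E) G where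
  toFun X := mfderiv 𝓘(ℝ, E) 𝓘(ℝ, E) (fun h : G => g * h * g⁻¹) 1 X
  map_add' X Y := map_add (mfderiv 𝓘(ℝ, E) 𝓘(ℝ, E) (fun h : G => g * h * g⁻¹) 1) X Y
  map_smul' c X := map_smul (mfderiv 𝓘(ℝ, E) 𝓘(ℝ, E) (fun h : G => g * h * g⁻¹) 1) c X

/-- `γ` is the one-parameter subgroup `t ↦ exp (t X)` of `G`: a smooth homomorphism `ℝ → G` with
initial velocity `X`. -/
structure IsOneParam (γ : ℝ → G) (X : GroupLieAlgebra 𝓘(ℝ, E) G) : Prop where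
  smooth : ContMDiff 𝓘(ℝ, ℝ) 𝓘(ℝ, E) ∞ γ
  map_add : ∀ s t : ℝ, γ (s + t) = γ s * γ t
  velocity : mfderiv 𝓘(ℝ, ℝ) 𝓘(ℝ, E) γ 0 (1 : ℝ) = X

lemma IsOneParam.map_zero {γ : ℝ → G} {X : GroupLieAlgebra 𝓘(ℝ, E) G} (h : IsOneParam E γ X) :
    γ 0 = 1 := by
  have := h.map_add 0 0
  simpa using this

variable [LieGroup 𝓘(ℝ, E) ∞ G]

lemma contMDiff_conj (g : G) :
    ContMDiff 𝓘(ℝ, E) 𝓘(ℝ, E) ∞ (fun h : G => g * h * g⁻¹) :=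
  (contMDiff_mul_right (I := 𝓘(ℝ, E)) (n := ∞) (a := g⁻¹)).comp
    (contMDiff_mul_left (I := 𝓘(ℝ, E)) (n := ∞) (a := g))

lemma mdiff_conj (g x : G) :
    MDifferentiableAt 𝓘(ℝ, E) 𝓘(ℝ, E) (fun h : G => g * h * g⁻¹) x :=
  (contMDiff_conj E g).mdifferentiable (by simp) x

lemma Ad_one : Ad E (1 : G) = LinearMap.id := by
  ext X
  have : (fun h : G => (1 : G) * h * (1 : G)⁻¹) = id := by ext; simp
  change mfderiv 𝓘(ℝ, E) 𝓘(ℝ, E) (fun h : G => (1 : G) * h * (1 : G)⁻¹) 1 X = X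
  rw [this, mfderiv_id]
  rfl

lemma mfderiv_conj_congr (g : G) {x : G} (hx : x = 1) (v : E) :
    (mfderiv 𝓘(ℝ, E) 𝓘(ℝ, E) (fun h : G => g * h * g⁻¹) x v : E) = Ad E g v := by
  subst hx; rfl

lemma Ad_mul (g h : G) : Ad E (g * h) = Ad E g ∘ₗ Ad E h := by
  ext X
  have e : (fun k : G => g * h * k * (g * h)⁻¹) =
      (fun k : G => g * k * g⁻¹) ∘ (fun k : G => h * k * h⁻¹) := by
    ext k; simp [mul_assoc]
  change mfderiv 𝓘(ℝ, E) 𝓘(ℝ, E) (fun k : G => g * h * k * (g * h)⁻¹) 1 X = _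
  rw [e, mfderiv_comp (I' := 𝓘(ℝ, E)) _ (mdiff_conj E g _) (mdiff_conj E h _)]
  exact mfderiv_conj_congr E g (by simp) _

lemma Ad_inv_apply (g : G) (X : GroupLieAlgebra 𝓘(ℝ, E) G) : Ad E g⁻¹ (Ad E g X) = X := by
  rw [← LinearMap.comp_apply, ← Ad_mul, inv_mul_cancel, Ad_one]; rfl

/-- `g exp(tX) g⁻¹ = exp (t Ad(g) X)`. -/
lemma IsOneParam.conj {γ : ℝ → G} {X : GroupLieAlgebra 𝓘(ℝ, E) G} (h : IsOneParam E γ X) (g : G) :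
    IsOneParam E (fun t => g * γ t * g⁻¹) (Ad E g X) where
  smooth := (contMDiff_conj E g).comp h.smooth
  map_add s t := by simp [h.map_add, mul_assoc]
  velocity := by
    have := mfderiv_comp (I := 𝓘(ℝ, ℝ)) (I' := 𝓘(ℝ, E)) (I'' := 𝓘(ℝ, E)) (0 : ℝ)
      (mdiff_conj E g (γ 0)) (h.smooth.mdifferentiable (by simp) 0)
    change mfderiv 𝓘(ℝ, ℝ) 𝓘(ℝ, E) ((fun h : G => g * h * g⁻¹) ∘ γ) 0 (1 : ℝ) = _
    rw [this]
    refine (mfderiv_conj_congr E g h.map_zero _).trans ?_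
    exact congrArg (Ad E g) h.velocity

lemma mfderiv_conj_mulInvariant (g x : G) (X : GroupLieAlgebra 𝓘(ℝ, E) G) :
    mfderiv 𝓘(ℝ, E) 𝓘(ℝ, E) (fun h : G => g * h * g⁻¹) x (mulInvariantVectorField X x) =
      mulInvariantVectorField (Ad E g X) (g * x * g⁻¹) := by
  have hL : ∀ a y : G, MDifferentiableAt 𝓘(ℝ, E) 𝓘(ℝ, E) (fun h : G => a * h) y := fun a y =>
    (contMDiff_mul_left (I := 𝓘(ℝ, E)) (n := ∞) (a := a)).mdifferentiable (by simp) y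
  have e : (fun h : G => g * h * g⁻¹) ∘ (fun h : G => x * h) =
      (fun h : G => g * x * g⁻¹ * h) ∘ (fun h : G => g * h * g⁻¹) := by
    ext k; simp [mul_assoc]
  have h1 := mfderiv_comp (I := 𝓘(ℝ, E)) (I' := 𝓘(ℝ, E)) (I'' := 𝓘(ℝ, E)) (1 : G)
    (mdiff_conj E g (x * 1)) (hL x 1)
  have h2 := mfderiv_comp (I := 𝓘(ℝ, E)) (I' := 𝓘(ℝ, E)) (I'' := 𝓘(ℝ, E)) (1 : G)
    (hL (g * x * g⁻¹) (g * 1 * g⁻¹)) (mdiff_conj E g 1)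
  rw [e] at h1
  have h3 := congrArg (fun T : E →L[ℝ] E => T X) (h1.symm.trans h2)
  have hx : ∀ y : G, y = x → ∀ v : E,
      (mfderiv 𝓘(ℝ, E) 𝓘(ℝ, E) (fun h : G => g * h * g⁻¹) y v : E) =
      mfderiv 𝓘(ℝ, E) 𝓘(ℝ, E) (fun h : G => g * h * g⁻¹) x v := by
    rintro y rfl v; rfl
  have hy : ∀ y : G, y = 1 → ∀ v : E,
      (mfderiv 𝓘(ℝ, E) 𝓘(ℝ, E) (fun h : G => g * x * g⁻¹ * h) y v : E) =
      mfderiv 𝓘(ℝ, E) 𝓘(ℝ, E) (fun h : G => g * x * g⁻¹ * h) 1 v := by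
    rintro y rfl v; rfl
  exact ((hx _ (mul_one x) _).symm.trans h3).trans (hy _ (by simp) _)

lemma mpullback_conj (g : G) (X : GroupLieAlgebra 𝓘(ℝ, E) G) :
    VectorField.mpullback 𝓘(ℝ, E) 𝓘(ℝ, E) (fun h : G => g * h * g⁻¹)
      (mulInvariantVectorField (Ad E g X)) = mulInvariantVectorField X := by
  ext x
  have hi : ∀ a b y : G, a * b = 1 → ∀ z : G, z = b * y * b⁻¹ →
      (mfderiv 𝓘(ℝ, E) 𝓘(ℝ, E) (fun h : G => a * h * a⁻¹) z : E →L[ℝ] E).comp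
        (mfderiv 𝓘(ℝ, E) 𝓘(ℝ, E) (fun h : G => b * h * b⁻¹) y : E →L[ℝ] E) =
      ContinuousLinearMap.id ℝ E := by
    rintro a b y hab z rfl
    have hba : b⁻¹ * a⁻¹ = 1 := by rw [← mul_inv_rev, hab, inv_one]
    have e : (fun h : G => a * h * a⁻¹) ∘ (fun h : G => b * h * b⁻¹) = id := by
      ext k
      calc a * (b * k * b⁻¹) * a⁻¹ = (a * b) * k * (b⁻¹ * a⁻¹) := by simp only [mul_assoc]
        _ = k := by rw [hab, hba]; simp
    have h1 := mfderiv_comp (I := 𝓘(ℝ, E)) (I' := 𝓘(ℝ, E)) (I'' := 𝓘(ℝ, E)) y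
      (mdiff_conj E a (b * y * b⁻¹)) (mdiff_conj E b y)
    rw [e, mfderiv_id] at h1
    exact h1.symm
  rw [VectorField.mpullback_apply, ← mfderiv_conj_mulInvariant]
  have hinv : ContinuousLinearMap.inverse
      (mfderiv 𝓘(ℝ, E) 𝓘(ℝ, E) (fun h : G => g * h * g⁻¹) x) =
      mfderiv 𝓘(ℝ, E) 𝓘(ℝ, E) (fun h : G => g⁻¹ * h * g⁻¹⁻¹) (g * x * g⁻¹) :=
    ContinuousLinearMap.inverse_eq
      (hi g g⁻¹ (g * x * g⁻¹) (by simp) x (by simp [mul_assoc]))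
      (hi g⁻¹ g x (by simp) _ rfl)
  rw [hinv]
  exact congrArg (fun T : E →L[ℝ] E => T (mulInvariantVectorField X x))
    (hi g⁻¹ g x (by simp) _ rfl)

/-- The adjoint action preserves the Lie bracket. -/
lemma Ad_lie (g : G) (X Y : GroupLieAlgebra 𝓘(ℝ, E) G) : Ad E g ⁅X, Y⁆ = ⁅Ad E g X, Ad E g Y⁆ := by
  have h := VectorField.mpullback_mlieBracket (I := 𝓘(ℝ, E)) (I' := 𝓘(ℝ, E))
    (n := minSmoothness ℝ 3) (x₀ := (1 : G))
    (f := fun h : G => g * h * g⁻¹) (V := mulInvariantVectorField (Ad E g X))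
    (W := mulInvariantVectorField (Ad E g Y))
    (mdifferentiableAt_mulInvariantVectorField _) (mdifferentiableAt_mulInvariantVectorField _)
    ((contMDiff_conj E g).contMDiffAt.of_le (by
      rw [minSmoothness_of_isRCLikeNormedField]; exact ENat.LEInfty.out))
    (minSmoothness_monotone (by norm_cast))
  rw [mpullback_conj, mpullback_conj, ← GroupLieAlgebra.bracket_def,
    ← mulInvariantVector_mlieBracket, ← GroupLieAlgebra.bracket_def] at h
  have hr : ∀ Z : GroupLieAlgebra 𝓘(ℝ, E) G, Ad E g (Ad E g⁻¹ Z) = Z := fun Z => by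
    have := Ad_inv_apply E g⁻¹ Z
    rwa [inv_inv] at this
  rw [← hr ⁅Ad E g X, Ad E g Y⁆, mpullback_conj] at h
  have h1 : mulInvariantVectorField (Ad E g⁻¹ ⁅Ad E g X, Ad E g Y⁆) (1 : G) =
      Ad E g⁻¹ ⁅Ad E g X, Ad E g Y⁆ := by
    have e : (fun k : G => (1 : G) * k) = id := by ext; simp
    rw [mulInvariantVectorField, e, mfderiv_id]; rfl
  rw [h1] at h
  rw [← h, hr]

/-- The adjoint action as a homomorphism of real Lie algebras. -/
def AdLie (g : G) : GroupLieAlgebra 𝓘(ℝ, E) G →ₗ⁅ℝ⁆ GroupLieAlgebra 𝓘(ℝ, E) G :=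
  { Ad E g with map_lie' := fun {X Y} => Ad_lie E g X Y }

/-- `x ∈ 𝔤(ℝ)` is hyperbolic: `ad x` is diagonalizable with real eigenvalues. -/
def IsHyperbolic (x : GroupLieAlgebra 𝓘(ℝ, E) G) : Prop :=
  ⨆ c : ℝ, Module.End.eigenspace (LieAlgebra.ad ℝ (GroupLieAlgebra 𝓘(ℝ, E) G) x) c = ⊤

/-- `𝔭(ℝ) = 𝔩(ℝ) + 𝔫₊(ℝ)`: the sum of the eigenspaces of `ad x` with eigenvalue `≥ 0`. -/
def parabolicSubalgebra (x : GroupLieAlgebra 𝓘(ℝ, E) G) :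
    Submodule ℝ (GroupLieAlgebra 𝓘(ℝ, E) G) :=
  ⨆ (c : ℝ) (_ : 0 ≤ c), Module.End.eigenspace (LieAlgebra.ad ℝ (GroupLieAlgebra 𝓘(ℝ, E) G) x) c

/-- The normalizer in `G` of a subspace of the Lie algebra. -/
def normalizerOf (W : Submodule ℝ (GroupLieAlgebra 𝓘(ℝ, E) G)) : Subgroup G where
  carrier := {g | W.map (Ad E g) = W}
  one_mem' := by simp [Ad_one]
  mul_mem' {a b} ha hb := by
    simp only [Set.mem_ofPred_eq] at ha hb ⊢
    rw [Ad_mul, Submodule.map_comp, hb, ha]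
  inv_mem' {a} ha := by
    simp only [Set.mem_ofPred_eq] at ha ⊢
    conv_lhs => rw [← ha]
    rw [← Submodule.map_comp, ← Ad_mul, inv_mul_cancel, Ad_one, Submodule.map_id]

/-- `P` is a parabolic subgroup of `G`: the normalizer in `G` of the parabolic subalgebra defined
by some hyperbolic element. -/
def IsParabolic (P : Subgroup G) : Prop :=
  ∃ x : GroupLieAlgebra 𝓘(ℝ, E) G, IsHyperbolic E x ∧ P = normalizerOf E (parabolicSubalgebra E x)

end LieGroups

/-! ## The generalized Verma module `U(𝔤) ⊗_{U(𝔭)} V^∨` -/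

section Verma

variable (E : Type*) [NormedAddCommGroup E] [NormedSpace ℝ E] [FiniteDimensional ℝ E]
  (G : Type*) [TopologicalSpace G] [ChartedSpace E G] [Group G] [LieGroup 𝓘(ℝ, E) ∞ G]

/-- The universal enveloping algebra `U(𝔤)` of the complexified Lie algebra `𝔤 = ℂ ⊗ 𝔤(ℝ)`. -/
abbrev Ug : Type _ := UniversalEnvelopingAlgebra ℂ (ℂ ⊗[ℝ] GroupLieAlgebra 𝓘(ℝ, E) G)

variable {G}

/-- The canonical map `𝔤(ℝ) → U(𝔤)`. -/
def toUg (X : GroupLieAlgebra 𝓘(ℝ, E) G) : Ug E G :=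
  UniversalEnvelopingAlgebra.ι ℂ ((1 : ℂ) ⊗ₜ[ℝ] X)

/-- The complex linear extension of `Ad g` to `𝔤`. -/
def AdC (g : G) : ℂ ⊗[ℝ] GroupLieAlgebra 𝓘(ℝ, E) G →ₗ⁅ℂ⁆ ℂ ⊗[ℝ] GroupLieAlgebra 𝓘(ℝ, E) G :=
  { (Ad E g).baseChange ℂ with
    map_lie' := fun {x y} =>
      (LieAlgebra.ExtendScalars.map (AlgHom.id ℝ ℂ) (AdLie E g)).map_lie x y }

/-- The adjoint action of `G` on `U(𝔤)` by algebra homomorphisms. -/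
def AdU (g : G) : Ug E G →ₐ[ℂ] Ug E G :=
  letI : LieRing (Ug E G) := LieRing.ofAssociativeRing
  UniversalEnvelopingAlgebra.lift ℂ ((UniversalEnvelopingAlgebra.ι ℂ).comp (AdC E g))

lemma AdU_toUg (g : G) (X : GroupLieAlgebra 𝓘(ℝ, E) G) :
    AdU E g (toUg E X) = toUg E (Ad E g X) := by
  rw [AdU, toUg, UniversalEnvelopingAlgebra.lift_ι_apply]
  rfl

variable {V : Type*} [NormedAddCommGroup V] [NormedSpace ℂ V] [FiniteDimensional ℂ V]
  {P : Subgroup G}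

/-- The infinitesimal contragredient action: `HasDualDeriv E ρ X ν ν'` says that `X` lies in the Lie
algebra `𝔭(ℝ)` of `P` (the one-parameter subgroup `exp (tX)` stays in `P`) and that
`X · ν = d/dt|₀ (exp (tX) · ν) = ν'` for the contragredient representation of `P` on `V^∨`. -/
def HasDualDeriv (ρ : Representation ℂ P V) (X : GroupLieAlgebra 𝓘(ℝ, E) G)
    (ν ν' : Module.Dual ℂ V) : Prop :=
  ∃ (γ : ℝ → G) (hγ : ∀ t, γ t ∈ P), IsOneParam E γ X ∧
    ∀ v : V, HasDerivAt (fun t => ρ.dual ⟨γ t, hγ t⟩ ν v) (ν' v) 0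

/-- The `U(𝔤)`-submodule of `U(𝔤) ⊗_ℂ V^∨` generated by `X ⊗ ν - 1 ⊗ X · ν`, `X ∈ 𝔭(ℝ)`, `ν ∈ V^∨`.
As `U(𝔭)` is generated by `𝔭(ℝ)`, it is the span of all `u a ⊗ ν - u ⊗ a · ν` with
`u ∈ U(𝔤)`, `a ∈ U(𝔭)`, `ν ∈ V^∨`. -/
def vermaRel (ρ : Representation ℂ P V) : Submodule (Ug E G) (Ug E G ⊗[ℂ] Module.Dual ℂ V) :=
  Submodule.span (Ug E G) {z | ∃ (X : GroupLieAlgebra 𝓘(ℝ, E) G) (ν ν' : Module.Dual ℂ V),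
    HasDualDeriv E ρ X ν ν' ∧ z = toUg E X ⊗ₜ[ℂ] ν - 1 ⊗ₜ[ℂ] ν'}

/-- The generalized Verma module `M_𝔭^𝔤(V^∨) = U(𝔤) ⊗_{U(𝔭)} V^∨`, a left `U(𝔤)`-module. -/
abbrev Verma (ρ : Representation ℂ P V) : Type _ :=
  (Ug E G ⊗[ℂ] Module.Dual ℂ V) ⧸ vermaRel E ρ

/-- The class of `u ⊗ ν` in `U(𝔤) ⊗_{U(𝔭)} V^∨`. -/
def Verma.mk (ρ : Representation ℂ P V) (u : Ug E G) (ν : Module.Dual ℂ V) : Verma E ρ :=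
  (vermaRel E ρ).mkQ (u ⊗ₜ[ℂ] ν)

/-- `p · (u ⊗ ν) = Ad(p) u ⊗ p · ν` on `U(𝔤) ⊗_ℂ V^∨`, as an `Ad(p)`-semilinear map. -/
def tensorAct (ρ : Representation ℂ P V) (p : P) :
    Ug E G ⊗[ℂ] Module.Dual ℂ V →ₛₗ[(AdU E (p : G) : Ug E G →+* Ug E G)]
      Ug E G ⊗[ℂ] Module.Dual ℂ V where
  toFun := TensorProduct.map (AdU E (p : G)).toLinearMap (ρ.dual p)
  map_add' := map_add _
  map_smul' a z := by
    induction z using TensorProduct.induction_on with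
    | zero => simp
    | tmul u ν => simp [TensorProduct.smul_tmul']
    | add x y hx hy => simp only [smul_add, map_add, hx, hy]

lemma HasDualDeriv.conj {ρ : Representation ℂ P V} {X : GroupLieAlgebra 𝓘(ℝ, E) G}
    {ν ν' : Module.Dual ℂ V} (h : HasDualDeriv E ρ X ν ν') (p : P) :
    HasDualDeriv E ρ (Ad E (p : G) X) (ρ.dual p ν) (ρ.dual p ν') := by
  obtain ⟨γ, hγ, hX, hd⟩ := h
  refine ⟨fun t => p * γ t * (p : G)⁻¹, fun t => P.mul_mem (P.mul_mem p.2 (hγ t)) (P.inv_mem p.2),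
    hX.conj E p, fun v => ?_⟩
  have key : ∀ t, ρ.dual ⟨p * γ t * (p : G)⁻¹,
      P.mul_mem (P.mul_mem p.2 (hγ t)) (P.inv_mem p.2)⟩ (ρ.dual p ν) v =
      ρ.dual ⟨γ t, hγ t⟩ ν (ρ p⁻¹ v) := by
    intro t
    have e : (⟨p * γ t * (p : G)⁻¹, P.mul_mem (P.mul_mem p.2 (hγ t)) (P.inv_mem p.2)⟩ : P) =
        p * ⟨γ t, hγ t⟩ * p⁻¹ := rfl
    rw [e, ← Module.End.mul_apply, ← map_mul, inv_mul_cancel_right, map_mul]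
    rfl
  simp only [key]
  exact hd (ρ p⁻¹ v)

lemma vermaRel_le (ρ : Representation ℂ P V) (p : P) :
    vermaRel E ρ ≤ (vermaRel E ρ).comap (tensorAct E ρ p) := by
  refine Submodule.span_le.2 ?_
  rintro z ⟨X, ν, ν', h, rfl⟩
  refine Submodule.subset_span ⟨_, _, _, h.conj E p, ?_⟩
  rw [map_sub]
  change AdU E (p : G) (toUg E X) ⊗ₜ[ℂ] ρ.dual p ν - AdU E (p : G) 1 ⊗ₜ[ℂ] ρ.dual p ν' = _
  rw [AdU_toUg, map_one]

/-- The action of `P` on the generalized Verma module, `p · (u ⊗ ν) = Ad(p) u ⊗ p · ν`. -/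
def Verma.act (ρ : Representation ℂ P V) (p : P) :
    Verma E ρ →ₛₗ[(AdU E (p : G) : Ug E G →+* Ug E G)] Verma E ρ :=
  Submodule.mapQ _ _ (tensorAct E ρ p) (vermaRel_le E ρ p)

lemma Verma.act_smul (ρ : Representation ℂ P V) (p : P) (c : ℂ) (m : Verma E ρ) :
    Verma.act E ρ p (c • m) = c • Verma.act E ρ p m := by
  have h : ∀ z : Verma E ρ, c • z = (algebraMap ℂ (Ug E G) c) • z := fun z => by
    rw [algebraMap_smul]
  rw [h, h, map_smulₛₗ]
  congr 1
  exact (AdU E (p : G)).commutes c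

end Verma

/-! ## Induced representations, jets and differential operators -/

section Induced

variable (E : Type*) [NormedAddCommGroup E] [NormedSpace ℝ E] [FiniteDimensional ℝ E]
  {G : Type*} [TopologicalSpace G] [ChartedSpace E G] [Group G] [LieGroup 𝓘(ℝ, E) ∞ G]
  {V : Type*} [NormedAddCommGroup V] [NormedSpace ℂ V] [FiniteDimensional ℂ V]
  {P : Subgroup G}

/-- `Ind_P^G(V) = C^∞(G, V)^P`: the smooth sections of `G ×_P V → G/P`, i.e. the smooth functions
`f : G → V` with `f (g p) = p⁻¹ · f g`. -/
def Ind (ρ : Representation ℂ P V) : Submodule ℂ (G → V) where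
  carrier := {f | ContMDiff 𝓘(ℝ, E) 𝓘(ℝ, V) ∞ f ∧ ∀ (g : G) (p : P), f (g * p) = ρ p⁻¹ (f g)}
  zero_mem' := ⟨contMDiff_const, fun g p => by simp⟩
  add_mem' {a b} ha hb := ⟨ha.1.add hb.1, fun g p => by simp [ha.2, hb.2]⟩
  smul_mem' c a ha := ⟨by
    have h : ContMDiff 𝓘(ℝ, V) 𝓘(ℝ, V) ∞ (fun v : V => c • v) :=
      (contDiff_const_smul c).contMDiff
    exact h.comp ha.1, fun g p => by simp [ha.2]⟩

/-- The representation of `G` on `Ind_P^G(V)` by left translations, `(a · f) g = f (a⁻¹ g)`. -/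
def Ind.translate (ρ : Representation ℂ P V) (a : G) : Ind E ρ →ₗ[ℂ] Ind E ρ where
  toFun f := ⟨fun g => f.1 (a⁻¹ * g),
    f.2.1.comp (contMDiff_mul_left (I := 𝓘(ℝ, E)) (n := ∞) (a := a⁻¹)),
    fun g p => by
      change f.1 (a⁻¹ * (g * p)) = _
      rw [← mul_assoc]; exact f.2.2 _ _⟩
  map_add' _ _ := rfl
  map_smul' _ _ := rfl

/-- The expression of a function on `G` in the chart at `1 ∈ G`. -/
def inChart (f : G → V) : E → V := f ∘ (extChartAt 𝓘(ℝ, E) (1 : G)).symm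

lemma contDiffAt_inChart (ρ : Representation ℂ P V) (f : Ind E ρ) :
    ContDiffAt ℝ ∞ (inChart E f.1) (extChartAt 𝓘(ℝ, E) (1 : G) 1) := by
  have h := (contMDiffAt_iff.1 (f.2.1.contMDiffAt (x := (1 : G)))).2
  simpa only [inChart, extChartAt_model_space_eq_id, PartialEquiv.refl_coe, Function.id_comp,
    modelWithCornersSelf_coe, Set.range_id, contDiffWithinAt_univ] using h

/-- The `f ∈ C^∞(G, V)^P` whose `k`-jet at `1 ∈ G` vanishes: all partial derivatives of order `≤ k`
at `1` in a chart are zero. -/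
def vanishJet (ρ : Representation ℂ P V) (k : ℕ) : Submodule ℂ (Ind E ρ) where
  carrier := {f | ∀ m ≤ k,
    iteratedFDeriv ℝ m (inChart E f.1) (extChartAt 𝓘(ℝ, E) (1 : G) 1) = 0}
  zero_mem' m _ := by
    have : inChart E ((0 : Ind E ρ) : G → V) = fun _ => 0 := rfl
    rw [this, iteratedFDeriv_fun_zero]; rfl
  add_mem' {a b} ha hb m hm := by
    have e : inChart E ((a + b : Ind E ρ) : G → V) = inChart E a.1 + inChart E b.1 := rfl
    have hm' : ((m : ℕ) : WithTop ℕ∞) ≤ ∞ := by exact_mod_cast le_top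
    rw [e, iteratedFDeriv_add_apply ((contDiffAt_inChart E ρ a).of_le hm')
      ((contDiffAt_inChart E ρ b).of_le hm'), ha m hm, hb m hm, add_zero]
  smul_mem' c a ha m hm := by
    have e : inChart E ((c • a : Ind E ρ) : G → V) = c • inChart E a.1 := rfl
    have hm' : ((m : ℕ) : WithTop ℕ∞) ≤ ∞ := by exact_mod_cast le_top
    rw [e, iteratedFDeriv_const_smul_apply ((contDiffAt_inChart E ρ a).of_le hm'), ha m hm,
      smul_zero]

/-- `J^k_e(G, V)^P`: the `k`-jets at the identity of elements of `C^∞(G, V)^P`. This is the fibre at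
the base point `o = eP` of the jet bundle of `𝒱 = G ×_P V`, and `J^k 𝒱 = G ×_P J^k_e(G, V)^P`. -/
abbrev Jet (ρ : Representation ℂ P V) (k : ℕ) : Type _ := Ind E ρ ⧸ vanishJet E ρ k

/-- The `k`-jet of `f` at `1`. -/
def jet (ρ : Representation ℂ P V) (k : ℕ) : Ind E ρ →ₗ[ℂ] Jet E ρ k := (vanishJet E ρ k).mkQ

lemma vanishJet_anti (ρ : Representation ℂ P V) {k l : ℕ} (h : k ≤ l) :
    vanishJet E ρ l ≤ vanishJet E ρ k := fun _ hf m hm => hf m (hm.trans h)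

/-- The left-invariant derivative `(∂_X f)(g) = d/dt|₀ f (g exp (tX))`. -/
def leftDeriv (X : GroupLieAlgebra 𝓘(ℝ, E) G) (f : G → V) : G → V := fun g =>
  mfderiv 𝓘(ℝ, E) 𝓘(ℝ, V) f g (mulInvariantVectorField X g)

end Induced

section Pairs

variable (E : Type*) [NormedAddCommGroup E] [NormedSpace ℝ E] [FiniteDimensional ℝ E]
  {G : Type*} [TopologicalSpace G] [ChartedSpace E G] [Group G] [LieGroup 𝓘(ℝ, E) ∞ G]
  (E' : Type*) [NormedAddCommGroup E'] [NormedSpace ℝ E'] [FiniteDimensional ℝ E']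
  {G' : Type*} [TopologicalSpace G'] [ChartedSpace E' G'] [Group G'] [LieGroup 𝓘(ℝ, E') ∞ G']
  (i : G' →* G) {P : Subgroup G}
  {V : Type*} [NormedAddCommGroup V] [NormedSpace ℂ V] [FiniteDimensional ℂ V]
  {V' : Type*} [NormedAddCommGroup V'] [NormedSpace ℂ V'] [FiniteDimensional ℂ V']
  (ρ : Representation ℂ P V) (ρ' : Representation ℂ (P.comap i) V')

/-- A smooth bundle map `i^* J^k 𝒱 → 𝒱'` over `G'/P'`, where `P' = P ∩ G'` (that is, `i⁻¹ P`),
`i^* J^k 𝒱 = G' ×_{P'} J^k_e(G, V)^P` and `𝒱' = G' ×_{P'} V'`: a smooth function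
`q : G' → Hom(J^k_e(G, V)^P, V')` with `q (g' p') = p'⁻¹ ∘ q g' ∘ p'`; the bundle map sends
`[g', j]` to `[g', q g' j]`. -/
structure IsBundleMap (k : ℕ) (q : G' → (Jet E ρ k →ₗ[ℂ] V')) : Prop where
  smooth : ∀ j : Jet E ρ k, ContMDiff 𝓘(ℝ, E') 𝓘(ℝ, V') ∞ (fun g' => q g' j)
  equivariant : ∀ (g' : G') (p' : P.comap i) (f : Ind E ρ),
    q (g' * p') (jet E ρ k f) = ρ' p'⁻¹ (q g' (jet E ρ k (Ind.translate E ρ (i p') f)))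

/-- `D : Ind_P^G(V) → Ind_{P'}^{G'}(V')` is a differential operator of order (at most) `k`:
`D = Q ∘ i^* ∘ J^k` for a smooth bundle map `Q : i^* J^k 𝒱 → 𝒱'`. The section `J^k f` of
`J^k 𝒱 = G ×_P J^k_e(G, V)^P` is the function sending `g` to the `k`-jet at `1` of `x ↦ f (g x)`. -/
def IsDiffOp (k : ℕ) (D : Ind E ρ →ₗ[ℂ] Ind E' ρ') : Prop :=
  ∃ q : G' → (Jet E ρ k →ₗ[ℂ] V'), IsBundleMap E E' i ρ ρ' k q ∧
    ∀ (f : Ind E ρ) (g' : G'), (D f).1 g' = q g' (jet E ρ k (Ind.translate E ρ (i g')⁻¹ f))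

variable {E E' i ρ ρ'} in
lemma IsDiffOp.mono {k l : ℕ} (h : k ≤ l) {D : Ind E ρ →ₗ[ℂ] Ind E' ρ'}
    (hD : IsDiffOp E E' i ρ ρ' k D) : IsDiffOp E E' i ρ ρ' l D := by
  obtain ⟨q, hq, hDq⟩ := hD
  exact ⟨fun g' => q g' ∘ₗ Submodule.factor (vanishJet_anti E ρ h),
    ⟨fun j => hq.smooth _, fun g' p' f => hq.equivariant g' p' f⟩, fun f g' => hDq f g'⟩

variable {E E' i ρ ρ'} in
lemma IsDiffOp.add {k : ℕ} {D₁ D₂ : Ind E ρ →ₗ[ℂ] Ind E' ρ'} (h₁ : IsDiffOp E E' i ρ ρ' k D₁)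
    (h₂ : IsDiffOp E E' i ρ ρ' k D₂) : IsDiffOp E E' i ρ ρ' k (D₁ + D₂) := by
  obtain ⟨q₁, hq₁, hD₁⟩ := h₁
  obtain ⟨q₂, hq₂, hD₂⟩ := h₂
  refine ⟨q₁ + q₂, ⟨fun j => (hq₁.smooth j).add (hq₂.smooth j), fun g' p' f => ?_⟩, fun f g' => ?_⟩
  · simp only [Pi.add_apply, LinearMap.add_apply, hq₁.equivariant, hq₂.equivariant, map_add]
  · change (D₁ f).1 g' + (D₂ f).1 g' = _
    rw [hD₁, hD₂]; rfl

variable {E E' i ρ ρ'} in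
lemma IsDiffOp.smul {k : ℕ} {D : Ind E ρ →ₗ[ℂ] Ind E' ρ'} (c : ℂ)
    (h : IsDiffOp E E' i ρ ρ' k D) : IsDiffOp E E' i ρ ρ' k (c • D) := by
  obtain ⟨q, hq, hD⟩ := h
  refine ⟨c • q, ⟨fun j => ?_, fun g' p' f => ?_⟩, fun f g' => ?_⟩
  · have h : ContMDiff 𝓘(ℝ, V') 𝓘(ℝ, V') ∞ (fun v : V' => c • v) :=
      (contDiff_const_smul c).contMDiff
    exact h.comp (hq.smooth j)
  · simp only [Pi.smul_apply, LinearMap.smul_apply, hq.equivariant, map_smul]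
  · change c • (D f).1 g' = _
    rw [hD]; rfl

/-- The space of `G'`-equivariant differential operators (of any finite order) from `Ind_P^G(V)` to
`Ind_{P'}^{G'}(V')`. -/
def equivariantDiffOp : Submodule ℂ (Ind E ρ →ₗ[ℂ] Ind E' ρ') where
  carrier := {D | (∃ k, IsDiffOp E E' i ρ ρ' k D) ∧
    ∀ (a : G') (f : Ind E ρ), D (Ind.translate E ρ (i a) f) = Ind.translate E' ρ' a (D f)}
  zero_mem' := by
    refine ⟨⟨0, 0, ⟨fun j => contMDiff_const, fun g' p' f => by simp⟩, fun f g' => rfl⟩,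
      fun a f => by simp⟩
  add_mem' {D₁ D₂} h₁ h₂ := by
    obtain ⟨⟨k₁, hk₁⟩, e₁⟩ := h₁
    obtain ⟨⟨k₂, hk₂⟩, e₂⟩ := h₂
    exact ⟨⟨max k₁ k₂, (hk₁.mono (le_max_left _ _)).add (hk₂.mono (le_max_right _ _))⟩,
      fun a f => by simp only [LinearMap.add_apply, e₁, e₂, map_add]⟩
  smul_mem' c D h := by
    obtain ⟨⟨k, hk⟩, e⟩ := h
    exact ⟨⟨k, hk.smul c⟩, fun a f => by simp only [LinearMap.smul_apply, e, map_smul]⟩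

/-- The differential `𝔤'(ℝ) → 𝔤(ℝ)` of `i : G' → G` at the identity. -/
def dHom (X : GroupLieAlgebra 𝓘(ℝ, E') G') : GroupLieAlgebra 𝓘(ℝ, E) G :=
  mfderiv 𝓘(ℝ, E') 𝓘(ℝ, E) i 1 X

/-- The space of `(𝔤', P')`-homomorphisms `M_{𝔭'}^{𝔤'}(V'^∨) → M_𝔭^𝔤(V^∨)`: the complex linear maps
that commute with the actions of `𝔤'` and of `P'`. -/
def gPHom : Submodule ℂ (Verma E' ρ' →ₗ[ℂ] Verma E ρ) where
  carrier := {φ |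
    (∀ (X : GroupLieAlgebra 𝓘(ℝ, E') G') (m : Verma E' ρ'),
      φ (toUg E' X • m) = toUg E (dHom E E' i X) • φ m) ∧
    ∀ (p' : P.comap i) (m : Verma E' ρ'),
      φ (Verma.act E' ρ' p' m) = Verma.act E ρ ⟨i p', p'.2⟩ (φ m)}
  zero_mem' := ⟨fun X m => by simp, fun p' m => by simp⟩
  add_mem' {φ ψ} h₁ h₂ := ⟨fun X m => by simp only [LinearMap.add_apply, h₁.1, h₂.1, smul_add],
    fun p' m => by simp only [LinearMap.add_apply, h₁.2, h₂.2, map_add]⟩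
  smul_mem' c φ h := ⟨fun X m => by simp only [LinearMap.smul_apply, h.1, smul_comm c],
    fun p' m => by rw [LinearMap.smul_apply, h.2, LinearMap.smul_apply, Verma.act_smul]⟩

end Pairs

end FlagOperator

end

set_option linter.unusedSectionVars false

/-! Everything happens at the identity. A `G'`-equivariant operator `D` is determined by the map `f
↦ (D f)(1)`, which factors through a finite jet of `f` at `1`. The generalized Verma module is, via
the pairing, exactly the space of linear functionals on `Ind` that factor through some finite jet at
`1`. Under this identification `φ_D` is the transpose of `D`, and conversely a homomorphism `φ`
gives back `(D f)(1)` by transposition, hence `D` by translation (`transposeAtOne`, `transposeOp`).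

Existence: a `k`-jet vanishes in a chart if and only if all left-invariant derivatives along words
of length at most `k` in a basis of the Lie algebra vanish at `1` (`vanishesTo_iff_foldr_lder`).
There are finitely many such words, so each functional on `k`-jets is a combination of them, that
is, the pairing with some `m` (`exists_vermaPair_eq`).

Uniqueness of `m` is nondegeneracy of the pairing on the Verma side (`Slice.eq_zero_of_vermaPair`).
Write `𝔤(ℝ) = 𝔫₋ ⊕ 𝔭`. The spanning half of the Poincaré-Birkhoff-Witt theorem shows that ordered
monomials in a basis `Y_j` of `𝔫₋`, with coefficients in `V^∨`, span the module
(`Slice.range_monomialMap`). Their independence comes from analysis: a section equal to `y^b v` near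
`0` in the coordinates `σ(y) = exp(y₁Y₁) ⋯ exp(y_mY_m)` pairs with the monomial of exponent `a` and
coefficient `ν` to `b! ν(v)` if `a = b` and to `0` otherwise (`foldr_lder_monomialList`).

Such sections exist (`Slice.exists_ind`) because the slice `σ` meets each coset `gP` at most once
near `0` and `P` is closed. The first fact rests on `𝔭` being its own normalizer
(`mem_parabolicSubalgebra_of_lie_mem`), which makes `σ` leave the normalizer `P` to first order.
Smoothness of the sections along `P` uses that a continuous finite-dimensional representation is
smooth along one-parameter subgroups (`exists_hasDerivAt_mul_of_continuous`).

Equivariance passes through the pairing since the actions of `P` and of `𝔤` on the Verma module are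
dual to translation and to its derivative (`vermaPair_act`, `IsOneParam.hasDerivAt_vermaPair`). -/

noncomputable section

namespace FlagOperator

open Set Filter Topology

/-! ### Derivatives along vector fields and left-invariant fields -/

section Calculus

variable {E : Type*} [NormedAddCommGroup E] [NormedSpace ℝ E] [FiniteDimensional ℝ E]
  {F : Type*} [NormedAddCommGroup F] [NormedSpace ℝ F]

section Manifold

variable {M : Type*} [TopologicalSpace M] [ChartedSpace E M] [IsManifold 𝓘(ℝ, E) ∞ M]

/-- The derivative of a vector-valued function along a vector field. -/
def vder (V : Π x : M, TangentSpace 𝓘(ℝ, E) x) (f : M → F) : M → F := fun x =>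
  mfderiv 𝓘(ℝ, E) 𝓘(ℝ, F) f x (V x)

open VectorField in
/-- The derivative along the bracket of two vector fields is the commutator of the derivatives. -/
lemma vder_mlieBracket {V W : Π x : M, TangentSpace 𝓘(ℝ, E) x} {f : M → F} {x₀ : M}
    (hf : ContMDiff 𝓘(ℝ, E) 𝓘(ℝ, F) ∞ f)
    (hV : MDifferentiableAt 𝓘(ℝ, E) 𝓘(ℝ, E).tangent
      (fun x => (⟨x, V x⟩ : TangentBundle 𝓘(ℝ, E) M)) x₀)
    (hW : MDifferentiableAt 𝓘(ℝ, E) 𝓘(ℝ, E).tangent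
      (fun x => (⟨x, W x⟩ : TangentBundle 𝓘(ℝ, E) M)) x₀)
    (hfV : MDifferentiable 𝓘(ℝ, E) 𝓘(ℝ, F) (vder V f))
    (hfW : MDifferentiable 𝓘(ℝ, E) 𝓘(ℝ, F) (vder W f)) :
    vder (mlieBracket 𝓘(ℝ, E) V W) f x₀ = vder V (vder W f) x₀ - vder W (vder V f) x₀ := by
  have : IsManifold 𝓘(ℝ, E) 1 M := IsManifold.of_le (n := ∞) (by exact_mod_cast le_top)
  have : IsManifold 𝓘(ℝ, E) 2 M := IsManifold.of_le (n := ∞) ENat.LEInfty.out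
  set φ := extChartAt 𝓘(ℝ, E) x₀ with hφ
  have hx₀ : φ x₀ ∈ φ.target := mem_extChartAt_target x₀
  have hr : range (𝓘(ℝ, E)) = univ := by simp
  -- Reduction to the model space: the pullback of a field through `φ.symm` contains the inverse of
  -- the differential of `φ.symm`, which cancels against the chain rule.
  have key : ∀ (g : M → F), MDifferentiable 𝓘(ℝ, E) 𝓘(ℝ, F) g → ∀ y ∈ φ.target,
      ∀ U : (Π x : M, TangentSpace 𝓘(ℝ, E) x),
      fderiv ℝ (g ∘ φ.symm) y (mpullbackWithin 𝓘(ℝ, E) 𝓘(ℝ, E) φ.symm U (range 𝓘(ℝ, E)) y) =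
        vder U g (φ.symm y) := by
    intro g hg y hy U
    have hs : MDifferentiableAt 𝓘(ℝ, E) 𝓘(ℝ, E) φ.symm y :=
      (mdifferentiableOn_extChartAt_symm y hy).mdifferentiableAt
        ((isOpen_extChartAt_target x₀).mem_nhds hy)
    have h1 := mfderiv_comp (I := 𝓘(ℝ, E)) (I' := 𝓘(ℝ, E)) (I'' := 𝓘(ℝ, F)) y (hg _) hs
    have hinv := isInvertible_mfderivWithin_extChartAt_symm (I := 𝓘(ℝ, E)) hy
    rw [← mfderiv_eq_fderiv, h1, mpullbackWithin_apply]
    have h2 : mfderivWithin 𝓘(ℝ, E) 𝓘(ℝ, E) φ.symm (range 𝓘(ℝ, E)) y =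
        mfderiv 𝓘(ℝ, E) 𝓘(ℝ, E) φ.symm y := by rw [hr, mfderivWithin_univ]
    have h3 := hinv.self_comp_inverse
    rw [← hφ, h2] at h3
    rw [h2]
    exact congrArg (fun T : E →L[ℝ] E => (mfderiv 𝓘(ℝ, E) 𝓘(ℝ, F) g (φ.symm y) : E →L[ℝ] F)
      (T (U (φ.symm y)))) h3
  have hev : ∀ᶠ y in 𝓝 (φ x₀), y ∈ φ.target := (isOpen_extChartAt_target x₀).mem_nhds hx₀
  have hU : ∀ U : (Π x : M, TangentSpace 𝓘(ℝ, E) x), MDifferentiableAt 𝓘(ℝ, E) 𝓘(ℝ, E).tangent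
      (fun x => (⟨x, U x⟩ : TangentBundle 𝓘(ℝ, E) M)) x₀ →
      DifferentiableAt ℝ (mpullbackWithin 𝓘(ℝ, E) 𝓘(ℝ, E) φ.symm U (range 𝓘(ℝ, E))) (φ x₀) := by
    intro U hU
    have := (mdifferentiableWithinAt_univ.2 hU).differentiableWithinAt_mpullbackWithin_vectorField
    rw [preimage_univ, univ_inter] at this
    exact this.differentiableAt (by rw [hr]; exact univ_mem)
  have hc : ContDiffAt ℝ ∞ (f ∘ φ.symm) (φ x₀) := by
    have h := (contMDiffAt_iff.1 (hf.contMDiffAt (x := x₀))).2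
    simpa only [extChartAt_model_space_eq_id, PartialEquiv.refl_coe, Function.id_comp,
      modelWithCornersSelf_coe, Set.range_id, contDiffWithinAt_univ] using h
  -- In a vector space the claim is the symmetry of the second derivative.
  have main := fderiv_apply_lieBracket hc (by
    rw [minSmoothness_of_isRCLikeNormedField]; exact ENat.LEInfty.out) (hU W hW) (hU V hV)
  have hcomm : ∀ U U' : (Π x : M, TangentSpace 𝓘(ℝ, E) x),
      MDifferentiable 𝓘(ℝ, E) 𝓘(ℝ, F) (vder U f) →
      fderiv ℝ (fun y => fderiv ℝ (f ∘ φ.symm) y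
        (mpullbackWithin 𝓘(ℝ, E) 𝓘(ℝ, E) φ.symm U (range 𝓘(ℝ, E)) y)) (φ x₀)
        (mpullbackWithin 𝓘(ℝ, E) 𝓘(ℝ, E) φ.symm U' (range 𝓘(ℝ, E)) (φ x₀)) =
      vder U' (vder U f) x₀ := by
    intro U U' h
    have e : (fun y => fderiv ℝ (f ∘ φ.symm) y
        (mpullbackWithin 𝓘(ℝ, E) 𝓘(ℝ, E) φ.symm U (range 𝓘(ℝ, E)) y)) =ᶠ[𝓝 (φ x₀)]
        vder U f ∘ φ.symm := by
      filter_upwards [hev] with y hy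
      exact key f (hf.mdifferentiable (by simp)) y hy U
    rw [e.fderiv_eq, key _ h _ hx₀ U', extChartAt_to_inv]
  rw [hcomm W V hfW, hcomm V W hfV] at main
  rw [← main]
  -- The manifold bracket is transported back by the inverse of the differential of `φ`, the chain
  -- rule uses the differential of `φ.symm`. The point `y` stands for `φ.symm (φ x₀)`, which equals
  -- `x₀` only propositionally, while tangent spaces depend on the point.
  have hsymm : ∀ y, y = x₀ → ∀ L : E, (mfderiv 𝓘(ℝ, E) 𝓘(ℝ, F) f y
      (mfderivWithin 𝓘(ℝ, E) 𝓘(ℝ, E) φ.symm (range 𝓘(ℝ, E)) (φ x₀) L : E) : F) =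
      mfderiv 𝓘(ℝ, E) 𝓘(ℝ, F) f x₀ ((mfderiv 𝓘(ℝ, E) 𝓘(ℝ, E) φ x₀).inverse L : E) := by
    rintro y rfl L
    have h5 := mfderivWithin_extChartAt_symm_comp_mfderiv_extChartAt' (I := 𝓘(ℝ, E))
      (mem_extChartAt_source (I := 𝓘(ℝ, E)) y)
    have h6 := mfderiv_extChartAt_comp_mfderivWithin_extChartAt_symm' (I := 𝓘(ℝ, E))
      (mem_extChartAt_source (I := 𝓘(ℝ, E)) y)
    have h7 := ContinuousLinearMap.inverse_eq (f := (mfderiv 𝓘(ℝ, E) 𝓘(ℝ, E) φ y : E →L[ℝ] E))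
      (g := (mfderivWithin 𝓘(ℝ, E) 𝓘(ℝ, E) φ.symm (range 𝓘(ℝ, E)) (φ y) : E →L[ℝ] E)) h6 h5
    exact congrArg (fun T : E →L[ℝ] E =>
      (mfderiv 𝓘(ℝ, E) 𝓘(ℝ, F) f y : E →L[ℝ] F) (T L)) h7.symm
  have hs : MDifferentiableAt 𝓘(ℝ, E) 𝓘(ℝ, E) φ.symm (φ x₀) :=
    (mdifferentiableOn_extChartAt_symm _ hx₀).mdifferentiableAt
      ((isOpen_extChartAt_target x₀).mem_nhds hx₀)
  have h1 := mfderiv_comp (I := 𝓘(ℝ, E)) (I' := 𝓘(ℝ, E)) (I'' := 𝓘(ℝ, F)) (φ x₀)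
    (hf.mdifferentiable (by simp) _) hs
  rw [← mfderiv_eq_fderiv, h1]
  have h8 := hsymm _ (extChartAt_to_inv (I := 𝓘(ℝ, E)) x₀) (lieBracket ℝ
    (mpullbackWithin 𝓘(ℝ, E) 𝓘(ℝ, E) φ.symm V (range 𝓘(ℝ, E)))
    (mpullbackWithin 𝓘(ℝ, E) 𝓘(ℝ, E) φ.symm W (range 𝓘(ℝ, E))) (φ x₀))
  have h9 : mfderivWithin 𝓘(ℝ, E) 𝓘(ℝ, E) φ.symm (range 𝓘(ℝ, E)) (φ x₀) =
      mfderiv 𝓘(ℝ, E) 𝓘(ℝ, E) φ.symm (φ x₀) := by rw [hr, mfderivWithin_univ]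
  rw [h9] at h8
  refine Eq.trans ?_ h8.symm
  rw [vder, ← mlieBracketWithin_univ (I := 𝓘(ℝ, E)), mlieBracketWithin_apply, preimage_univ, univ_inter]
  have h10 : ∀ s : Set E, s = univ → ∀ A B : E → E,
      lieBracketWithin ℝ A B s (φ x₀) = lieBracket ℝ A B (φ x₀) := by
    rintro s rfl A B; rw [lieBracketWithin_univ]
  exact congrArg (fun L : E => (mfderiv 𝓘(ℝ, E) 𝓘(ℝ, F) f x₀
    ((mfderiv 𝓘(ℝ, E) 𝓘(ℝ, E) φ x₀).inverse L : E) : F)) (h10 _ hr _ _)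

end Manifold

/-- Charts make points closed, and a T1 topological group is Hausdorff. This is needed for
uniqueness of integral curves and for bump functions. -/
lemma T2Space.of_lieGroup (E : Type*) [NormedAddCommGroup E] [NormedSpace ℝ E] 
    (G : Type*) [TopologicalSpace G] [ChartedSpace E G] [Group G]
    [LieGroup 𝓘(ℝ, E) ∞ G] : T2Space G := by
  have := ChartedSpace.t1Space E G
  have := topologicalGroup_of_lieGroup 𝓘(ℝ, E) ∞ (G := G)
  infer_instance

variable {G : Type*} [TopologicalSpace G] [ChartedSpace E G] [Group G]

/-- The derivative of a function along the left-invariant vector field of `X`. -/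
def lder (X : GroupLieAlgebra 𝓘(ℝ, E) G) (f : G → F) : G → F := fun g =>
  mfderiv 𝓘(ℝ, E) 𝓘(ℝ, F) f g (mulInvariantVectorField X g)

variable [LieGroup 𝓘(ℝ, E) ∞ G]

/-- The field is the tangent map of multiplication `G × G → G` applied to the pair of the zero
vector at `g` and `X` at `1`, hence a composite of smooth maps. -/
lemma contMDiff_mulInvariantVectorField_top (X : GroupLieAlgebra 𝓘(ℝ, E) G) :
    ContMDiff 𝓘(ℝ, E) 𝓘(ℝ, E).tangent ∞
      (fun g => (⟨g, mulInvariantVectorField X g⟩ : TangentBundle 𝓘(ℝ, E) G)) := by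
  let fg : G → TangentBundle 𝓘(ℝ, E) G := fun g => Bundle.TotalSpace.mk' E g 0
  have sfg : ContMDiff 𝓘(ℝ, E) 𝓘(ℝ, E).tangent ∞ fg := Bundle.contMDiff_zeroSection _ _
  let fv : G → TangentBundle 𝓘(ℝ, E) G := fun _ => Bundle.TotalSpace.mk' E 1 X
  have sfv : ContMDiff 𝓘(ℝ, E) 𝓘(ℝ, E).tangent ∞ fv := contMDiff_const
  let F₂ : (TangentBundle 𝓘(ℝ, E) G × TangentBundle 𝓘(ℝ, E) G) →
    TangentBundle (𝓘(ℝ, E).prod 𝓘(ℝ, E)) (G × G) :=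
    (equivTangentBundleProd 𝓘(ℝ, E) G 𝓘(ℝ, E) G).symm
  have S₂ : ContMDiff (𝓘(ℝ, E).tangent.prod 𝓘(ℝ, E).tangent)
      (𝓘(ℝ, E).prod 𝓘(ℝ, E)).tangent ∞ F₂ := contMDiff_equivTangentBundleProd_symm
  let F₃ : TangentBundle (𝓘(ℝ, E).prod 𝓘(ℝ, E)) (G × G) → TangentBundle 𝓘(ℝ, E) G :=
    tangentMap (𝓘(ℝ, E).prod 𝓘(ℝ, E)) 𝓘(ℝ, E) (fun p : G × G => p.1 * p.2)
  have S₃ : ContMDiff (𝓘(ℝ, E).prod 𝓘(ℝ, E)).tangent 𝓘(ℝ, E).tangent ∞ F₃ :=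
    ContMDiff.contMDiff_tangentMap (n := ∞) (contMDiff_mul 𝓘(ℝ, E) ∞) le_rfl
  have S := (S₃.comp S₂).comp (sfg.prodMk sfv)
  convert! S with g
  · simp [F₂, F₃, fg, fv]
  · simp only [Function.comp_apply, tangentMap, F₃, F₂, fg, fv]
    rw [mfderiv_prod_eq_add_apply ((contMDiff_mul 𝓘(ℝ, E) ∞).mdifferentiableAt (by simp))]
    exact ((congrArg (· + (mfderiv 𝓘(ℝ, E) 𝓘(ℝ, E) (fun z : G => g * z) 1 X : E))
      (map_zero (mfderiv 𝓘(ℝ, E) 𝓘(ℝ, E) (fun z : G => z * 1) g))).trans (zero_add _)).symm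

lemma lder_contMDiff (X : GroupLieAlgebra 𝓘(ℝ, E) G) {f : G → F}
    (hf : ContMDiff 𝓘(ℝ, E) 𝓘(ℝ, F) ∞ f) : ContMDiff 𝓘(ℝ, E) 𝓘(ℝ, F) ∞ (lder X f) := by
  have : IsManifold 𝓘(ℝ, E) (∞ + 1) G := by
    change IsManifold 𝓘(ℝ, E) ∞ G; infer_instance
  have h1 : ContMDiff 𝓘(ℝ, E).tangent 𝓘(ℝ, F).tangent ∞ (tangentMap 𝓘(ℝ, E) 𝓘(ℝ, F) f) :=
    hf.contMDiff_tangentMap le_rfl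
  have h2 := h1.comp (contMDiff_mulInvariantVectorField_top X)
  have h3 := (contMDiff_snd_tangentBundle_modelSpace F 𝓘(ℝ, F) (n := ∞)).comp h2
  exact h3

lemma lder_lie (X Y : GroupLieAlgebra 𝓘(ℝ, E) G) {f : G → F}
    (hf : ContMDiff 𝓘(ℝ, E) 𝓘(ℝ, F) ∞ f) :
    lder ⁅X, Y⁆ f = lder X (lder Y f) - lder Y (lder X f) := by
  ext g
  have h := vder_mlieBracket (x₀ := g) hf (mdifferentiableAt_mulInvariantVectorField X)
    (mdifferentiableAt_mulInvariantVectorField Y)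
    ((lder_contMDiff X hf).mdifferentiable (by simp))
    ((lder_contMDiff Y hf).mdifferentiable (by simp))
  rwa [← mulInvariantVector_mlieBracket] at h

end Calculus

/-! ### One-parameter subgroups and the derivative of the adjoint action -/

section OneParameter

variable {E : Type*} [NormedAddCommGroup E] [NormedSpace ℝ E] [FiniteDimensional ℝ E]
  {F : Type*} [NormedAddCommGroup F] [NormedSpace ℝ F]

/-- A solution of an autonomous ordinary differential equation is as smooth as the equation. -/
lemma contDiffAt_of_eventually_hasDerivAt {x : ℝ → E} {w : E → E} {t₀ : ℝ}
    (hw : ContDiffAt ℝ ∞ w (x t₀)) (hx : ∀ᶠ t in 𝓝 t₀, HasDerivAt x (w (x t)) t) :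
    ContDiffAt ℝ ∞ x t₀ := by
  rw [contDiffAt_infty]
  intro n
  induction n with
  | zero =>
    refine contDiffAt_zero.2 ⟨{t | HasDerivAt x (w (x t)) t}, hx, fun t ht => ?_⟩
    exact (ht : HasDerivAt _ _ _).continuousAt.continuousWithinAt
  | succ n ih =>
    push_cast
    -- Bootstrapping: `x' = w ∘ x` is as smooth as `x`, so one order of smoothness is gained.
    refine contDiffAt_succ_iff_hasFDerivAt.2
      ⟨fun t => ContinuousLinearMap.toSpanSingleton ℝ (w (x t)),
        ⟨_, hx, fun t ht => (ht : HasDerivAt _ _ _).hasFDerivAt⟩, ?_⟩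
    have h1 : ContDiffAt ℝ n (fun t => w (x t)) t₀ :=
      (hw.of_le (by exact_mod_cast le_top)).comp t₀ ih
    have h2 : ContDiff ℝ n (ContinuousLinearMap.smulRightL ℝ ℝ E 1) :=
      ContinuousLinearMap.contDiff _
    refine (h2.contDiffAt.comp t₀ h1).congr_of_eventuallyEq (Eventually.of_forall fun t => ?_)
    ext
    simp

lemma hasDerivAt_fderiv_smul_apply {A : Type*} [NormedAddCommGroup A] [NormedSpace ℝ A] {k : A → F}
    (hk : ContDiff ℝ ∞ k) (u w : A) :
    HasDerivAt (fun t : ℝ => fderiv ℝ k (t • u) w) (fderiv ℝ (fderiv ℝ k) 0 u w) 0 := by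
  have hDs : ContDiff ℝ ∞ (fderiv ℝ k) := hk.fderiv_right (m := ∞) le_rfl
  have h1 : HasFDerivAt (fderiv ℝ k) (fderiv ℝ (fderiv ℝ k) 0) ((0 : ℝ) • u) := by
    rw [zero_smul]; exact ((hDs.differentiable (by simp)) 0).hasFDerivAt
  have h2 : HasDerivAt (fun s : ℝ => s • u) u 0 := by
    simpa using (hasDerivAt_id (0 : ℝ)).smul_const u
  have h3 : HasDerivAt (fun s : ℝ => fderiv ℝ k (s • u)) (fderiv ℝ (fderiv ℝ k) 0 u) 0 :=
    h1.comp_hasDerivAt 0 h2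
  exact (ContinuousLinearMap.apply ℝ F w).hasFDerivAt.comp_hasDerivAt 0 h3

/-- In a chart the curve solves an autonomous equation whose right-hand side is the coordinate
expression of `v`. -/
lemma IsMIntegralCurve.contMDiff {M : Type*} [TopologicalSpace M] [ChartedSpace E M]
    [IsManifold 𝓘(ℝ, E) ∞ M] {v : Π x : M, TangentSpace 𝓘(ℝ, E) x} {γ : ℝ → M}
    (hγ : IsMIntegralCurve γ v)
    (hv : ContMDiff 𝓘(ℝ, E) 𝓘(ℝ, E).tangent ∞ (fun x => (⟨x, v x⟩ : TangentBundle 𝓘(ℝ, E) M))) :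
    ContMDiff 𝓘(ℝ, ℝ) 𝓘(ℝ, E) ∞ γ := by
  have : IsManifold 𝓘(ℝ, E) 1 M := IsManifold.of_le (n := ∞) (by exact_mod_cast le_top)
  intro t₀
  have hc : Continuous γ := hγ.continuous
  refine contMDiffAt_iff.2 ⟨hc.continuousAt, ?_⟩
  set φ := extChartAt 𝓘(ℝ, E) (γ t₀) with hφ
  suffices h : ContDiffAt ℝ ∞ (φ ∘ γ) t₀ by
    simpa only [extChartAt_model_space_eq_id, PartialEquiv.refl_coe, Function.comp_id,
      PartialEquiv.refl_symm, id, modelWithCornersSelf_coe, Set.range_id, contDiffWithinAt_univ]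
      using h
  have hd := (hγ.isMIntegralCurveAt t₀).eventually_hasDerivAt
  have h1 := (contMDiffAt_iff.1 (hv.contMDiffAt (x := γ t₀))).2
  have h2 := (h1.contDiffAt (by simp)).snd
  refine contDiffAt_of_eventually_hasDerivAt h2 ?_
  have hs : ∀ᶠ t in 𝓝 t₀, γ t ∈ φ.source :=
    hc.continuousAt.eventually (extChartAt_source_mem_nhds (γ t₀))
  filter_upwards [hd, hs] with t h3 h4
  refine h3.congr_deriv ?_
  have h5 : φ.symm ((φ ∘ γ) t) = γ t := φ.left_inv h4
  change _ = (tangentCoordChange 𝓘(ℝ, E) (φ.symm ((φ ∘ γ) t)) (γ t₀) (φ.symm ((φ ∘ γ) t)))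
    (v (φ.symm ((φ ∘ γ) t)))
  rw [h5]

variable {G : Type*} [TopologicalSpace G] [ChartedSpace E G] [Group G] [LieGroup 𝓘(ℝ, E) ∞ G]

/-- Chain rule for `L_a ∘ L_g = L_{ag}`. -/
lemma mfderiv_mul_left_mulInvariant (a g : G) (X : GroupLieAlgebra 𝓘(ℝ, E) G) :
    mfderiv 𝓘(ℝ, E) 𝓘(ℝ, E) (fun h : G => a * h) g (mulInvariantVectorField X g) =
      mulInvariantVectorField X (a * g) := by
  have hL : ∀ a y : G, MDifferentiableAt 𝓘(ℝ, E) 𝓘(ℝ, E) (fun h : G => a * h) y := fun a y =>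
    (contMDiff_mul_left (I := 𝓘(ℝ, E)) (n := ∞) (a := a)).mdifferentiable (by simp) y
  have e : (fun h : G => a * h) ∘ (fun h : G => g * h) = (fun h : G => a * g * h) := by
    ext k; simp [mul_assoc]
  have h1 := mfderiv_comp (I := 𝓘(ℝ, E)) (I' := 𝓘(ℝ, E)) (I'' := 𝓘(ℝ, E)) (1 : G)
    (hL a (g * 1)) (hL g 1)
  rw [e] at h1
  have hx : ∀ y : G, y = g → ∀ v : E,
      (mfderiv 𝓘(ℝ, E) 𝓘(ℝ, E) (fun h : G => a * h) g v : E) =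
      mfderiv 𝓘(ℝ, E) 𝓘(ℝ, E) (fun h : G => a * h) y v := by
    rintro y rfl v; rfl
  exact (hx _ (mul_one g) _).trans (congrArg (fun T : E →L[ℝ] E => T X) h1.symm)

lemma mulInvariantVectorField_one (X : GroupLieAlgebra 𝓘(ℝ, E) G) :
    mulInvariantVectorField X (1 : G) = X := by
  have e : (fun k : G => (1 : G) * k) = id := by ext; simp
  rw [mulInvariantVectorField, e, mfderiv_id]; rfl

/-- Left translates of the integral curves of a left-invariant vector field. -/
lemma hasMFDerivWithinAt_mul_left {γ : ℝ → G} {X : GroupLieAlgebra 𝓘(ℝ, E) G} {s : Set ℝ} {t : ℝ} (a : G)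
    (h : HasMFDerivWithinAt 𝓘(ℝ, ℝ) 𝓘(ℝ, E) γ s t
      ((1 : ℝ →L[ℝ] ℝ).smulRight (mulInvariantVectorField X (γ t)))) :
    HasMFDerivWithinAt 𝓘(ℝ, ℝ) 𝓘(ℝ, E) (fun t => a * γ t) s t
      ((1 : ℝ →L[ℝ] ℝ).smulRight (mulInvariantVectorField X (a * γ t))) := by
  have hL := ((contMDiff_mul_left (I := 𝓘(ℝ, E)) (n := ∞) (a := a)).mdifferentiable (by simp)
    (γ t)).hasMFDerivAt
  have h2 := hL.comp_hasMFDerivWithinAt t h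
  refine h2.congr_mfderiv ?_
  ext
  have := mfderiv_mul_left_mulInvariant a (γ t) X
  rw [← this]
  exact (map_smul (mfderiv 𝓘(ℝ, E) 𝓘(ℝ, E) (fun h : G => a * h) (γ t)) (1 : ℝ)
    (mulInvariantVectorField X (γ t)))

/-- Since `γ s = γ t * γ (s - t)`, the velocity at `t` is the left translate of the velocity at `0`.
-/
lemma IsOneParam.isMIntegralCurve {γ : ℝ → G} {X : GroupLieAlgebra 𝓘(ℝ, E) G}
    (h : IsOneParam E γ X) : IsMIntegralCurve γ (mulInvariantVectorField X) := by
  intro t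
  have h0 : HasMFDerivAt 𝓘(ℝ, ℝ) 𝓘(ℝ, E) γ 0
      ((1 : ℝ →L[ℝ] ℝ).smulRight (mulInvariantVectorField X (γ 0))) := by
    refine ((h.smooth.mdifferentiable (by simp)) 0).hasMFDerivAt.congr_mfderiv ?_
    ext
    have : ∀ g : G, g = 1 → (mulInvariantVectorField X g : E) = X := by
      rintro g rfl; exact mulInvariantVectorField_one X
    refine Eq.trans h.velocity ((this (γ 0) h.map_zero).symm.trans ?_)
    exact (one_smul ℝ _).symm
  have h1 := hasMFDerivWithinAt_univ.1 (hasMFDerivWithinAt_mul_left (γ t) h0.hasMFDerivWithinAt)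
  have h2 : HasMFDerivAt 𝓘(ℝ, ℝ) 𝓘(ℝ, ℝ) (fun s : ℝ => s - t) t (1 : ℝ →L[ℝ] ℝ) := by
    refine hasMFDerivAt_iff_hasFDerivAt.2 ?_
    exact ((hasFDerivAt_id t).sub_const t)
  have h3 : ∀ a : ℝ, a = 0 → HasMFDerivAt 𝓘(ℝ, ℝ) 𝓘(ℝ, E) (fun s => γ t * γ s) a
      ((1 : ℝ →L[ℝ] ℝ).smulRight (mulInvariantVectorField X (γ t * γ a))) := by
    rintro a rfl; exact h1
  have h4 := HasMFDerivAt.comp (f := fun s : ℝ => s - t) t (h3 (t - t) (sub_self t)) h2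
  have e : (fun s => γ t * γ s) ∘ (fun s : ℝ => s - t) = γ := by
    ext s; simp [← h.map_add]
  rw [e] at h4
  have e2 : ∀ g : G, g = γ t → HasMFDerivAt 𝓘(ℝ, ℝ) 𝓘(ℝ, E) γ t
      (((1 : ℝ →L[ℝ] ℝ).smulRight (mulInvariantVectorField X g : E)).comp (1 : ℝ →L[ℝ] ℝ)) →
      HasMFDerivAt 𝓘(ℝ, ℝ) 𝓘(ℝ, E) γ t
      ((1 : ℝ →L[ℝ] ℝ).smulRight (mulInvariantVectorField X (γ t))) := by
    rintro g rfl h5; exact h5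
  exact e2 _ (by simp [h.map_zero]) h4

/-- Every element of the Lie algebra generates a one-parameter subgroup. -/
lemma exists_isOneParam (X : GroupLieAlgebra 𝓘(ℝ, E) G) : ∃ γ : ℝ → G, IsOneParam E γ X := by
  have := T2Space.of_lieGroup E G
  have : IsManifold 𝓘(ℝ, E) 1 G := IsManifold.of_le (n := ∞) (by exact_mod_cast le_top)
  have hv := contMDiff_mulInvariantVectorField_top X
  have hv1 := hv.of_le (m := 1) (by exact_mod_cast le_top)
  obtain ⟨γ₀, h0, hγ₀⟩ := exists_isMIntegralCurveAt_of_contMDiffAt_boundaryless (t₀ := 0)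
    (hv1.contMDiffAt (x := (1 : G)))
  obtain ⟨ε, hε, hγ₀⟩ := isMIntegralCurveAt_iff'.1 hγ₀
  rw [Real.ball_eq_Ioo, zero_sub, zero_add] at hγ₀
  -- Left translates of one local integral curve exist through every point for the same time `ε`, so
  -- integral curves extend to all of `ℝ`.
  obtain ⟨γ, hγ0, hγ⟩ := exists_isMIntegralCurve_of_isMIntegralCurveOn hv1 hε
    (fun x => ⟨fun t => x * γ₀ t, by simp [h0], fun t ht => hasMFDerivWithinAt_mul_left x (hγ₀ t ht)⟩) 1
  refine ⟨γ, IsMIntegralCurve.contMDiff hγ hv, fun s t => ?_, ?_⟩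
  -- The homomorphism law is uniqueness: `t ↦ γ (t + s)` and `t ↦ γ s * γ t` are integral curves
  -- that agree at `0`.
  · have h1 : IsMIntegralCurve (fun t => γ s * γ t) (mulInvariantVectorField X) := fun t =>
      hasMFDerivWithinAt_univ.1 (hasMFDerivWithinAt_mul_left _ (hγ t).hasMFDerivWithinAt)
    have h2 := isMIntegralCurve_Ioo_eq_of_contMDiff_boundaryless (t₀ := 0) hv1
      (hγ.comp_add s) h1 (by simp [hγ0])
    have := congrFun h2 t
    simpa [add_comm] using this
  · rw [(hγ 0).mfderiv]
    have : ∀ g : G, g = 1 → (mulInvariantVectorField X g : E) = X := by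
      rintro g rfl; exact mulInvariantVectorField_one X
    refine Eq.trans ?_ (this (γ 0) hγ0)
    exact one_smul ℝ _

/-- The derivative of `f` along `t ↦ a exp (tX)` is given by the left-invariant derivative. -/
lemma IsOneParam.hasDerivAt_comp {γ : ℝ → G} {X : GroupLieAlgebra 𝓘(ℝ, E) G}
    (h : IsOneParam E γ X) {f : G → F} (hf : ContMDiff 𝓘(ℝ, E) 𝓘(ℝ, F) ∞ f) (a : G) (t : ℝ) :
    HasDerivAt (fun s => f (a * γ s)) (lder X f (a * γ t)) t := by
  have h1 := hasMFDerivWithinAt_univ.1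
    (hasMFDerivWithinAt_mul_left a (h.isMIntegralCurve t).hasMFDerivWithinAt)
  have h2 := ((hf.mdifferentiable (by simp)) (a * γ t)).hasMFDerivAt.comp t h1
  obtain ⟨L, hL⟩ : ∃ L : E →L[ℝ] F, L = mfderiv 𝓘(ℝ, E) 𝓘(ℝ, F) f (a * γ t) := ⟨_, rfl⟩
  obtain ⟨w, hw⟩ : ∃ w : E, w = mulInvariantVectorField X (a * γ t) := ⟨_, rfl⟩
  have h3 : HasFDerivAt (fun s => f (a * γ s)) (L.comp ((1 : ℝ →L[ℝ] ℝ).smulRight w)) t := by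
    rw [hL, hw]; exact hasMFDerivAt_iff_hasFDerivAt.1 h2
  refine h3.hasDerivAt.congr_deriv ?_
  have h4 : (L.comp ((1 : ℝ →L[ℝ] ℝ).smulRight w)) 1 = L w := by simp
  rw [h4, hL, hw]; rfl

lemma IsOneParam.hasDerivAt_zero {γ : ℝ → G} {X : GroupLieAlgebra 𝓘(ℝ, E) G}
    (h : IsOneParam E γ X) {f : G → F} (hf : ContMDiff 𝓘(ℝ, E) 𝓘(ℝ, F) ∞ f) (a : G) :
    HasDerivAt (fun s => f (a * γ s)) (lder X f a) 0 := by
  simpa [h.map_zero] using h.hasDerivAt_comp hf a 0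

lemma lder_one (X : GroupLieAlgebra 𝓘(ℝ, E) G) (f : G → F) :
    lder X f 1 = mfderiv 𝓘(ℝ, E) 𝓘(ℝ, F) f 1 X := by
  rw [lder, mulInvariantVectorField_one]

/-- There is a smooth function on the group that agrees with the chart near the identity. -/
lemma exists_contMDiff_eventuallyEq_extChartAt (E : Type*) [NormedAddCommGroup E]
    [NormedSpace ℝ E] [FiniteDimensional ℝ E] (G : Type*) [TopologicalSpace G] [ChartedSpace E G]
    [Group G] [LieGroup 𝓘(ℝ, E) ∞ G] :
    ∃ f : G → E, ContMDiff 𝓘(ℝ, E) 𝓘(ℝ, E) ∞ f ∧ f =ᶠ[𝓝 1] extChartAt 𝓘(ℝ, E) (1 : G) := by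
  have := T2Space.of_lieGroup E G
  obtain ⟨b⟩ : Nonempty (SmoothBumpFunction 𝓘(ℝ, E) (1 : G)) := inferInstance
  refine ⟨fun g => b g • extChartAt 𝓘(ℝ, E) (1 : G) g,
    b.contMDiff_smul (contMDiffOn_extChartAt), ?_⟩
  filter_upwards [b.eventuallyEq_one] with g hg
  simp [hg]

/-- The tangent space at `g` is by construction the model space read in the preferred chart at `g`,
so the coordinate change is trivial. -/
lemma mfderiv_extChartAt_self (g : G) (X : E) :
    mfderiv 𝓘(ℝ, E) 𝓘(ℝ, E) (extChartAt 𝓘(ℝ, E) g) g X = X := by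
  have : IsManifold 𝓘(ℝ, E) 1 G := IsManifold.of_le (n := ∞) (by exact_mod_cast le_top)
  have h1 := mfderiv_chartAt_eq_tangentCoordChange (I := 𝓘(ℝ, E)) (mem_chart_source E g)
  have h2 := tangentCoordChange_self (I := 𝓘(ℝ, E)) (v := X) (mem_extChartAt_source (I := 𝓘(ℝ, E)) g)
  refine Eq.trans ?_ h2
  rw [← h1]
  rfl

/-- The chart at `1`, extended by a bump function, separates tangent vectors. -/
lemma ext_of_lder_one {X Y : GroupLieAlgebra 𝓘(ℝ, E) G}
    (h : ∀ f : G → E, ContMDiff 𝓘(ℝ, E) 𝓘(ℝ, E) ∞ f → lder X f 1 = lder Y f 1) : X = Y := by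
  obtain ⟨f, hf, hfe⟩ := exists_contMDiff_eventuallyEq_extChartAt E G
  have h1 := h f hf
  rw [lder_one, lder_one, hfe.mfderiv_eq] at h1
  exact (mfderiv_extChartAt_self (E := E) (1 : G) X).symm.trans
    (h1.trans (mfderiv_extChartAt_self (E := E) (1 : G) Y))

/-- The adjoint action, as a continuous linear map of the model space. -/
def AdL (E : Type*) [NormedAddCommGroup E] [NormedSpace ℝ E] {G : Type*} [TopologicalSpace G]
    [ChartedSpace E G] [Group G] (g : G) : E →L[ℝ] E :=
  mfderiv 𝓘(ℝ, E) 𝓘(ℝ, E) (fun h : G => g * h * g⁻¹) 1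

/-- `Ad g` is the partial differential in `h`, at `h = 1`, of the smooth map `(g, h) ↦ g h g⁻¹`.
Both base points equal `1`, so the coordinate changes in the statement about families of
differentials are identities. -/
lemma contMDiff_AdL : ContMDiff 𝓘(ℝ, E) 𝓘(ℝ, E →L[ℝ] E) ∞ (AdL E : G → E →L[ℝ] E) := by
  have : IsManifold 𝓘(ℝ, E) (∞ + 1) G := by
    change IsManifold 𝓘(ℝ, E) ∞ G; infer_instance
  have : IsManifold 𝓘(ℝ, E) 1 G := IsManifold.of_le (n := ∞) (by exact_mod_cast le_top)
  intro g₀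
  have hm : ContMDiff (𝓘(ℝ, E).prod 𝓘(ℝ, E)) 𝓘(ℝ, E) ∞
      (Function.uncurry fun g h : G => g * h * g⁻¹) := by
    have := topologicalGroup_of_lieGroup 𝓘(ℝ, E) ∞ (G := G)
    exact (contMDiff_fst.mul contMDiff_snd).mul contMDiff_fst.inv
  have h := ContMDiffAt.mfderiv (x₀ := g₀) (fun g h : G => g * h * g⁻¹) (fun _ => (1 : G))
    hm.contMDiffAt contMDiffAt_const (m := ∞) le_rfl
  refine h.congr_of_eventuallyEq (Eventually.of_forall fun g => ?_)
  have hc : ∀ a b c : G, a = 1 → b = 1 → c = 1 → ∀ v : E,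
      (tangentBundleCore 𝓘(ℝ, E) G).coordChange (achart E a) (achart E b) c v = v := by
    rintro a b c rfl rfl rfl v
    exact tangentCoordChange_self (I := 𝓘(ℝ, E)) (mem_extChartAt_source (I := 𝓘(ℝ, E)) (1 : G))
  have h2 := inTangentCoordinates_eq (I := 𝓘(ℝ, E)) (I' := 𝓘(ℝ, E)) (fun _ : G => (1 : G))
    (fun g : G => g * 1 * g⁻¹) (fun g => AdL E g) (x₀ := g₀) (x := g) (mem_chart_source E 1)
    (by simp)
  refine Eq.trans ?_ h2.symm
  ext v
  change _ = (tangentBundleCore 𝓘(ℝ, E) G).coordChange _ _ _ (AdL E g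
    ((tangentBundleCore 𝓘(ℝ, E) G).coordChange _ _ _ v))
  rw [hc _ _ _ rfl rfl rfl, hc _ _ _ (by simp) (by simp) (by simp)]

/-- The derivative of the adjoint action along a one-parameter subgroup is the bracket. -/
lemma IsOneParam.hasDerivAt_AdL {γ : ℝ → G} {X : GroupLieAlgebra 𝓘(ℝ, E) G}
    (h : IsOneParam E γ X) (Z : GroupLieAlgebra 𝓘(ℝ, E) G) :
    HasDerivAt (fun t => (AdL E (γ t) Z : E)) (⁅X, Z⁆ : GroupLieAlgebra 𝓘(ℝ, E) G) 0 := by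
  obtain ⟨δ, hδ⟩ := exists_isOneParam Z
  set A : ℝ → E := fun t => AdL E (γ t) Z with hA
  have hAs : ContDiff ℝ ∞ A := by
    have h1 := (contMDiff_AdL (G := G)).comp h.smooth
    exact h1.contDiff.clm_apply contDiff_const
  have hA' : HasDerivAt A (deriv A 0) 0 := ((hAs.differentiable (by simp)) 0).hasDerivAt
  suffices e : (deriv A 0 : E) = (⁅X, Z⁆ : GroupLieAlgebra 𝓘(ℝ, E) G) by rw [← e]; exact hA'
  refine ext_of_lder_one (G := G) fun f hf => ?_
  have := topologicalGroup_of_lieGroup 𝓘(ℝ, E) ∞ (G := G)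
  -- All terms are second derivatives at `0` of this one function: `X Z f` is the mixed derivative
  -- in the first two variables, `Z X f` in the last two. The direction `(1, 0, -1)` produces `γ t *
  -- δ s * γ (-t)`, the one-parameter subgroup of `Ad (γ t) Z`.
  set k : ℝ × ℝ × ℝ → E := fun p => f (γ p.1 * δ p.2.1 * γ p.2.2) with hk
  have hks : ContDiff ℝ ∞ k := by
    have h1 : ContMDiff 𝓘(ℝ, ℝ × ℝ × ℝ) 𝓘(ℝ, E) ∞ (fun p : ℝ × ℝ × ℝ => γ p.1) :=
      h.smooth.comp contDiff_fst.contMDiff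
    have h2 : ContMDiff 𝓘(ℝ, ℝ × ℝ × ℝ) 𝓘(ℝ, E) ∞ (fun p : ℝ × ℝ × ℝ => δ p.2.1) :=
      hδ.smooth.comp (contDiff_fst.comp contDiff_snd).contMDiff
    have h3 : ContMDiff 𝓘(ℝ, ℝ × ℝ × ℝ) 𝓘(ℝ, E) ∞ (fun p : ℝ × ℝ × ℝ => γ p.2.2) :=
      h.smooth.comp (contDiff_snd.comp contDiff_snd).contMDiff
    exact (hf.comp ((h1.mul h2).mul h3)).contDiff
  have hD1 : ∀ p w, HasDerivAt (fun s : ℝ => k (p + s • w)) (fderiv ℝ k p w) 0 := by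
    intro p w
    have h1 : HasFDerivAt k (fderiv ℝ k p) (p + (0 : ℝ) • w) := by
      simpa using ((hks.differentiable (by simp)) p).hasFDerivAt
    have h2 : HasDerivAt (fun s : ℝ => p + s • w) w 0 := by
      simpa using ((hasDerivAt_id (0 : ℝ)).smul_const w).const_add p
    exact h1.comp_hasDerivAt 0 h2
  set D2 := fderiv ℝ (fderiv ℝ k) 0 with hD2
  have hD : ∀ u w, HasDerivAt (fun t : ℝ => fderiv ℝ k (t • u) w) (D2 u w) 0 := fun u w =>
    hasDerivAt_fderiv_smul_apply hks u w
  have hsymm : ∀ u w, D2 u w = D2 w u := fun u w =>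
    (hks.contDiffAt.isSymmSndFDerivAt
      (by rw [minSmoothness_of_isRCLikeNormedField]; exact ENat.LEInfty.out)) u w
  have e1 : lder X (lder Z f) 1 = D2 (1, 0, 0) (0, 1, 0) := by
    have h1 := h.hasDerivAt_zero (lder_contMDiff Z hf) 1
    refine h1.unique (Eq.mp ?_ (hD (1, 0, 0) (0, 1, 0)))
    congr 1
    ext t
    refine (hD1 (t • (1, 0, 0)) (0, 1, 0)).unique ?_
    simpa [hk, h.map_zero] using hδ.hasDerivAt_zero hf (γ t)
  have e2 : lder Z (lder X f) 1 = D2 (0, 1, 0) (0, 0, 1) := by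
    have h1 := hδ.hasDerivAt_zero (lder_contMDiff X hf) 1
    refine h1.unique (Eq.mp ?_ (hD (0, 1, 0) (0, 0, 1)))
    congr 1
    ext t
    refine (hD1 (t • (0, 1, 0)) (0, 0, 1)).unique ?_
    simpa [hk, h.map_zero] using h.hasDerivAt_zero hf (δ t)
  rw [lder_lie X Z hf, Pi.sub_apply, e1, e2]
  refine (lder_one (E := E) (G := G) _ f).trans ?_
  obtain ⟨L, hL⟩ : ∃ L : E →L[ℝ] E, L = mfderiv 𝓘(ℝ, E) 𝓘(ℝ, E) f 1 := ⟨_, rfl⟩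
  have h4 : HasDerivAt (fun t => L (A t)) (L (deriv A 0)) 0 :=
    L.hasFDerivAt.comp_hasDerivAt 0 hA'
  have h5 : D2 (1, 0, -1) (0, 1, 0) = D2 (1, 0, 0) (0, 1, 0) - D2 (0, 1, 0) (0, 0, 1) := by
    rw [hsymm (0, 1, 0) (0, 0, 1), ← sub_apply, ← map_sub]
    simp
  rw [← h5]
  suffices e3 : L (deriv A 0) = D2 (1, 0, -1) (0, 1, 0) from
    (congrArg (fun T : E →L[ℝ] E => T (deriv A 0)) hL.symm).trans e3
  refine h4.unique (Eq.mp ?_ (hD (1, 0, -1) (0, 1, 0)))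
  congr 1
  ext t
  refine (hD1 (t • (1, 0, -1)) (0, 1, 0)).unique ?_
  have h6 := (hδ.conj E (γ t)).hasDerivAt_zero hf 1
  have e4 : L (A t) = lder (Ad E (γ t) Z) f 1 := by rw [lder_one, hL]; rfl
  rw [e4]
  have h7 : γ (-t) = (γ t)⁻¹ := by
    rw [eq_inv_iff_mul_eq_one, ← h.map_add, neg_add_cancel, h.map_zero]
  simpa [hk, h7] using h6

end OneParameter

/-! ### Parabolic subalgebras and their normalizers -/

section Parabolic

variable {E : Type*} [NormedAddCommGroup E] [NormedSpace ℝ E] [FiniteDimensional ℝ E]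
  {G : Type*} [TopologicalSpace G] [ChartedSpace E G] [Group G] [LieGroup 𝓘(ℝ, E) ∞ G]

instance : FiniteDimensional ℝ (GroupLieAlgebra 𝓘(ℝ, E) G) := inferInstanceAs (FiniteDimensional ℝ E)

/-- The sum of the eigenspaces of `ad x` with negative eigenvalue. -/
def oppositeNilradical (x : GroupLieAlgebra 𝓘(ℝ, E) G) :
    Submodule ℝ (GroupLieAlgebra 𝓘(ℝ, E) G) :=
  ⨆ (c : ℝ) (_ : c < 0), Module.End.eigenspace (LieAlgebra.ad ℝ (GroupLieAlgebra 𝓘(ℝ, E) G) x) c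

lemma isCompl_parabolicSubalgebra {x : GroupLieAlgebra 𝓘(ℝ, E) G} (hx : IsHyperbolic E x) :
    IsCompl (parabolicSubalgebra E x) (oppositeNilradical x) := by
  constructor
  · exact (Module.End.eigenspaces_iSupIndep
      (LieAlgebra.ad ℝ (GroupLieAlgebra 𝓘(ℝ, E) G) x)).disjoint_biSup_biSup
      (s := {c : ℝ | 0 ≤ c}) (t := {c : ℝ | c < 0})
      (Set.disjoint_left.2 fun c (hc : 0 ≤ c) (hc' : c < 0) => not_lt.2 hc hc')
  · rw [codisjoint_iff, eq_top_iff, ← hx]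
    refine iSup_le fun c => ?_
    rcases le_or_gt 0 c with h | h
    · exact le_sup_of_le_left (le_iSup₂_of_le c h le_rfl)
    · exact le_sup_of_le_right (le_iSup₂_of_le c h le_rfl)

/-- By the Jacobi identity the bracket adds eigenvalues of `ad x`, and nonnegative numbers are
closed under addition. -/
lemma lie_mem_parabolicSubalgebra {x X Y : GroupLieAlgebra 𝓘(ℝ, E) G}
    (hX : X ∈ parabolicSubalgebra E x) (hY : Y ∈ parabolicSubalgebra E x) :
    ⁅X, Y⁆ ∈ parabolicSubalgebra E x := by
  have key : ∀ c : ℝ, 0 ≤ c → ∀ d : ℝ, 0 ≤ d →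
      ∀ A ∈ Module.End.eigenspace (LieAlgebra.ad ℝ (GroupLieAlgebra 𝓘(ℝ, E) G) x) c,
      ∀ B ∈ Module.End.eigenspace (LieAlgebra.ad ℝ (GroupLieAlgebra 𝓘(ℝ, E) G) x) d,
      ⁅A, B⁆ ∈ parabolicSubalgebra E x := by
    intro c hc d hd A hA B hB
    refine Submodule.mem_iSup_of_mem (c + d) (Submodule.mem_iSup_of_mem (add_nonneg hc hd) ?_)
    rw [Module.End.mem_eigenspace_iff, LieAlgebra.ad_apply] at hA hB ⊢
    rw [leibniz_lie, hA, hB, smul_lie, lie_smul, add_smul]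
  have h1 : ∀ c : ℝ, 0 ≤ c →
      ∀ A ∈ Module.End.eigenspace (LieAlgebra.ad ℝ (GroupLieAlgebra 𝓘(ℝ, E) G) x) c,
      ⁅A, Y⁆ ∈ parabolicSubalgebra E x := by
    intro c hc A hA
    have : parabolicSubalgebra E x ≤
        (parabolicSubalgebra E x).comap (LieAlgebra.ad ℝ (GroupLieAlgebra 𝓘(ℝ, E) G) A) :=
      iSup₂_le fun d hd B hB => key c hc d hd A hA B hB
    exact this hY
  have : parabolicSubalgebra E x ≤
      (parabolicSubalgebra E x).comap (LieAlgebra.ad ℝ (GroupLieAlgebra 𝓘(ℝ, E) G) Y) :=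
    iSup₂_le fun c hc A hA => by
      have := h1 c hc A hA
      rw [← lie_skew, neg_mem_iff] at this
      exact this
  have h2 := this hX
  rw [Submodule.mem_comap, LieAlgebra.ad_apply, ← lie_skew] at h2
  exact neg_mem_iff.1 h2

/-- The subalgebra is its own normalizer. It contains `x`, so for the component `n` of `Y` in the
negative eigenspaces, `⁅x, n⁆` lies in both summands and vanishes; then `n` has eigenvalue `0`. -/
lemma mem_parabolicSubalgebra_of_lie_mem {x Y : GroupLieAlgebra 𝓘(ℝ, E) G}
    (hx : IsHyperbolic E x) (hY : ∀ w ∈ parabolicSubalgebra E x, ⁅Y, w⁆ ∈ parabolicSubalgebra E x) :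
    Y ∈ parabolicSubalgebra E x := by
  have hxx : x ∈ parabolicSubalgebra E x :=
    Submodule.mem_iSup_of_mem 0 (Submodule.mem_iSup_of_mem le_rfl (by
      rw [Module.End.mem_eigenspace_iff]; simp))
  have hc := isCompl_parabolicSubalgebra hx
  obtain ⟨w, hw, n, hn, rfl⟩ := Submodule.mem_sup.1
    (hc.sup_eq_top ▸ Submodule.mem_top : Y ∈ parabolicSubalgebra E x ⊔ oppositeNilradical x)
  have h1 : ⁅x, n⁆ ∈ parabolicSubalgebra E x := by
    have h2 := hY x hxx
    rw [← lie_skew, neg_mem_iff, lie_add] at h2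
    exact (Submodule.add_mem_iff_right _ (lie_mem_parabolicSubalgebra hxx hw)).1 h2
  have h3 : oppositeNilradical x ≤
      (oppositeNilradical x).comap (LieAlgebra.ad ℝ (GroupLieAlgebra 𝓘(ℝ, E) G) x) :=
    iSup₂_le fun c hc A hA => by
      refine Submodule.mem_iSup_of_mem c (Submodule.mem_iSup_of_mem hc ?_)
      rw [Module.End.mem_eigenspace_iff.1 hA]
      exact Submodule.smul_mem _ _ hA
  have h4 : ⁅x, n⁆ = 0 := by
    have : ⁅x, n⁆ ∈ parabolicSubalgebra E x ⊓ oppositeNilradical x := ⟨h1, h3 hn⟩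
    rwa [hc.inf_eq_bot] at this
  have h5 : n ∈ parabolicSubalgebra E x :=
    Submodule.mem_iSup_of_mem 0 (Submodule.mem_iSup_of_mem le_rfl (by
      rw [Module.End.mem_eigenspace_iff]; simp [h4]))
  exact Submodule.add_mem _ hw h5

/-- `Ad g` is injective, so an inclusion of the image in `W` is an equality by dimension. -/
lemma mem_normalizerOf_iff {W : Submodule ℝ (GroupLieAlgebra 𝓘(ℝ, E) G)} {g : G} :
    g ∈ normalizerOf E W ↔ ∀ w ∈ W, Ad E g w ∈ W := by
  have hinj : Function.Injective (Ad E g) := fun a b h => by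
    rw [← Ad_inv_apply E g a, h, Ad_inv_apply]
  constructor
  · intro (h : W.map (Ad E g) = W) w hw
    rw [← h]; exact Submodule.mem_map_of_mem hw
  · intro h
    refine Submodule.eq_of_le_of_finrank_eq (Submodule.map_le_iff_le_comap.2 h) ?_
    exact (Submodule.equivMapOfInjective _ hinj W).finrank_eq.symm

lemma AdL_mul (g h : G) : AdL E (g * h) = (AdL E g).comp (AdL E h) := by
  ext X
  exact LinearMap.congr_fun (Ad_mul E g h) X

lemma AdL_one : AdL E (1 : G) = ContinuousLinearMap.id ℝ E := by
  ext X
  exact LinearMap.congr_fun (Ad_one E (G := G)) X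

/-- Intersection of preimages of the closed subspace `W` under the continuous maps `g ↦ Ad g w`. -/
lemma isClosed_normalizerOf (W : Submodule ℝ (GroupLieAlgebra 𝓘(ℝ, E) G)) :
    IsClosed (normalizerOf E W : Set G) := by
  have e : (normalizerOf E W : Set G) = ⋂ w ∈ W, {g : G | Ad E g w ∈ W} := by
    ext g
    simp only [SetLike.mem_coe, mem_normalizerOf_iff, mem_iInter]
    rfl
  rw [e]
  let W' : Submodule ℝ E := W
  have hW : IsClosed (W' : Set E) := W'.closed_of_finiteDimensional
  refine isClosed_biInter fun w _ => hW.preimage ?_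
  exact (contMDiff_AdL (E := E) (G := G)).continuous.clm_apply continuous_const

/-- `ad X` as a continuous linear map of the model space. -/
def adL (X : GroupLieAlgebra 𝓘(ℝ, E) G) : E →L[ℝ] E :=
  LinearMap.toContinuousLinearMap
    (LieAlgebra.ad ℝ (GroupLieAlgebra 𝓘(ℝ, E) G) X : E →ₗ[ℝ] E)

lemma IsOneParam.hasDerivAt_AdL_zero {γ : ℝ → G} {X : GroupLieAlgebra 𝓘(ℝ, E) G}
    (h : IsOneParam E γ X) : HasDerivAt (fun t => AdL E (γ t)) (adL X) 0 := by
  have hs : ContDiff ℝ ∞ (fun t => AdL E (γ t)) :=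
    ((contMDiff_AdL (E := E) (G := G)).comp h.smooth).contDiff
  have hd := ((hs.differentiable (by simp)) 0).hasDerivAt
  suffices e : deriv (fun t => AdL E (γ t)) 0 = adL X by rwa [e] at hd
  ext Z
  have h1 := hd.clm_apply (hasDerivAt_const (0 : ℝ) Z)
  rw [_root_.map_zero, add_zero] at h1
  exact h1.unique (h.hasDerivAt_AdL Z)

lemma IsOneParam.hasDerivAt_AdL_comp {γ : ℝ → G} {X : GroupLieAlgebra 𝓘(ℝ, E) G}
    (h : IsOneParam E γ X) (t : ℝ) :
    HasDerivAt (fun t => AdL E (γ t)) ((AdL E (γ t)).comp (adL X)) t := by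
  have h1 : HasDerivAt (fun s => (AdL E (γ t)).comp (AdL E (γ s))) ((AdL E (γ t)).comp (adL X)) 0 :=
    (ContinuousLinearMap.compL ℝ E E E (AdL E (γ t))).hasFDerivAt.comp_hasDerivAt 0
      h.hasDerivAt_AdL_zero
  have h2 : HasDerivAt (fun s => (AdL E (γ t)).comp (AdL E (γ s)))
      ((AdL E (γ t)).comp (adL X)) (t - t) := by rwa [sub_self]
  have h3 := HasDerivAt.scomp (h := fun s => s - t) t h2 ((hasDerivAt_id t).sub_const t)
  rw [one_smul] at h3
  refine h3.congr_of_eventuallyEq (Eventually.of_forall fun s => ?_)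
  simp [← AdL_mul, ← h.map_add]

lemma exists_clm_projection (W : Submodule ℝ (GroupLieAlgebra 𝓘(ℝ, E) G)) :
    ∃ q : E →L[ℝ] E, (∀ w, q w ∈ W) ∧ ∀ w ∈ W, q w = w := by
  obtain ⟨N, hN⟩ := Submodule.exists_isCompl W
  let q : GroupLieAlgebra 𝓘(ℝ, E) G →ₗ[ℝ] GroupLieAlgebra 𝓘(ℝ, E) G :=
    W.subtype ∘ₗ Submodule.projectionOnto W N hN
  refine ⟨LinearMap.toContinuousLinearMap (q : E →ₗ[ℝ] E), fun w => ?_, fun w hw => ?_⟩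
  · exact (Submodule.projectionOnto W N hN w).2
  · exact congrArg Subtype.val (Submodule.projectionOnto_apply_left hN ⟨w, hw⟩)

/-- With a projection `q` onto `W`, the operator `u = (1 - q) Ad(γ t) q` measures how far `γ t` is
from preserving `W`. As `ad X` preserves `W`, it solves the linear equation `u' = u ∘ (ad X ∘ q)`
with `u 0 = 0`, so it is zero. -/
lemma IsOneParam.mem_normalizerOf {γ : ℝ → G} {X : GroupLieAlgebra 𝓘(ℝ, E) G}
    (h : IsOneParam E γ X) {W : Submodule ℝ (GroupLieAlgebra 𝓘(ℝ, E) G)}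
    (hX : ∀ w ∈ W, ⁅X, w⁆ ∈ W) (t : ℝ) : γ t ∈ normalizerOf E W := by
  rw [mem_normalizerOf_iff]
  obtain ⟨q, hq⟩ := exists_clm_projection W
  set u : ℝ → E →L[ℝ] E := fun t =>
    ((ContinuousLinearMap.id ℝ E) - q).comp ((AdL E (γ t)).comp q) with hu
  have hud : ∀ t, HasDerivAt u ((u t).comp ((adL X).comp q)) t := by
    intro t
    have h1 := ((ContinuousLinearMap.compL ℝ E E E (ContinuousLinearMap.id ℝ E - q)).comp
      ((ContinuousLinearMap.compL ℝ E E E).flip q)).hasFDerivAt.comp_hasDerivAt t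
      (h.hasDerivAt_AdL_comp t)
    have h2 : (adL X).comp q = q.comp ((adL X).comp q) := by
      ext w
      exact (hq.2 _ (hX _ (hq.1 w))).symm
    refine h1.congr_deriv ?_
    change (ContinuousLinearMap.id ℝ E - q).comp (((AdL E (γ t)).comp (adL X)).comp q) =
      ((ContinuousLinearMap.id ℝ E - q).comp ((AdL E (γ t)).comp q)).comp ((adL X).comp q)
    rw [ContinuousLinearMap.comp_assoc]
    conv_lhs => rw [h2]
    rfl
  have hu0 : u 0 = 0 := by
    ext w
    simp [hu, h.map_zero, AdL_one, hq.2 _ (hq.1 w)]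
  have hz : u = fun _ => 0 := by
    refine ODE_solution_unique_univ (v := fun _ A => A.comp ((adL X).comp q)) (s := fun _ => univ)
      (K := ‖(adL X).comp q‖₊) (t₀ := 0) (fun t => ?_) (fun t => ⟨hud t, mem_univ _⟩)
      (fun t => ⟨?_, mem_univ _⟩) hu0
    · refine LipschitzWith.lipschitzOnWith (LipschitzWith.of_dist_le_mul fun A B => ?_)
      rw [dist_eq_norm, dist_eq_norm, ← ContinuousLinearMap.sub_comp, mul_comm]
      exact ContinuousLinearMap.opNorm_comp_le _ _
    · simpa using hasDerivAt_const t (0 : E →L[ℝ] E)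
  intro w hw
  have h1 : AdL E (γ t) (q w) - q (AdL E (γ t) (q w)) = 0 :=
    congrArg (fun T : E →L[ℝ] E => T w) (congrFun hz t)
  rw [hq.2 w hw, sub_eq_zero] at h1
  have h2 := hq.1 (AdL E (γ t) w)
  rw [← h1] at h2
  exact h2

end Parabolic

/-! ### Coordinates of the second kind and iterated derivatives -/

section Products

variable {E : Type*} [NormedAddCommGroup E] [NormedSpace ℝ E] [FiniteDimensional ℝ E]
  {F : Type*} [NormedAddCommGroup F] [NormedSpace ℝ F]
  {G : Type*} [TopologicalSpace G] [ChartedSpace E G] [Group G]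
  {ι : Type*}

/-- The product of the elements `γ j (y j)`, in the order of the list `l`: coordinates of the second
kind on the group. -/
def expProd (γ : ι → ℝ → G) (l : List ι) (y : ι → ℝ) : G := (l.map fun j => γ j (y j)).prod

@[simp] lemma expProd_nil (γ : ι → ℝ → G) (y : ι → ℝ) : expProd γ [] y = 1 := rfl

lemma expProd_append (γ : ι → ℝ → G) (l₁ l₂ : List ι) (y : ι → ℝ) :
    expProd γ (l₁ ++ l₂) y = expProd γ l₁ y * expProd γ l₂ y := by simp [expProd]

@[simp] lemma expProd_singleton (γ : ι → ℝ → G) (j : ι) (y : ι → ℝ) :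
    expProd γ [j] y = γ j (y j) := by simp [expProd]

lemma expProd_congr (γ : ι → ℝ → G) {l : List ι} {y z : ι → ℝ} (h : ∀ j ∈ l, y j = z j) :
    expProd γ l y = expProd γ l z := by
  unfold expProd
  exact congrArg List.prod (List.map_congr_left fun j hj => by rw [h j hj])

lemma expProd_zero {γ : ι → ℝ → G} (h0 : ∀ j, γ j 0 = 1) (l : List ι) : expProd γ l 0 = 1 := by
  simp [expProd, h0]

/-- All other factors are `1`; this yields the partial derivatives of the coordinates at `0`. -/
lemma expProd_single [DecidableEq ι] {γ : ι → ℝ → G} (h0 : ∀ j, γ j 0 = 1) {l : List ι}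
    (hl : l.Nodup) {j : ι} (hj : j ∈ l) (s : ℝ) : expProd γ l (Pi.single j s) = γ j s := by
  obtain ⟨l₁, l₂, rfl⟩ := List.append_of_mem hj
  have h1 := List.nodup_middle.1 hl
  rw [List.nodup_cons, List.mem_append, not_or] at h1
  have h2 : ∀ l' : List ι, j ∉ l' → expProd γ l' (Pi.single j s) = 1 := fun l' h' => by
    rw [← expProd_zero h0 l']
    exact expProd_congr γ fun k hk => by
      rw [Pi.single_eq_of_ne (ne_of_mem_of_not_mem hk h')]; rfl
  rw [List.append_cons, expProd_append, expProd_append, h2 _ h1.1.1, h2 _ h1.1.2]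
  simp

lemma expProd_mem {P : Subgroup G} {γ : ι → ℝ → G} (h : ∀ j t, γ j t ∈ P) (l : List ι)
    (y : ι → ℝ) : expProd γ l y ∈ P :=
  Subgroup.list_prod_mem _ fun g hg => by
    obtain ⟨j, -, rfl⟩ := List.mem_map.1 hg
    exact h j _

variable [LieGroup 𝓘(ℝ, E) ∞ G] [Fintype ι]

lemma contMDiff_expProd {γ : ι → ℝ → G} (hγ : ∀ j, ContMDiff 𝓘(ℝ, ℝ) 𝓘(ℝ, E) ∞ (γ j))
    (l : List ι) : ContMDiff 𝓘(ℝ, ι → ℝ) 𝓘(ℝ, E) ∞ (expProd γ l) := by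
  induction l with
  | nil => exact contMDiff_const
  | cons j l ih =>
    have h1 : ContMDiff 𝓘(ℝ, ι → ℝ) 𝓘(ℝ, E) ∞ (fun y : ι → ℝ => γ j (y j)) :=
      (hγ j).comp (contDiff_apply ℝ ℝ j).contMDiff
    have h2 : expProd γ (j :: l) = fun y => γ j (y j) * expProd γ l y := by
      ext y; simp [expProd]
    rw [h2]
    exact h1.mul ih

/-- The list `Y_{j₁}, …, Y_{j₁}, Y_{j₂}, …` in which `Y_j` occurs `a j` times. -/
def monomialList {L : Type*} (Y : ι → L) (a : ι → ℕ) (l : List ι) : List L :=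
  l.flatMap fun j => List.replicate (a j) (Y j)

lemma foldr_lder_contMDiff (Xs : List (GroupLieAlgebra 𝓘(ℝ, E) G)) {f : G → F}
    (hf : ContMDiff 𝓘(ℝ, E) 𝓘(ℝ, F) ∞ f) :
    ContMDiff 𝓘(ℝ, E) 𝓘(ℝ, F) ∞ (Xs.foldr lder f) := by
  induction Xs with
  | nil => exact hf
  | cons X Xs ih => exact lder_contMDiff X ih

lemma IsOneParam.iteratedDeriv_comp {γ : ℝ → G} {X : GroupLieAlgebra 𝓘(ℝ, E) G}
    (h : IsOneParam E γ X) {f : G → F} (hf : ContMDiff 𝓘(ℝ, E) 𝓘(ℝ, F) ∞ f) (a : G) (n : ℕ) :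
    iteratedDeriv n (fun s => f (a * γ s)) =
      fun s => (List.replicate n X).foldr lder f (a * γ s) := by
  induction n with
  | zero => simp
  | succ n ih =>
    rw [iteratedDeriv_succ, ih]
    ext s
    exact (h.hasDerivAt_comp (foldr_lder_contMDiff _ hf) a s).deriv

lemma iteratedDeriv_pow_smul_zero (n b : ℕ) (v : F) :
    iteratedDeriv n (fun s : ℝ => s ^ b • v) 0 = (if n = b then (b.factorial : ℝ) else 0) • v := by
  have h1 : ∀ n : ℕ, iteratedDeriv n (fun s : ℝ => s ^ b • v) =
      fun s => iteratedDeriv n (fun s : ℝ => s ^ b) s • v := by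
    intro n
    induction n with
    | zero => simp
    | succ n ih =>
      rw [iteratedDeriv_succ, ih]
      ext s
      rw [iteratedDeriv_succ, deriv_smul_const]
      exact ((contDiff_id.pow b).differentiable_iteratedDeriv n
        (by exact_mod_cast WithTop.coe_lt_top (n : ℕ∞))) s
  simp only [h1, iteratedDeriv_fun_pow_zero]
  split_ifs <;> simp

/-- A left-invariant derivative differentiates along multiplication on the right, so it acts on the
last factor of the product. Peeling factors off the end, each block of `a j` derivatives hits `s ^ b
j` at `s = 0`, which leaves `(b j)!` or `0`. The list `l₁` holds the factors not yet differentiated,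
and the case of empty `l₁` is the one used later. -/
lemma foldr_lder_monomialList [DecidableEq ι] {γ : ι → ℝ → G} {Y : ι → GroupLieAlgebra 𝓘(ℝ, E) G}
    (hγ : ∀ j, IsOneParam E (γ j) (Y j)) {f : G → F} (hf : ContMDiff 𝓘(ℝ, E) 𝓘(ℝ, F) ∞ f)
    (a b : ι → ℕ) (v : F) (l₂ : List ι) : ∀ l₁ : List ι, (l₁ ++ l₂).Nodup →
    (∀ᶠ y in 𝓝 (0 : ι → ℝ), f (expProd γ (l₁ ++ l₂) y) =
      ((l₁ ++ l₂).map fun j => y j ^ b j).prod • v) →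
    ∀ᶠ y in 𝓝 (0 : ι → ℝ), (monomialList Y a l₂).foldr lder f (expProd γ l₁ y) =
      ((l₁.map fun j => y j ^ b j).prod *
        (l₂.map fun j => if a j = b j then ((b j).factorial : ℝ) else 0).prod) • v := by
  induction l₂ with
  | nil => intro l₁ _ h; simpa [monomialList] using h
  | cons j l₂ ih =>
    intro l₁ hl h
    rw [List.append_cons] at hl h
    have h1 := ih (l₁ ++ [j]) hl h
    have hj : j ∉ l₁ := by
      intro hj
      have h3 := (List.nodup_append.1 hl).1
      exact (List.nodup_append.1 h3).2.2 j hj j (by simp) rfl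
    have hc : ∀ y : ι → ℝ, Continuous fun s => Function.update y j s := fun y =>
      continuous_const.update j continuous_id
    have hu : Tendsto (fun y : ι → ℝ => Function.update y j 0) (𝓝 0) (𝓝 0) := by
      have : Continuous fun y : ι → ℝ => Function.update y j (0 : ℝ) :=
        continuous_id.update j continuous_const
      have h2 := this.tendsto 0
      rwa [show Function.update (0 : ι → ℝ) j (0 : ℝ) = 0 from Function.update_eq_self j _] at h2
    -- The formula must hold on a neighbourhood of the point with `j`-th coordinate `0`, since it is
    -- differentiated in that coordinate.
    filter_upwards [hu.eventually h1.eventually_nhds] with y hy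
    have h2 := ((hc y).tendsto 0).eventually hy
    set F₁ := (monomialList Y a l₂).foldr lder f with hF₁
    set C := (l₂.map fun j => if a j = b j then ((b j).factorial : ℝ) else 0).prod with hC
    have h3 : (fun s => F₁ (expProd γ l₁ y * γ j s)) =ᶠ[𝓝 0]
        fun s => s ^ b j • (((l₁.map fun j => y j ^ b j).prod * C) • v) := by
      filter_upwards [h2] with s hs
      have e1 : expProd γ l₁ (Function.update y j s) = expProd γ l₁ y :=
        expProd_congr γ fun k hk => Function.update_of_ne (ne_of_mem_of_not_mem hk hj) _ _
      have e2 : (l₁.map fun k => Function.update y j s k ^ b k) = l₁.map fun k => y k ^ b k :=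
        List.map_congr_left fun k hk => by
          rw [Function.update_of_ne (ne_of_mem_of_not_mem hk hj)]
      rw [expProd_append, e1, expProd_singleton, Function.update_self] at hs
      rw [hs, List.map_append, List.prod_append, e2, smul_smul]
      congr 1
      simp
      ring
    have h4 := h3.iteratedDeriv_eq (a j)
    rw [(hγ j).iteratedDeriv_comp (foldr_lder_contMDiff _ hf), iteratedDeriv_pow_smul_zero,
      smul_smul] at h4
    have e3 : monomialList Y a (j :: l₂) = List.replicate (a j) (Y j) ++ monomialList Y a l₂ := rfl
    rw [e3, List.foldr_append]
    simp only [(hγ j).map_zero, mul_one] at h4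
    rw [h4]
    congr 1
    rw [List.map_cons, List.prod_cons]
    ring

end Products

/-! ### Automatic smoothness and the inverse function theorem -/

section Analysis

/-- A continuous one-parameter subgroup of a Banach algebra is differentiable and solves
`R' = R B`. -/
lemma exists_hasDerivAt_mul_of_continuous {A : Type*} [NormedRing A] [NormedAlgebra ℝ A]
    [CompleteSpace A] {R : ℝ → A} (hc : Continuous R) (h0 : R 0 = 1)
    (hadd : ∀ s t, R (s + t) = R s * R t) : ∃ B : A, ∀ t, HasDerivAt R (R t * B) t := by
  have hi : ∀ a b : ℝ, IntervalIntegrable R MeasureTheory.volume a b := fun a b =>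
    hc.intervalIntegrable a b
  have hd : ∀ t, HasDerivAt (fun t => ∫ s in (0 : ℝ)..t, R s) (R t) t := fun t =>
    intervalIntegral.integral_hasDerivAt_right (hi 0 t)
      hc.aestronglyMeasurable.stronglyMeasurableAtFilter hc.continuousAt
  -- The averages of `R` over `[0, ε]` tend to `R 0 = 1`, and units are open, so the integral `C` is
  -- invertible for a suitable `ε`.
  obtain ⟨ε, hε, C, hC⟩ : ∃ ε : ℝ, ε ≠ 0 ∧ ∃ C : Aˣ, (C : A) = ∫ s in (0 : ℝ)..ε, R s := by
    have h1 := (hd 0).tendsto_slope_zero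
    simp only [zero_add, intervalIntegral.integral_same, sub_zero, h0] at h1
    have h2 := h1.eventually (Units.isOpen.mem_nhds (x := (1 : A)) isUnit_one)
    obtain ⟨ε, ⟨u, hu⟩, hε⟩ := (h2.and self_mem_nhdsWithin).exists
    refine ⟨ε, hε, (Units.mk0 ε hε) • u, ?_⟩
    rw [Units.val_smul, hu]
    exact smul_inv_smul₀ hε _
  -- `R t * C` is the integral of `R` over `[t, t + ε]`; solving for `R t` exhibits it as a
  -- differentiable function.
  have hR : ∀ t, R t = ((∫ s in (0 : ℝ)..(t + ε), R s) - ∫ s in (0 : ℝ)..t, R s) * (C⁻¹ : Aˣ) := by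
    intro t
    have h1 : (∫ s in (0 : ℝ)..ε, R t * R s) = R t * ∫ s in (0 : ℝ)..ε, R s :=
      (ContinuousLinearMap.mul ℝ A (R t)).intervalIntegral_comp_comm (hi 0 ε)
    rw [Units.eq_mul_inv_iff_mul_eq, hC, intervalIntegral.integral_interval_sub_left (hi _ _)
      (hi _ _), ← h1]
    simp only [← hadd]
    rw [intervalIntegral.integral_comp_add_left (fun s => R s), add_zero]
  refine ⟨(R ε - 1) * (C⁻¹ : Aˣ), fun t => ?_⟩
  have h1 : HasDerivAt (fun t => ((∫ s in (0 : ℝ)..(t + ε), R s) - ∫ s in (0 : ℝ)..t, R s) *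
      ((C⁻¹ : Aˣ) : A)) ((R (t + ε) - R t) * ((C⁻¹ : Aˣ) : A)) t :=
    (((hd (t + ε)).comp_add_const t ε).sub (hd t)).mul_const _
  rw [← funext hR] at h1
  refine h1.congr_deriv ?_
  rw [hadd, ← mul_assoc, mul_sub, mul_one]

lemma contDiff_of_hasDerivAt_mul {A : Type*} [NormedRing A] [NormedAlgebra ℝ A]
    {R : ℝ → A} {B : A} (h : ∀ t, HasDerivAt R (R t * B) t) : ContDiff ℝ ∞ R := by
  refine contDiff_infty.2 fun n => ?_
  induction n with
  | zero => exact contDiff_zero.2 (continuous_iff_continuousAt.2 fun t => (h t).continuousAt)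
  | succ n ih =>
    rw [show ((n + 1 : ℕ) : WithTop ℕ∞) = (n : WithTop ℕ∞) + 1 from rfl]
    refine contDiff_succ_iff_deriv.2 ⟨fun t => (h t).differentiableAt, by simp, ?_⟩
    rw [funext fun t => (h t).deriv]
    exact ih.mul contDiff_const

/-- Given differentiability, the derivative is determined on the standard basis. -/
lemma hasFDerivAt_of_hasDerivAt_single {J F : Type*} [Fintype J] [DecidableEq J]
    [NormedAddCommGroup F] [NormedSpace ℝ F] {u : (J → ℝ) → F} (hu : DifferentiableAt ℝ u 0)
    {L : (J → ℝ) →L[ℝ] F} (h : ∀ j, HasDerivAt (fun s => u (Pi.single j s)) (L (Pi.single j 1)) 0) :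
    HasFDerivAt u L 0 := by
  suffices e : fderiv ℝ u 0 = L by rw [← e]; exact hu.hasFDerivAt
  refine ContinuousLinearMap.coe_injective (LinearMap.pi_ext' fun j => LinearMap.ext_ring ?_)
  have h1 : HasDerivAt (fun s : ℝ => (Pi.single j s : J → ℝ)) (Pi.single j 1) 0 :=
    (ContinuousLinearMap.single ℝ (fun _ : J => ℝ) j).hasDerivAt
  have h2 : HasFDerivAt u (fderiv ℝ u 0) (Pi.single j (0 : ℝ)) := by
    rw [Pi.single_zero]; exact hu.hasFDerivAt
  exact (h2.comp_hasDerivAt 0 h1).unique (h j)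

variable {E : Type*} [NormedAddCommGroup E] [NormedSpace ℝ E] [FiniteDimensional ℝ E]
  {G : Type*} [TopologicalSpace G] [ChartedSpace E G]
  {Z : Type*} [NormedAddCommGroup Z] [NormedSpace ℝ Z] [FiniteDimensional ℝ Z]

/-- The inverse function theorem for a smooth map from a vector space to a manifold. -/
lemma exists_openPartialHomeomorph_of_hasFDerivAt [IsManifold 𝓘(ℝ, E) ∞ G] {ψ : Z → G}
    (hψ : ContMDiff 𝓘(ℝ, Z) 𝓘(ℝ, E) ∞ ψ) (A : Z ≃L[ℝ] E)
    (hA : HasFDerivAt (fun z => chartAt E (ψ 0) (ψ z)) (A : Z →L[ℝ] E) 0) :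
    ∃ e : OpenPartialHomeomorph Z G, 0 ∈ e.source ∧ (∀ z ∈ e.source, e z = ψ z) ∧
      ContMDiffOn 𝓘(ℝ, E) 𝓘(ℝ, Z) ∞ e.symm e.target := by
  have : CompleteSpace Z := FiniteDimensional.complete ℝ Z
  set c := chartAt E (ψ 0) with hc
  set u : Z → E := fun z => c (ψ z) with hu
  set O : Set Z := ψ ⁻¹' c.source with hO
  have hOo : IsOpen O := c.open_source.preimage hψ.continuous
  have h0 : (0 : Z) ∈ O := mem_chart_source E (ψ 0)
  have huO : ContDiffOn ℝ ∞ u O := by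
    have h1 : ContMDiffOn 𝓘(ℝ, Z) 𝓘(ℝ, E) ∞ u O :=
      (contMDiffOn_chart (I := 𝓘(ℝ, E)) (n := ∞) (x := ψ 0)).comp hψ.contMDiffOn fun z hz => hz
    exact h1.contDiffOn
  have hu0 : ContDiffAt ℝ ∞ u 0 := huO.contDiffAt (hOo.mem_nhds h0)
  -- Restricting to points with invertible derivative makes the inverse smooth on its whole domain,
  -- not only at the image of `0`.
  set O' : Set Z := O ∩ fderiv ℝ u ⁻¹' range ((↑) : (Z ≃L[ℝ] E) → Z →L[ℝ] E) with hO'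
  have hO'o : IsOpen O' :=
    (huO.continuousOn_fderiv_of_isOpen hOo (by exact_mod_cast le_top)).isOpen_inter_preimage hOo
      ContinuousLinearEquiv.isOpen
  have h0' : (0 : Z) ∈ O' := ⟨h0, A, hA.fderiv.symm⟩
  set e₀ := hu0.toOpenPartialHomeomorph u hA (by simp) with he₀
  have he₀c : (e₀ : Z → E) = u := hu0.toOpenPartialHomeomorph_coe hA (by simp)
  set e₁ := e₀.restrOpen O' hO'o with he₁
  have he₁c : (e₁ : Z → E) = u := he₀c
  have hs₁ : ∀ z, z ∈ e₁.source ↔ z ∈ e₀.source ∧ z ∈ O' := fun z => by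
    rw [he₁, OpenPartialHomeomorph.restrOpen_source]; rfl
  have hsm : ContDiffOn ℝ ∞ e₁.symm e₁.target := by
    intro a ha
    have h1 : e₁.symm a ∈ O' := ((hs₁ _).1 (e₁.map_target ha)).2
    obtain ⟨A', hA'⟩ := h1.2
    have h2 : ContDiffAt ℝ ∞ u (e₁.symm a) := huO.contDiffAt (hOo.mem_nhds h1.1)
    refine (e₁.contDiffAt_symm (f₀' := A') ha ?_ ?_).contDiffWithinAt
    · rw [he₁c, hA']; exact (h2.differentiableAt (by simp)).hasFDerivAt
    · rw [he₁c]; exact h2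
  refine ⟨e₁.trans c.symm, ?_, fun z hz => ?_, ?_⟩
  · rw [OpenPartialHomeomorph.trans_source]
    refine ⟨(hs₁ _).2 ⟨hu0.mem_toOpenPartialHomeomorph_source hA (by simp), h0'⟩, ?_⟩
    rw [he₁c]; exact c.map_source h0
  · rw [OpenPartialHomeomorph.trans_source] at hz
    rw [OpenPartialHomeomorph.coe_trans, Function.comp_apply, he₁c]
    exact c.left_inv ((hs₁ _).1 hz.1).2.1
  · rw [OpenPartialHomeomorph.trans_target]
    exact hsm.contMDiffOn.comp ((contMDiffOn_chart (I := 𝓘(ℝ, E)) (n := ∞) (x := ψ 0)).mono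
      inter_subset_left) fun z hz => hz.2

end Analysis

/-! ### Slices transversal to a parabolic subgroup -/

section Slices

variable {E : Type*} [NormedAddCommGroup E] [NormedSpace ℝ E] [FiniteDimensional ℝ E]
  {G : Type*} [TopologicalSpace G] [ChartedSpace E G] [Group G] [LieGroup 𝓘(ℝ, E) ∞ G]

/-- Near `1` the chart agrees with a smooth function on all of `G`, to which the derivative along
`γ` applies. -/
lemma IsOneParam.hasDerivAt_chartAt {γ : ℝ → G} {X : GroupLieAlgebra 𝓘(ℝ, E) G}
    (h : IsOneParam E γ X) : HasDerivAt (fun s => chartAt E (1 : G) (γ s)) (X : E) 0 := by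
  obtain ⟨f, hf, hfe⟩ := exists_contMDiff_eventuallyEq_extChartAt E G
  have h1 := h.hasDerivAt_zero hf 1
  have h2 : lder X f 1 = X := by
    rw [lder_one, hfe.mfderiv_eq]
    exact mfderiv_extChartAt_self (E := E) (1 : G) X
  rw [h2] at h1
  refine h1.congr_of_eventuallyEq ?_
  have h3 : Tendsto γ (𝓝 0) (𝓝 1) := by
    simpa [h.map_zero] using h.smooth.continuous.tendsto 0
  filter_upwards [h3.eventually hfe] with s hs
  simp [hs]

/-- One-parameter subgroups `exp (t Y_j)` and `exp (t X_k)`, the latter in `P`, whose velocities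
form a basis of `𝔤(ℝ)`, such that the coordinates of the second kind in the `Y_j` are transversal to
`P` at the identity. -/
structure Slice (P : Subgroup G) where
  m : ℕ
  n : ℕ
  basis : Module.Basis (Fin m ⊕ Fin n) ℝ (GroupLieAlgebra 𝓘(ℝ, E) G)
  curve : Fin m ⊕ Fin n → ℝ → G
  isOneParam : ∀ j, IsOneParam E (curve j) (basis j)
  curve_mem : ∀ k t, curve (.inr k) t ∈ P
  eventually_eq_zero : ∀ᶠ y in 𝓝 (0 : Fin m → ℝ),
    expProd (fun j => curve (.inl j)) (List.finRange m) y ∈ P → y = 0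
  isClosed : IsClosed (P : Set G)

/-- A parabolic subgroup admits a slice. -/
lemma IsParabolic.nonempty_slice {P : Subgroup G} (hP : IsParabolic E P) :
    Nonempty (Slice (E := E) P) := by
  obtain ⟨x, hx, rfl⟩ := hP
  have hc := isCompl_parabolicSubalgebra hx
  set W := parabolicSubalgebra E x with hW
  set N := oppositeNilradical x with hN
  let b := ((Module.finBasis ℝ N).prod (Module.finBasis ℝ W)).map
    (Submodule.prodEquivOfIsCompl N W hc.symm)
  have hbN : ∀ j, b (.inl j) ∈ N := fun j => by simp [b]
  have hbW : ∀ k, b (.inr k) ∈ W := fun k => by simp [b]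
  choose γ hγ using fun j => exists_isOneParam (b j)
  refine ⟨⟨_, _, b, γ, hγ, fun k t => (hγ _).mem_normalizerOf
    (fun w hw => lie_mem_parabolicSubalgebra (hbW k) hw) t, ?_, isClosed_normalizerOf _⟩⟩
  obtain ⟨q, hqW, hq⟩ := exists_clm_projection W
  set p : E →L[ℝ] E := ContinuousLinearMap.id ℝ E - q with hp
  set σ : (Fin (Module.finrank ℝ N) → ℝ) → G :=
    expProd (fun j => γ (.inl j)) (List.finRange (Module.finrank ℝ N)) with hσ
  have h0 : ∀ j, (fun j => γ (.inl j)) j 0 = 1 := fun j => (hγ (.inl j)).map_zero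
  -- This is the linearization of `u` below: `u y` is the part of `Ad (σ y)` that moves `W` out of
  -- itself, and it vanishes when `σ y` lies in the normalizer.
  let Λ : GroupLieAlgebra 𝓘(ℝ, E) G →ₗ[ℝ] E →L[ℝ] E :=
    { toFun := fun X => p.comp ((adL X).comp q)
      map_add' := fun X Y => by
        ext w
        exact (congrArg p (LinearMap.congr_fun (map_add (LieAlgebra.ad ℝ
          (GroupLieAlgebra 𝓘(ℝ, E) G)) X Y) (q w))).trans (map_add p _ _)
      map_smul' := fun c X => by
        ext w
        exact (congrArg p (LinearMap.congr_fun (map_smul (LieAlgebra.ad ℝ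
          (GroupLieAlgebra 𝓘(ℝ, E) G)) c X) (q w))).trans (map_smul p _ _) }
  let L := Λ ∘ₗ Fintype.linearCombination ℝ (fun j => b (.inl j))
  set u : (Fin (Module.finrank ℝ N) → ℝ) → E →L[ℝ] E :=
    fun y => p.comp ((AdL E (σ y)).comp q) with hu
  have hcomp : ContDiff ℝ ∞ fun y => AdL E (σ y) :=
    ((contMDiff_AdL (E := E) (G := G)).comp
      (contMDiff_expProd (fun j => (hγ (.inl j)).smooth) _)).contDiff
  set T : (E →L[ℝ] E) →L[ℝ] E →L[ℝ] E := (ContinuousLinearMap.compL ℝ E E E p).comp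
      ((ContinuousLinearMap.compL ℝ E E E).flip q) with hT
  have hud : HasFDerivAt u (LinearMap.toContinuousLinearMap L) 0 := by
    refine hasFDerivAt_of_hasDerivAt_single
      (T.differentiable.comp (hcomp.differentiable (by simp)) 0) fun j => ?_
    have h1 := T.hasFDerivAt.comp_hasDerivAt 0 (hγ (.inl j)).hasDerivAt_AdL_zero
    have h2 : L (Pi.single j 1) = T (adL (b (.inl j))) := by
      simp only [L, LinearMap.comp_apply, Fintype.linearCombination_apply_single, one_smul]
      rfl
    rw [LinearMap.coe_toContinuousLinearMap', h2]
    refine h1.congr_of_eventuallyEq (Eventually.of_forall fun s => ?_)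
    exact congrArg (fun g => T (AdL E g))
      (expProd_single h0 (List.nodup_finRange _) (List.mem_finRange _) s)
  -- A vector `Y` of `N` killed by the linearization normalizes `W`, hence lies in `W ⊓ N = ⊥`. Thus
  -- the derivative of `u` at `0` is injective, and `u y ≠ 0` for small nonzero `y`.
  have hL : LinearMap.ker L = ⊥ := by
    refine LinearMap.ker_eq_bot'.2 fun y hy => ?_
    set Y := Fintype.linearCombination ℝ (fun j => b (.inl j)) y with hY
    have hYN : Y ∈ N := by
      rw [hY, Fintype.linearCombination_apply]
      exact Submodule.sum_mem _ fun j _ => N.smul_mem _ (hbN j)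
    have hYW : Y ∈ W := mem_parabolicSubalgebra_of_lie_mem hx fun w hw => by
      have h1 : p ((adL Y) (q w)) = 0 := congrArg (fun T : E →L[ℝ] E => T w) hy
      rw [hq w hw] at h1
      have h2 : (adL Y) w - q ((adL Y) w) = 0 := h1
      have h3 := hqW ((adL Y) w)
      rw [← sub_eq_zero.1 h2] at h3
      exact h3
    have hY0 : Y = 0 := by
      have : Y ∈ W ⊓ N := ⟨hYW, hYN⟩
      rwa [hc.inf_eq_bot] at this
    have hli : LinearIndependent ℝ (fun j => b (.inl j)) :=
      b.linearIndependent.comp _ Sum.inl_injective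
    exact hli.fintypeLinearCombination_injective (by rw [_root_.map_zero]; exact hY0)
  obtain ⟨K, -, hK⟩ := LinearMap.exists_antilipschitzWith L hL
  have h1 := hud.eventually_ne (c := 0) ⟨K, hK⟩
  rw [eventually_nhdsWithin_iff] at h1
  filter_upwards [h1] with y hy hyP
  by_contra hne
  refine hy hne ?_
  ext w
  have h2 := mem_normalizerOf_iff.1 hyP _ (hqW w)
  have h3 : q (AdL E (σ y) (q w)) = AdL E (σ y) (q w) := hq _ h2
  simp [hu, hp, h3]

namespace Slice

variable {P : Subgroup G} (S : Slice (E := E) P)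

/-- The coordinates of the second kind in the directions transversal to `P`. -/
def sect (y : Fin S.m → ℝ) : G := expProd (fun j => S.curve (.inl j)) (List.finRange S.m) y

/-- The coordinates of the second kind on `P`. -/
def para (t : Fin S.n → ℝ) : P :=
  ⟨expProd (fun k => S.curve (.inr k)) (List.finRange S.n) t, expProd_mem S.curve_mem _ _⟩

lemma sect_zero : S.sect 0 = 1 := expProd_zero (fun _ => (S.isOneParam _).map_zero) _

lemma contMDiff_sect : ContMDiff 𝓘(ℝ, Fin S.m → ℝ) 𝓘(ℝ, E) ∞ S.sect :=
  contMDiff_expProd (fun _ => (S.isOneParam _).smooth) _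

/-- Coordinates near the identity adapted to `P`. -/
lemma exists_coord : ∃ e : OpenPartialHomeomorph (Fin S.m ⊕ Fin S.n → ℝ) G, 0 ∈ e.source ∧
    (∀ z ∈ e.source, e z = S.sect (fun j => z (.inl j)) * S.para (fun k => z (.inr k))) ∧
    ContMDiffOn 𝓘(ℝ, E) 𝓘(ℝ, Fin S.m ⊕ Fin S.n → ℝ) ∞ e.symm e.target := by
  set l : List (Fin S.m ⊕ Fin S.n) :=
    (List.finRange S.m).map .inl ++ (List.finRange S.n).map .inr with hl
  have hnd : l.Nodup := by
    refine List.Nodup.append ((List.nodup_finRange _).map Sum.inl_injective)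
      ((List.nodup_finRange _).map Sum.inr_injective) ?_
    simp [List.disjoint_left]
  have hmem : ∀ j, j ∈ l := by rintro (j | k) <;> simp [hl]
  have h0 : ∀ j, S.curve j 0 = 1 := fun j => (S.isOneParam j).map_zero
  have hψ : ContMDiff 𝓘(ℝ, Fin S.m ⊕ Fin S.n → ℝ) 𝓘(ℝ, E) ∞ (expProd S.curve l) :=
    contMDiff_expProd (fun j => (S.isOneParam j).smooth) _
  let A₀ : (Fin S.m ⊕ Fin S.n → ℝ) ≃ₗ[ℝ] E := S.basis.equivFun.symm
  let A : (Fin S.m ⊕ Fin S.n → ℝ) ≃L[ℝ] E := A₀.toContinuousLinearEquiv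
  obtain ⟨e, he0, hes, hsm⟩ := exists_openPartialHomeomorph_of_hasFDerivAt hψ A (by
    refine hasFDerivAt_of_hasDerivAt_single ?_ fun j => ?_
    · have h1 : ContMDiffAt 𝓘(ℝ, Fin S.m ⊕ Fin S.n → ℝ) 𝓘(ℝ, E) ∞
          (fun z => chartAt E (expProd S.curve l 0) (expProd S.curve l z)) 0 :=
        ContMDiffAt.comp 0 ((contMDiffOn_chart (I := 𝓘(ℝ, E)) (n := ∞)).contMDiffAt
          ((chartAt E (expProd S.curve l 0)).open_source.mem_nhds (mem_chart_source E _)))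
          hψ.contMDiffAt
      exact h1.contDiffAt.differentiableAt (by simp)
    · rw [expProd_zero h0]
      have h2 : (A : (Fin S.m ⊕ Fin S.n → ℝ) →L[ℝ] E) (Pi.single j 1) = S.basis j := by
        change S.basis.equivFun.symm (Pi.single j 1) = S.basis j
        simp
      rw [h2]
      refine (S.isOneParam j).hasDerivAt_chartAt.congr_of_eventuallyEq
        (Eventually.of_forall fun s => ?_)
      exact congrArg (chartAt E (1 : G)) (expProd_single h0 hnd (hmem j) s))
  refine ⟨e, he0, fun z hz => ?_, hsm⟩
  rw [hes z hz, expProd_append]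
  simp only [expProd, List.map_map]
  rfl

/-- The slice meets the right cosets of `P` at most once, near the identity. -/
lemma eventually_injective : ∃ A ∈ 𝓝 (0 : Fin S.m → ℝ), ∀ y ∈ A, ∀ y' ∈ A, ∀ p : P,
    S.sect y = S.sect y' * p → y = y' := by
  have := topologicalGroup_of_lieGroup 𝓘(ℝ, E) ∞ (G := G)
  obtain ⟨e, he0, he, hsm⟩ := S.exists_coord
  have he0' : e 0 = 1 := by
    rw [he 0 he0]
    change S.sect 0 * S.para 0 = 1
    rw [sect_zero, one_mul]
    exact expProd_zero (fun _ => (S.isOneParam _).map_zero) _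
  have hc : Continuous fun z : (Fin S.m → ℝ) × (Fin S.m → ℝ) => (S.sect z.2)⁻¹ * S.sect z.1 :=
    (S.contMDiff_sect.continuous.comp continuous_snd).inv.mul
      (S.contMDiff_sect.continuous.comp continuous_fst)
  have hc0 : Tendsto (fun z : (Fin S.m → ℝ) × (Fin S.m → ℝ) => (S.sect z.2)⁻¹ * S.sect z.1)
      (𝓝 (0, 0)) (𝓝 1) := by
    have := hc.tendsto (0, 0)
    simpa [sect_zero] using this
  have h1t : (1 : G) ∈ e.target := he0' ▸ e.map_source he0
  have hs0 : e.symm 1 = 0 := by rw [← he0', e.left_inv he0]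
  have hcs : Tendsto (fun z : (Fin S.m → ℝ) × (Fin S.m → ℝ) =>
      e.symm ((S.sect z.2)⁻¹ * S.sect z.1)) (𝓝 (0, 0)) (𝓝 0) := by
    have h2 := (e.symm.continuousAt (x := 1) h1t).tendsto
    rw [hs0] at h2
    exact h2.comp hc0
  have hl : Tendsto (fun z : Fin S.m ⊕ Fin S.n → ℝ => fun j => z (.inl j)) (𝓝 0) (𝓝 0) :=
    (continuous_pi fun j => continuous_apply (Sum.inl j)).tendsto' _ _ rfl
  have hr : Tendsto (fun z : Fin S.m ⊕ Fin S.n → ℝ => fun j => z (.inr j)) (𝓝 0) (𝓝 0) :=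
    (continuous_pi fun j => continuous_apply (Sum.inr j)).tendsto' _ _ rfl
  have hk : Tendsto (fun z : (Fin S.m → ℝ) × (Fin S.n → ℝ) => (Sum.elim z.1 z.2))
      (𝓝 (0, 0)) (𝓝 (0 : Fin S.m ⊕ Fin S.n → ℝ)) := by
    refine Continuous.tendsto' (continuous_pi fun j => ?_) _ _ ?_
    · rcases j with j | k
      · exact (continuous_apply j).comp continuous_fst
      · exact (continuous_apply k).comp continuous_snd
    · ext (j | k) <;> rfl
  have hk1 : Tendsto (fun z : (Fin S.m → ℝ) × (Fin S.m → ℝ) =>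
      (Sum.elim z.1 0 : Fin S.m ⊕ Fin S.n → ℝ)) (𝓝 (0, 0)) (𝓝 0) :=
    hk.comp ((continuous_fst.prodMk continuous_const).tendsto' _ _ rfl)
  have hk2 : Tendsto (fun z : (Fin S.m → ℝ) × (Fin S.m → ℝ) =>
      (Sum.elim z.2 (fun k => e.symm ((S.sect z.2)⁻¹ * S.sect z.1) (.inr k)) :
        Fin S.m ⊕ Fin S.n → ℝ)) (𝓝 (0, 0)) (𝓝 0) :=
    hk.comp ((continuous_snd.tendsto' _ _ rfl).prodMk_nhds (hr.comp hcs))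
  have hall := (hc0.eventually (e.open_target.mem_nhds h1t)).and
    (((hl.comp hcs).eventually S.eventually_eq_zero).and
      ((hk1.eventually (e.open_source.mem_nhds he0)).and
        (hk2.eventually (e.open_source.mem_nhds he0))))
  rw [nhds_prod_eq, eventually_prod_self_iff'] at hall
  obtain ⟨A, hA, hall⟩ := hall
  refine ⟨A, hA, fun y hy y' hy' p hp => ?_⟩
  obtain ⟨h1, h2, h3, h4⟩ := hall y hy y' hy'
  set g := (S.sect y')⁻¹ * S.sect y with hg
  have hgp : g = p := by rw [hg, hp, inv_mul_cancel_left]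
  -- The element `p` need not be small, but `g = (σ y')⁻¹ σ y` is, so it has adapted coordinates. As
  -- `g ∈ P`, its transversal coordinates vanish, and injectivity of the coordinates `e` compares
  -- `y` with `y'`.
  have h5 : g = S.sect (fun j => e.symm g (.inl j)) * S.para (fun k => e.symm g (.inr k)) := by
    rw [← he _ (e.map_target h1), e.right_inv h1]
  have h6 : (fun j => e.symm g (.inl j)) = 0 := by
    refine h2 ?_
    have h7 := eq_mul_inv_of_mul_eq h5.symm
    change S.sect (fun j => e.symm g (.inl j)) ∈ P
    rw [h7, hgp]
    exact P.mul_mem p.2 (P.inv_mem (S.para _).2)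
  rw [h6, sect_zero, one_mul] at h5
  have h8 : e (Sum.elim y 0) = e (Sum.elim y' (fun k => e.symm g (.inr k))) := by
    rw [he _ h3, he _ h4]
    simp only [Sum.elim_inl, Sum.elim_inr]
    rw [← h5, hg, mul_inv_cancel_left]
    have h9 : ((S.para 0 : P) : G) = 1 := expProd_zero (fun _ => (S.isOneParam _).map_zero) _
    exact (congrArg (S.sect y * ·) h9).trans (mul_one _)
  have h9 := e.injOn h3 h4 h8
  ext j
  exact congrFun h9 (.inl j)

end Slice

end Slices

/-! ### Smoothness of representations and extension of functions from the slice -/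

section
open scoped Pointwise

section Representations

variable {E : Type*} [NormedAddCommGroup E] [NormedSpace ℝ E] [FiniteDimensional ℝ E]
  {G : Type*} [TopologicalSpace G] [ChartedSpace E G] [Group G] [LieGroup 𝓘(ℝ, E) ∞ G]
  {V : Type*} [NormedAddCommGroup V] [NormedSpace ℂ V] [FiniteDimensional ℂ V]
  {P : Subgroup G} {ρ : Representation ℂ P V}

instance : CompleteSpace V := FiniteDimensional.complete ℂ V

/-- The operators of a finite-dimensional representation, as continuous linear maps. -/
def repL (ρ : Representation ℂ P V) (p : P) : V →L[ℂ] V := LinearMap.toContinuousLinearMap (ρ p)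

@[simp] lemma repL_apply (p : P) (v : V) : repL ρ p v = ρ p v := rfl

lemma repL_mul (p q : P) : repL ρ (p * q) = repL ρ p * repL ρ q := by
  ext v
  simp

lemma repL_one : repL ρ 1 = 1 := by
  ext v
  simp

lemma continuous_repL (hρ : ∀ v, Continuous fun p => ρ p v) : Continuous (repL ρ) :=
  continuous_clm_apply.2 hρ

/-- Here continuity of the representation is turned into differentiability. -/
lemma IsOneParam.exists_hasDerivAt_repL (hρ : ∀ v, Continuous fun p => ρ p v) {γ : ℝ → G}
    {X : GroupLieAlgebra 𝓘(ℝ, E) G} (h : IsOneParam E γ X) (hP : ∀ t, γ t ∈ P) :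
    ∃ B : V →L[ℂ] V, ∀ t, HasDerivAt (fun t => repL ρ ⟨γ t, hP t⟩) (repL ρ ⟨γ t, hP t⟩ * B) t := by
  refine exists_hasDerivAt_mul_of_continuous
    ((continuous_repL hρ).comp (h.smooth.continuous.subtype_mk hP)) ?_ fun s t => ?_
  · have : (⟨γ 0, hP 0⟩ : P) = 1 := Subtype.ext h.map_zero
    rw [this, repL_one]
  · rw [← repL_mul]
    exact congrArg (repL ρ) (Subtype.ext (h.map_add s t))

lemma IsOneParam.map_neg {γ : ℝ → G} {X : GroupLieAlgebra 𝓘(ℝ, E) G} (h : IsOneParam E γ X)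
    (t : ℝ) : γ (-t) = (γ t)⁻¹ := by
  rw [eq_inv_iff_mul_eq_one, ← h.map_add, neg_add_cancel, h.map_zero]

lemma IsOneParam.contDiff_repL_inv (hρ : ∀ v, Continuous fun p => ρ p v) {γ : ℝ → G}
    {X : GroupLieAlgebra 𝓘(ℝ, E) G} (h : IsOneParam E γ X) (hP : ∀ t, γ t ∈ P) :
    ContDiff ℝ ∞ (fun t => repL ρ (⟨γ t, hP t⟩ : P)⁻¹) := by
  obtain ⟨B, hB⟩ := h.exists_hasDerivAt_repL hρ hP
  refine (congrArg (ContDiff ℝ ∞) (funext fun t => ?_)).mp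
    ((contDiff_of_hasDerivAt_mul hB).comp contDiff_neg)
  exact congrArg (repL ρ) (Subtype.ext (h.map_neg t))

/-- The Lie algebra of `P` acts on the contragredient representation. -/
lemma IsOneParam.exists_hasDualDeriv (hρ : ∀ v, Continuous fun p => ρ p v) {γ : ℝ → G}
    {X : GroupLieAlgebra 𝓘(ℝ, E) G} (h : IsOneParam E γ X) (hP : ∀ t, γ t ∈ P)
    (ν : Module.Dual ℂ V) : ∃ ν', HasDualDeriv E ρ X ν ν' := by
  have hd := ((h.contDiff_repL_inv hρ hP).differentiable (by simp) 0).hasDerivAt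
  set B : V →L[ℂ] V := deriv (fun t => repL ρ (⟨γ t, hP t⟩ : P)⁻¹) 0
  refine ⟨ν ∘ₗ B.toLinearMap, γ, hP, h, fun v => ?_⟩
  let T : (V →L[ℂ] V) →L[ℂ] ℂ :=
    (LinearMap.toContinuousLinearMap ν).comp (ContinuousLinearMap.apply ℂ V v)
  exact (T.restrictScalars ℝ).hasFDerivAt.comp_hasDerivAt 0 hd

/-- Inversion reverses the product, so the new factor appears on the right of the inductive one. -/
lemma contDiff_repL_expProd_inv (hρ : ∀ v, Continuous fun p => ρ p v) {ι : Type*} [Fintype ι]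
    {γ : ι → ℝ → G} {X : ι → GroupLieAlgebra 𝓘(ℝ, E) G} (h : ∀ j, IsOneParam E (γ j) (X j))
    (hP : ∀ j t, γ j t ∈ P) (l : List ι) :
    ContDiff ℝ ∞ (fun t => repL ρ (⟨expProd γ l t, expProd_mem hP l t⟩ : P)⁻¹) := by
  induction l with
  | nil =>
    refine (congrArg (ContDiff ℝ ∞) (funext fun t => ?_)).mp
      (contDiff_const (c := (1 : V →L[ℂ] V)))
    rw [← repL_one (ρ := ρ)]
    exact congrArg (repL ρ) inv_one.symm
  | cons j l ih =>
    refine (congrArg (ContDiff ℝ ∞) (funext fun t => ?_)).mp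
      (ih.mul (((h j).contDiff_repL_inv hρ (hP j)).comp (contDiff_apply ℝ ℝ j)))
    rw [Function.comp_apply, ← repL_mul]
    refine congrArg (repL ρ) (Subtype.ext ?_)
    simp [expProd]

namespace Slice

variable (S : Slice (E := E) P)

/-- Functions with small compact support on the slice extend to sections over `G/P`. -/
lemma exists_ind (hρ : ∀ v, Continuous fun p => ρ p v) : ∃ A ∈ 𝓝 (0 : Fin S.m → ℝ),
    ∀ h : (Fin S.m → ℝ) → V, ContDiff ℝ ∞ h → HasCompactSupport h → tsupport h ⊆ A →
      ∃ f : Ind E ρ, ∀ y ∈ A, f.1 (S.sect y) = h y := by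
  have := topologicalGroup_of_lieGroup 𝓘(ℝ, E) ∞ (G := G)
  obtain ⟨e, he0, he, hsm⟩ := S.exists_coord
  obtain ⟨A₀, hA₀, hinj⟩ := S.eventually_injective
  have hk : Continuous fun y : Fin S.m → ℝ => (Sum.elim y 0 : Fin S.m ⊕ Fin S.n → ℝ) := by
    refine continuous_pi fun j => ?_
    rcases j with j | k
    · exact continuous_apply j
    · exact continuous_const
  have hk0 : (Sum.elim 0 0 : Fin S.m ⊕ Fin S.n → ℝ) = 0 := by ext (j | k) <;> rfl
  set A : Set (Fin S.m → ℝ) := interior A₀ ∩ (fun y => Sum.elim y 0) ⁻¹' e.source with hA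
  have hAo : IsOpen A := isOpen_interior.inter (e.open_source.preimage hk)
  have hA0 : (0 : Fin S.m → ℝ) ∈ A :=
    ⟨mem_interior_iff_mem_nhds.2 hA₀, by rw [mem_preimage, hk0]; exact he0⟩
  have hAinj : ∀ y ∈ A, ∀ y' ∈ A, ∀ p : P, S.sect y = S.sect y' * p → y = y' :=
    fun y hy y' hy' => hinj y (interior_subset hy.1) y' (interior_subset hy'.1)
  have hpara : (S.para 0 : G) = 1 := expProd_zero (fun _ => (S.isOneParam _).map_zero) _
  refine ⟨A, hAo.mem_nhds hA0, fun h hh hK hKA => ?_⟩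
  -- The section is forced on the cosets through the slice, `f (σ(y) p) = p⁻¹ h(y)`, and is `0`
  -- elsewhere. It is well defined because the slice meets each coset at most once.
  obtain ⟨f, hf1, hf2⟩ : ∃ f : G → V, (∀ y ∈ A, ∀ p : P, f (S.sect y * p) = ρ p⁻¹ (h y)) ∧
      ∀ g, (¬ ∃ y ∈ A, ∃ p : P, g = S.sect y * p) → f g = 0 := by
    have : ∀ g, ∃ v : V, (∀ y ∈ A, ∀ p : P, g = S.sect y * p → v = ρ p⁻¹ (h y)) ∧
        ((¬ ∃ y ∈ A, ∃ p : P, g = S.sect y * p) → v = 0) := by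
      intro g
      by_cases hg : ∃ y ∈ A, ∃ p : P, g = S.sect y * p
      · obtain ⟨y, hy, p, rfl⟩ := hg
        refine ⟨ρ p⁻¹ (h y), fun y' hy' p' hp' => ?_, fun hn => absurd ⟨y, hy, p, rfl⟩ hn⟩
        have h1 : S.sect y = S.sect y' * (p' * p⁻¹ : P) := by
          push_cast
          rw [← mul_assoc, ← hp', mul_inv_cancel_right]
        obtain rfl := hAinj y hy y' hy' _ h1
        rw [Subtype.ext (mul_left_cancel hp')]
      · exact ⟨0, fun y hy p hp => absurd ⟨y, hy, p, hp⟩ hg, fun _ => rfl⟩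
    choose f hf using this
    exact ⟨f, fun y hy p => (hf _).1 y hy p rfl, fun g => (hf g).2⟩
  have heq : ∀ (g : G) (p : P), f (g * p) = ρ p⁻¹ (f g) := by
    intro g p
    by_cases hg : ∃ y ∈ A, ∃ p : P, g = S.sect y * p
    · obtain ⟨y, hy, q, rfl⟩ := hg
      rw [hf1 y hy, mul_assoc, ← P.coe_mul, hf1 y hy, mul_inv_rev, map_mul]
      rfl
    · rw [hf2 g hg, map_zero]
      refine hf2 _ fun ⟨y, hy, q, hq⟩ => hg ⟨y, hy, q * p⁻¹, ?_⟩
      push_cast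
      rw [← mul_assoc, ← hq, mul_inv_cancel_right]
  have hsect : ∀ y ∈ A, f (S.sect y) = h y := fun y hy => by
    simpa using hf1 y hy 1
  have hloc : ∀ y ∈ A, ContMDiffAt 𝓘(ℝ, E) 𝓘(ℝ, V) ∞ f (S.sect y) := by
    intro y hy
    have hes : e (Sum.elim y 0) = S.sect y := by
      rw [he _ hy.2]
      exact (congrArg (S.sect y * ·) hpara).trans (mul_one _)
    have htar : S.sect y ∈ e.target := hes ▸ e.map_source hy.2
    have hsy : e.symm (S.sect y) = Sum.elim y 0 := by rw [← hes, e.left_inv hy.2]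
    have hl : ContDiff ℝ ∞ fun z : Fin S.m ⊕ Fin S.n → ℝ => fun j => z (.inl j) :=
      contDiff_pi.2 fun j => contDiff_apply ℝ ℝ _
    have hr : ContDiff ℝ ∞ fun z : Fin S.m ⊕ Fin S.n → ℝ => fun j => z (.inr j) :=
      contDiff_pi.2 fun j => contDiff_apply ℝ ℝ _
    have hF : ContDiff ℝ ∞ fun z : Fin S.m ⊕ Fin S.n → ℝ =>
        repL ρ (S.para fun k => z (.inr k))⁻¹ (h fun j => z (.inl j)) := by
      have h1 : ContDiff ℝ ∞ fun z : Fin S.m ⊕ Fin S.n → ℝ =>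
          repL ρ (S.para fun k => z (.inr k))⁻¹ :=
        (contDiff_repL_expProd_inv hρ (fun k => S.isOneParam (.inr k)) S.curve_mem _).comp hr
      have h2 : ContDiff ℝ ∞ fun z : Fin S.m ⊕ Fin S.n → ℝ =>
          (ContinuousLinearMap.restrictScalarsL ℂ V V ℝ ℝ
            (repL ρ (S.para fun k => z (.inr k))⁻¹)) :=
        (ContinuousLinearMap.restrictScalarsL ℂ V V ℝ ℝ).contDiff.comp h1
      exact h2.clm_apply (hh.comp hl)
    have hsmy := hsm.contMDiffAt (e.open_target.mem_nhds htar)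
    refine (ContMDiffAt.comp (S.sect y) hF.contMDiff.contMDiffAt hsmy).congr_of_eventuallyEq ?_
    have hev : ∀ᶠ g in 𝓝 (S.sect y), (fun j => e.symm g (.inl j)) ∈ A := by
      have h1 : ContinuousAt (fun g => (fun j => e.symm g (.inl j) : Fin S.m → ℝ)) (S.sect y) :=
        hl.continuous.continuousAt.comp (e.symm.continuousAt htar)
      refine h1.eventually_mem (hAo.mem_nhds ?_)
      rw [hsy]; exact hy
    filter_upwards [hev, e.open_target.mem_nhds htar] with g hg hgt
    rw [Function.comp_apply, repL_apply, ← hf1 _ hg]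
    rw [← he _ (e.map_target hgt), e.right_inv hgt]
  have hsmooth : ContMDiff 𝓘(ℝ, E) 𝓘(ℝ, V) ∞ f := by
    intro g
    -- On the cosets through the support of `h`, smoothness is moved to the slice by right
    -- translation. The set of these cosets is closed, being a compact set times the closed `P`, and
    -- `f` vanishes on its complement.
    by_cases hg : g ∈ (S.sect '' tsupport h) * (P : Set G)
    · obtain ⟨_, ⟨y, hy, rfl⟩, p, hp, rfl⟩ := hg
      have h1 : ContMDiffAt 𝓘(ℝ, E) 𝓘(ℝ, E) ∞ (fun x : G => x * p⁻¹) (S.sect y * p) :=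
        (contMDiff_mul_right (I := 𝓘(ℝ, E)) (n := ∞) (a := p⁻¹)).contMDiffAt
      have h2 : ContMDiffAt 𝓘(ℝ, E) 𝓘(ℝ, V) ∞ f ((fun x : G => x * p⁻¹) (S.sect y * p)) := by
        simpa using hloc y (hKA hy)
      have h3 : ContDiff ℝ ∞ fun v : V => ρ (⟨p, hp⟩ : P)⁻¹ v :=
        ((repL ρ (⟨p, hp⟩ : P)⁻¹).restrictScalars ℝ).contDiff
      have h5 := ContMDiffAt.comp (f := fun x : G => x * p⁻¹) (S.sect y * p) h2 h1
      refine (h3.contMDiff.contMDiffAt.comp (S.sect y * p) h5).congr_of_eventuallyEq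
        (Eventually.of_forall fun x => ?_)
      have h4 := heq (x * p⁻¹) ⟨p, hp⟩
      simpa using h4
    · have hcl : IsClosed ((S.sect '' tsupport h) * (P : Set G)) :=
        S.isClosed.mul_left_of_isCompact (hK.isCompact.image S.contMDiff_sect.continuous)
      refine contMDiffAt_const (c := (0 : V)) |>.congr_of_eventuallyEq ?_
      filter_upwards [hcl.isOpen_compl.mem_nhds hg] with x hx
      by_cases hx2 : ∃ y ∈ A, ∃ p : P, x = S.sect y * p
      · obtain ⟨y, hy, p, rfl⟩ := hx2
        have h5 : y ∉ tsupport h := fun h6 => hx ⟨_, ⟨y, h6, rfl⟩, p, p.2, rfl⟩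
        rw [hf1 y hy, image_eq_zero_of_notMem_tsupport h5, map_zero]
      · exact hf2 x hx2
  exact ⟨⟨f, hsmooth, heq⟩, hsect⟩

end Slice

end Representations

end

/-! ### Generation of the enveloping algebra by the real Lie algebra -/

section EnvelopingAlgebra

variable {E : Type*} [NormedAddCommGroup E] [NormedSpace ℝ E] [FiniteDimensional ℝ E]
  {G : Type*} [TopologicalSpace G] [ChartedSpace E G] [Group G] [LieGroup 𝓘(ℝ, E) ∞ G]

lemma toUg_add (X Y : GroupLieAlgebra 𝓘(ℝ, E) G) : toUg E (X + Y) = toUg E X + toUg E Y := by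
  rw [toUg, TensorProduct.tmul_add, map_add]; rfl

lemma toUg_smul (c : ℝ) (X : GroupLieAlgebra 𝓘(ℝ, E) G) : toUg E (c • X) = (c : ℂ) • toUg E X := by
  have : (1 : ℂ) ⊗ₜ[ℝ] (c • X) = (c : ℂ) • ((1 : ℂ) ⊗ₜ[ℝ] X) := by
    rw [TensorProduct.tmul_smul, TensorProduct.smul_tmul', TensorProduct.smul_tmul']
    simp
  rw [toUg, this, map_smul]; rfl

/-- The canonical map `𝔤(ℝ) → U(𝔤)` as a linear map. -/
def toUgₗ : GroupLieAlgebra 𝓘(ℝ, E) G →ₗ[ℝ] Ug E G where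
  toFun := toUg E
  map_add' := toUg_add
  map_smul' c X := by rw [toUg_smul]; rfl

lemma toUg_lie (X Y : GroupLieAlgebra 𝓘(ℝ, E) G) :
    toUg E ⁅X, Y⁆ = toUg E X * toUg E Y - toUg E Y * toUg E X := by
  let : LieRing (Ug E G) := LieRing.ofAssociativeRing
  have h := LieHom.map_lie (UniversalEnvelopingAlgebra.ι ℂ) ((1 : ℂ) ⊗ₜ[ℝ] X) ((1 : ℂ) ⊗ₜ[ℝ] Y)
  rw [LieAlgebra.ExtendScalars.bracket_tmul, one_mul] at h
  exact h

lemma adjoin_range_toUg : Algebra.adjoin ℂ (range (toUg E : _ → Ug E G)) = ⊤ := by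
  let : LieRing (Ug E G) := LieRing.ofAssociativeRing
  rw [eq_top_iff]
  intro u _
  obtain ⟨a, rfl⟩ : ∃ a, UniversalEnvelopingAlgebra.mkAlgHom ℂ
      (ℂ ⊗[ℝ] GroupLieAlgebra 𝓘(ℝ, E) G) a = u := Quotient.mk_surjective u
  induction a using TensorAlgebra.induction with
  | algebraMap c => rw [AlgHom.commutes]; exact Subalgebra.algebraMap_mem _ _
  | ι x =>
    change UniversalEnvelopingAlgebra.ι ℂ x ∈ _
    induction x using TensorProduct.induction_on with
    | zero => rw [map_zero]; exact Subalgebra.zero_mem _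
    | tmul z X =>
      have : z ⊗ₜ[ℝ] X = z • ((1 : ℂ) ⊗ₜ[ℝ] X) := by simp [TensorProduct.smul_tmul']
      rw [this, map_smul]
      exact Subalgebra.smul_mem _ (Algebra.subset_adjoin (mem_range_self X)) z
    | add x y hx hy => rw [map_add]; exact Subalgebra.add_mem _ (hx trivial) (hy trivial)
  | mul a b ha hb => rw [map_mul]; exact Subalgebra.mul_mem _ (ha trivial) (hb trivial)
  | add a b ha hb => rw [map_add]; exact Subalgebra.add_mem _ (ha trivial) (hb trivial)

lemma span_range_prod_toUg :
    Submodule.span ℂ (range fun Xs : List (GroupLieAlgebra 𝓘(ℝ, E) G) => (Xs.map (toUg E)).prod) =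
      ⊤ := by
  rw [eq_top_iff, ← Algebra.top_toSubmodule, ← adjoin_range_toUg, Algebra.adjoin_eq_span]
  refine Submodule.span_mono fun u hu => ?_
  obtain ⟨l, hl, rfl⟩ := Submonoid.exists_list_of_mem_closure hu
  clear hu
  induction l with
  | nil => exact ⟨[], rfl⟩
  | cons a l ih =>
    obtain ⟨Xs, hXs⟩ := ih fun y hy => hl y (List.mem_cons_of_mem _ hy)
    obtain ⟨X, rfl⟩ := hl a (by simp)
    exact ⟨X :: Xs, by simp only [List.map_cons, List.prod_cons, ← hXs]⟩

-- Words in `𝔤(ℝ)` span `U(𝔤)` over `ℂ`, and a word is built by multiplying letters on the left.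
@[elab_as_elim]
lemma Ug.induction {p : Ug E G → Prop} (one : p 1) (toUg_mul : ∀ X u, p u → p (toUg E X * u))
    (add : ∀ u v, p u → p v → p (u + v)) (smul : ∀ (c : ℂ) u, p u → p (c • u)) (u : Ug E G) :
    p u := by
  have hu : u ∈ Submodule.span ℂ (range fun Xs : List (GroupLieAlgebra 𝓘(ℝ, E) G) =>
      (Xs.map (toUg E)).prod) := by rw [span_range_prod_toUg]; exact Submodule.mem_top
  induction hu using Submodule.span_induction with
  | mem x hx =>
    obtain ⟨Xs, rfl⟩ := hx
    induction Xs with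
    | nil => exact one
    | cons X Xs ih => exact toUg_mul X _ ih
  | zero => simpa using smul 0 1 one
  | add x y _ _ hx hy => exact add x y hx hy
  | smul c x _ hx => exact smul c x hx

end EnvelopingAlgebra

/-! ### The enveloping algebra as left-invariant differential operators -/

section SmoothFunctions

variable {E : Type*} [NormedAddCommGroup E] [NormedSpace ℝ E] [FiniteDimensional ℝ E]
  {G : Type*} [TopologicalSpace G] [ChartedSpace E G] [Group G] [LieGroup 𝓘(ℝ, E) ∞ G]
  {F F' : Type*} [NormedAddCommGroup F] [NormedSpace ℝ F] [NormedAddCommGroup F'] [NormedSpace ℝ F']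

lemma lder_add_left (X Y : GroupLieAlgebra 𝓘(ℝ, E) G) (f : G → F) :
    lder (X + Y) f = lder X f + lder Y f := by
  ext g
  exact (congrArg (mfderiv 𝓘(ℝ, E) 𝓘(ℝ, F) f g) (map_add (mfderiv 𝓘(ℝ, E) 𝓘(ℝ, E)
    (fun h : G => g * h) 1) X Y)).trans (map_add (mfderiv 𝓘(ℝ, E) 𝓘(ℝ, F) f g) _ _)

lemma lder_smul_left (c : ℝ) (X : GroupLieAlgebra 𝓘(ℝ, E) G) (f : G → F) :
    lder (c • X) f = c • lder X f := by
  ext g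
  exact (congrArg (mfderiv 𝓘(ℝ, E) 𝓘(ℝ, F) f g) (map_smul (mfderiv 𝓘(ℝ, E) 𝓘(ℝ, E)
    (fun h : G => g * h) 1) c X)).trans (map_smul (mfderiv 𝓘(ℝ, E) 𝓘(ℝ, F) f g) _ _)

lemma lder_comp_clm (X : GroupLieAlgebra 𝓘(ℝ, E) G) (T : F →L[ℝ] F') {f : G → F}
    (hf : ContMDiff 𝓘(ℝ, E) 𝓘(ℝ, F) ∞ f) (g : G) :
    lder X (fun x => T (f x)) g = T (lder X f g) := by
  obtain ⟨γ, hγ⟩ := exists_isOneParam X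
  exact (hγ.hasDerivAt_zero (T.contDiff.contMDiff.comp hf) g).unique
    (T.hasFDerivAt.comp_hasDerivAt 0 (hγ.hasDerivAt_zero hf g))

lemma lder_add_right (X : GroupLieAlgebra 𝓘(ℝ, E) G) {f₁ f₂ : G → F}
    (h₁ : ContMDiff 𝓘(ℝ, E) 𝓘(ℝ, F) ∞ f₁) (h₂ : ContMDiff 𝓘(ℝ, E) 𝓘(ℝ, F) ∞ f₂) :
    lder X (f₁ + f₂) = lder X f₁ + lder X f₂ := by
  obtain ⟨γ, hγ⟩ := exists_isOneParam X
  ext g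
  exact (hγ.hasDerivAt_zero (h₁.add h₂) g).unique
    ((hγ.hasDerivAt_zero h₁ g).add (hγ.hasDerivAt_zero h₂ g))

lemma lder_comp_mul_left (X : GroupLieAlgebra 𝓘(ℝ, E) G) (a : G) {f : G → F}
    (hf : ContMDiff 𝓘(ℝ, E) 𝓘(ℝ, F) ∞ f) (g : G) :
    lder X (fun x => f (a * x)) g = lder X f (a * g) := by
  obtain ⟨γ, hγ⟩ := exists_isOneParam X
  have h1 := hγ.hasDerivAt_zero (hf.comp (contMDiff_mul_left (I := 𝓘(ℝ, E)) (n := ∞) (a := a))) g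
  refine h1.unique ?_
  simpa only [Function.comp_apply, mul_assoc] using hγ.hasDerivAt_zero hf (a * g)

/-- `g exp(tX) a⁻¹ = g a⁻¹ exp(t Ad(a) X)`. -/
lemma lder_comp_mul_right (X : GroupLieAlgebra 𝓘(ℝ, E) G) (a : G) {f : G → F}
    (hf : ContMDiff 𝓘(ℝ, E) 𝓘(ℝ, F) ∞ f) (g : G) :
    lder X (fun x => f (x * a⁻¹)) g = lder (Ad E a X) f (g * a⁻¹) := by
  obtain ⟨γ, hγ⟩ := exists_isOneParam X
  have h1 := hγ.hasDerivAt_zero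
    (hf.comp (contMDiff_mul_right (I := 𝓘(ℝ, E)) (n := ∞) (a := a⁻¹))) g
  refine h1.unique ?_
  simpa [mul_assoc] using (hγ.conj E a).hasDerivAt_zero hf (g * a⁻¹)

variable {V V' : Type*} [NormedAddCommGroup V] [NormedSpace ℂ V] [NormedAddCommGroup V']
  [NormedSpace ℂ V']

variable (E G V) in
/-- The smooth functions on `G` with values in a complex vector space. -/
def smoothFun : Submodule ℂ (G → V) where
  carrier := {f | ContMDiff 𝓘(ℝ, E) 𝓘(ℝ, V) ∞ f}
  zero_mem' := contMDiff_const
  add_mem' ha hb := ContMDiff.add ha hb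
  smul_mem' c a ha := by
    have h : ContMDiff 𝓘(ℝ, V) 𝓘(ℝ, V) ∞ (fun v : V => c • v) :=
      (contDiff_const_smul c).contMDiff
    exact h.comp ha

/-- The left-invariant derivative as an operator on smooth functions. -/
def lderEnd (X : GroupLieAlgebra 𝓘(ℝ, E) G) : Module.End ℂ (smoothFun E G V) where
  toFun f := ⟨lder X f.1, lder_contMDiff X f.2⟩
  map_add' f₁ f₂ := Subtype.ext (lder_add_right X f₁.2 f₂.2)
  map_smul' c f := Subtype.ext (funext fun g => lder_comp_clm X
    ((c • ContinuousLinearMap.id ℂ V).restrictScalars ℝ) f.2 g)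

/-- The left-invariant derivatives, as a representation of the complexified Lie algebra on smooth
functions. -/
def lderLie : letI : LieRing (Module.End ℂ (smoothFun E G V)) := LieRing.ofAssociativeRing
    ℂ ⊗[ℝ] GroupLieAlgebra 𝓘(ℝ, E) G →ₗ⁅ℂ⁆ Module.End ℂ (smoothFun E G V) :=
  letI : LieRing (Module.End ℂ (smoothFun E G V)) := LieRing.ofAssociativeRing
  let l : GroupLieAlgebra 𝓘(ℝ, E) G →ₗ[ℝ] Module.End ℂ (smoothFun E G V) :=
    { toFun := lderEnd
      map_add' := fun X Y => LinearMap.ext fun f => Subtype.ext (lder_add_left X Y f.1)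
      map_smul' := fun c X => LinearMap.ext fun f => Subtype.ext (lder_smul_left c X f.1) }
  { l.liftBaseChange ℂ with
    map_lie' := fun {x y} => by
      change l.liftBaseChange ℂ ⁅x, y⁆ = ⁅l.liftBaseChange ℂ x, l.liftBaseChange ℂ y⁆
      induction x using TensorProduct.induction_on with
      | zero => simp
      | add x₁ x₂ h₁ h₂ => rw [add_lie, map_add, map_add, add_lie, h₁, h₂]
      | tmul z X =>
        induction y using TensorProduct.induction_on with
        | zero =>
          rw [map_zero, lie_zero]
          exact (congrArg (l.liftBaseChange ℂ) (lie_zero (z ⊗ₜ[ℝ] X))).trans (map_zero _)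
        | add y₁ y₂ h₁ h₂ =>
          rw [map_add, lie_add, ← h₁, ← h₂, ← map_add]
          exact congrArg (l.liftBaseChange ℂ) (lie_add (z ⊗ₜ[ℝ] X) y₁ y₂)
        | tmul w Y =>
          rw [LieAlgebra.ExtendScalars.bracket_tmul, LinearMap.liftBaseChange_tmul,
            LinearMap.liftBaseChange_tmul, LinearMap.liftBaseChange_tmul, smul_lie, lie_smul,
            smul_smul]
          congr 1
          refine LinearMap.ext fun f => Subtype.ext ?_
          exact lder_lie X Y f.2 }

variable (E G V) in
/-- The action of `U(𝔤)` on smooth functions by left-invariant differential operators. -/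
def opU : Ug E G →ₐ[ℂ] Module.End ℂ (smoothFun E G V) :=
  letI : LieRing (Module.End ℂ (smoothFun E G V)) := LieRing.ofAssociativeRing
  UniversalEnvelopingAlgebra.lift ℂ lderLie

lemma opU_toUg (X : GroupLieAlgebra 𝓘(ℝ, E) G) : opU E G V (toUg E X) = lderEnd X := by
  rw [opU, toUg, UniversalEnvelopingAlgebra.lift_ι_apply]
  exact (LinearMap.liftBaseChange_tmul _ _ _ _).trans (one_smul _ _)

lemma opU_toUg_mul (X : GroupLieAlgebra 𝓘(ℝ, E) G) (u : Ug E G) (f : smoothFun E G V) :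
    (opU E G V (toUg E X * u) f).1 = lder X (opU E G V u f).1 := by
  rw [map_mul, opU_toUg]; rfl

lemma opU_prod (Xs : List (GroupLieAlgebra 𝓘(ℝ, E) G)) (f : smoothFun E G V) :
    (opU E G V (Xs.map (toUg E)).prod f).1 = Xs.foldr lder f.1 := by
  induction Xs with
  | nil => simp
  | cons X Xs ih => rw [List.map_cons, List.prod_cons, opU_toUg_mul, ih]; rfl

/-- A linear map that intertwines left-invariant derivatives intertwines the actions of `U(𝔤)`. -/
lemma opU_intertwine (T : smoothFun E G V →ₗ[ℂ] smoothFun E G V') (α : Ug E G →ₐ[ℂ] Ug E G)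
    (h : ∀ X f, T (opU E G V (toUg E X) f) = opU E G V' (α (toUg E X)) (T f)) (u : Ug E G)
    (f : smoothFun E G V) : T (opU E G V u f) = opU E G V' (α u) (T f) := by
  induction u using Ug.induction generalizing f with
  | one => simp
  | toUg_mul X u hu => simp only [map_mul, Module.End.mul_apply, h, hu]
  | add u v hu hv => simp only [map_add, LinearMap.add_apply, hu, hv]
  | smul c u hu => simp only [map_smul, LinearMap.smul_apply, hu]

/-- Composition with a linear map between the values. -/
def smoothFun.mapValue (T : V →L[ℂ] V') : smoothFun E G V →ₗ[ℂ] smoothFun E G V' where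
  toFun f := ⟨fun g => T (f.1 g), (T.restrictScalars ℝ).contDiff.contMDiff.comp f.2⟩
  map_add' _ _ := Subtype.ext (funext fun _ => map_add T _ _)
  map_smul' _ _ := Subtype.ext (funext fun _ => map_smul T _ _)

lemma opU_mapValue (T : V →L[ℂ] V') (u : Ug E G) (f : smoothFun E G V) :
    smoothFun.mapValue T (opU E G V u f) = opU E G V' u (smoothFun.mapValue T f) :=
  opU_intertwine (smoothFun.mapValue T) (AlgHom.id ℂ _) (fun X f => by
    rw [AlgHom.id_apply, opU_toUg, opU_toUg]
    exact Subtype.ext (funext fun g => (lder_comp_clm X (T.restrictScalars ℝ) f.2 g).symm)) u f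

/-- Left translation of functions, `f ↦ f (a · )`. -/
def smoothFun.mulLeft (a : G) : smoothFun E G V →ₗ[ℂ] smoothFun E G V where
  toFun f := ⟨fun g => f.1 (a * g),
    f.2.comp (contMDiff_mul_left (I := 𝓘(ℝ, E)) (n := ∞) (a := a))⟩
  map_add' _ _ := rfl
  map_smul' _ _ := rfl

lemma opU_mulLeft (a : G) (u : Ug E G) (f : smoothFun E G V) :
    smoothFun.mulLeft a (opU E G V u f) = opU E G V u (smoothFun.mulLeft a f) :=
  opU_intertwine (smoothFun.mulLeft a) (AlgHom.id ℂ _) (fun X f => by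
    rw [AlgHom.id_apply, opU_toUg]
    exact Subtype.ext (funext fun g => (lder_comp_mul_left X a f.2 g).symm)) u f

/-- Right translation of functions, `f ↦ f ( · a⁻¹)`. -/
def smoothFun.mulRight (a : G) : smoothFun E G V →ₗ[ℂ] smoothFun E G V where
  toFun f := ⟨fun g => f.1 (g * a⁻¹),
    f.2.comp (contMDiff_mul_right (I := 𝓘(ℝ, E)) (n := ∞) (a := a⁻¹))⟩
  map_add' _ _ := rfl
  map_smul' _ _ := rfl

lemma opU_mulRight (a : G) (u : Ug E G) (f : smoothFun E G V) :
    opU E G V u (smoothFun.mulRight a f) = smoothFun.mulRight a (opU E G V (AdU E a u) f) := by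
  have h : ∀ a f, smoothFun.mulRight a⁻¹ (smoothFun.mulRight (E := E) (V := V) (G := G) a f) = f :=
    fun a f => Subtype.ext (funext fun g => congrArg f.1 (by simp))
  have h' : ∀ a f, smoothFun.mulRight a (smoothFun.mulRight (E := E) (V := V) (G := G) a⁻¹ f) = f :=
    fun a f => by simpa using h a⁻¹ f
  -- The intertwining lemma twists the operator after the map `T`, which fits translation by the
  -- inverse of `a`; the cancellations `h` and `h'` bring the translation to the other side.
  have h1 := opU_intertwine (smoothFun.mulRight a⁻¹) (AdU E a) (fun X f => by
    rw [AdU_toUg, opU_toUg, opU_toUg]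
    refine Subtype.ext (funext fun g => ?_)
    have h2 := lder_comp_mul_right X a (smoothFun.mulRight a⁻¹ f).2 (g * a)
    simp only [mul_inv_cancel_right] at h2
    change lder X f.1 (g * a⁻¹⁻¹) = lder (Ad E a X) (smoothFun.mulRight a⁻¹ f).1 g
    rw [← h2, inv_inv]
    congr 1
    exact funext fun x => congrArg f.1 (by simp)) u (smoothFun.mulRight a f)
  rw [h] at h1
  rw [← h1, h']

end SmoothFunctions

/-! ### The pairing of the Verma module with the induced representation -/

section Pairing

variable {E : Type*} [NormedAddCommGroup E] [NormedSpace ℝ E] [FiniteDimensional ℝ E]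
  {G : Type*} [TopologicalSpace G] [ChartedSpace E G] [Group G] [LieGroup 𝓘(ℝ, E) ∞ G]
  {V : Type*} [NormedAddCommGroup V] [NormedSpace ℂ V] [FiniteDimensional ℂ V]
  {P : Subgroup G} (ρ : Representation ℂ P V)

/-- The inclusion of the induced representation into the smooth functions. -/
def Ind.toSmooth : Ind E ρ →ₗ[ℂ] smoothFun E G V := Submodule.inclusion fun _ hf => hf.1

variable {ρ}

/-- Differentiate `ν (f (g exp(tX))) = (exp(tX) · ν)(f g)`, which is the equivariance of `f` under
`P`. -/
lemma HasDualDeriv.apply_lder {X : GroupLieAlgebra 𝓘(ℝ, E) G} {ν ν' : Module.Dual ℂ V}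
    (h : HasDualDeriv E ρ X ν ν') (f : Ind E ρ) (g : G) : ν (lder X f.1 g) = ν' (f.1 g) := by
  obtain ⟨γ, hP, hγ, hd⟩ := h
  have h1 := ((LinearMap.toContinuousLinearMap ν).restrictScalars ℝ).hasFDerivAt.comp_hasDerivAt 0
    (hγ.hasDerivAt_zero f.2.1 g)
  refine h1.unique ((hd (f.1 g)).congr_of_eventuallyEq (Eventually.of_forall fun t => ?_))
  exact congrArg ν (f.2.2 g ⟨γ t, hP t⟩)

variable (ρ)

/-- The pairing of `U(𝔤) ⊗ V^∨` with the induced representation. -/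
def pairTensor : Ug E G ⊗[ℂ] Module.Dual ℂ V →ₗ[ℂ] Ind E ρ →ₗ[ℂ] ℂ :=
  TensorProduct.lift (LinearMap.mk₂ ℂ
    (fun u ν => ν ∘ₗ LinearMap.proj 1 ∘ₗ (smoothFun E G V).subtype ∘ₗ opU E G V u ∘ₗ Ind.toSmooth ρ)
    (fun u v ν => by ext f; simp) (fun c u ν => by ext f; simp)
    (fun u ν ν' => by ext f; simp) (fun c u ν => by ext f; simp))

lemma pairTensor_tmul (u : Ug E G) (ν : Module.Dual ℂ V) (f : Ind E ρ) :
    pairTensor ρ (u ⊗ₜ ν) f = ν ((opU E G V u (Ind.toSmooth ρ f)).1 1) := rfl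

/-- Functionals on the values commute with left-invariant operators, so `ν` applied to `u X f` is
`u` applied to `ν ∘ X f = ν' ∘ f`. The claim is strengthened to all left multiples, as the relations
form a `U(𝔤)`-submodule while the pairing is only `ℂ`-linear. -/
lemma pairTensor_eq_zero {z : Ug E G ⊗[ℂ] Module.Dual ℂ V} (hz : z ∈ vermaRel E ρ) :
    pairTensor ρ z = 0 := by
  suffices h : ∀ u : Ug E G, pairTensor ρ (u • z) = 0 by simpa using h 1
  induction hz using Submodule.span_induction with
  | mem z hz =>
    obtain ⟨X, ν, ν', h, rfl⟩ := hz
    intro u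
    ext f
    have e : u • (toUg E X ⊗ₜ[ℂ] ν - 1 ⊗ₜ[ℂ] ν') = (u * toUg E X) ⊗ₜ[ℂ] ν - u ⊗ₜ[ℂ] ν' := by
      rw [smul_sub, TensorProduct.smul_tmul', TensorProduct.smul_tmul', smul_eq_mul, smul_eq_mul,
        mul_one]
    rw [e, map_sub, LinearMap.sub_apply, pairTensor_tmul, pairTensor_tmul, map_mul,
      Module.End.mul_apply, opU_toUg, LinearMap.zero_apply, sub_eq_zero]
    have h1 := opU_mapValue (LinearMap.toContinuousLinearMap ν) u (lderEnd X (Ind.toSmooth ρ f))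
    have h2 := opU_mapValue (LinearMap.toContinuousLinearMap ν') u (Ind.toSmooth ρ f)
    have h3 : smoothFun.mapValue (LinearMap.toContinuousLinearMap ν)
        (lderEnd X (Ind.toSmooth ρ f)) =
        smoothFun.mapValue (LinearMap.toContinuousLinearMap ν') (Ind.toSmooth ρ f) :=
      Subtype.ext (funext fun g => h.apply_lder f g)
    rw [h3, ← h2] at h1
    exact congrFun (congrArg Subtype.val h1) 1
  | zero => simp
  | add x y _ _ hx hy => intro u; rw [smul_add, map_add, hx, hy, add_zero]
  | smul v x _ hx => intro u; rw [smul_smul]; exact hx _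

/-- The pairing of the generalized Verma module with the induced representation. -/
def vermaPair : Verma E ρ →ₗ[ℂ] Ind E ρ →ₗ[ℂ] ℂ :=
  ((vermaRel E ρ).restrictScalars ℂ).liftQ (pairTensor ρ) (fun _ hz => pairTensor_eq_zero ρ hz) ∘ₗ
    (Submodule.Quotient.restrictScalarsEquiv ℂ (vermaRel E ρ)).symm.toLinearMap

lemma vermaPair_mk (u : Ug E G) (ν : Module.Dual ℂ V) (f : Ind E ρ) :
    vermaPair ρ (Verma.mk E ρ u ν) f = ν ((opU E G V u (Ind.toSmooth ρ f)).1 1) := rfl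

lemma vermaPair_mk_prod (Xs : List (GroupLieAlgebra 𝓘(ℝ, E) G)) (ν : Module.Dual ℂ V)
    (f : Ind E ρ) :
    vermaPair ρ (Verma.mk E ρ (Xs.map (toUg E)).prod ν) f = ν (Xs.foldr lder f.1 1) := by
  rw [vermaPair_mk, opU_prod]; rfl

/-- `Verma.mk` as a bilinear map. -/
def vermaMk : Ug E G →ₗ[ℂ] Module.Dual ℂ V →ₗ[ℂ] Verma E ρ :=
  LinearMap.mk₂ ℂ (Verma.mk E ρ)
    (fun u v ν => by rw [Verma.mk, TensorProduct.add_tmul, map_add]; rfl)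
    (fun c u ν => by
      rw [Verma.mk, ← TensorProduct.smul_tmul']
      exact map_smul ((vermaRel E ρ).mkQ.restrictScalars ℂ) c _)
    (fun u ν ν' => by rw [Verma.mk, TensorProduct.tmul_add, map_add]; rfl)
    (fun c u ν => by
      rw [Verma.mk, TensorProduct.tmul_smul]
      exact map_smul ((vermaRel E ρ).mkQ.restrictScalars ℂ) c _)

@[simp] lemma vermaMk_apply (u : Ug E G) (ν : Module.Dual ℂ V) :
    vermaMk ρ u ν = Verma.mk E ρ u ν := rfl

lemma Verma.smul_mk (v u : Ug E G) (ν : Module.Dual ℂ V) :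
    v • Verma.mk E ρ u ν = Verma.mk E ρ (v * u) ν := by
  rw [Verma.mk, ← map_smul, TensorProduct.smul_tmul']; rfl

lemma Verma.act_mk (p : P) (u : Ug E G) (ν : Module.Dual ℂ V) :
    Verma.act E ρ p (Verma.mk E ρ u ν) = Verma.mk E ρ (AdU E (p : G) u) (ρ.dual p ν) := rfl

/-- Elements of `𝔭(ℝ)` move across the tensor sign. -/
lemma HasDualDeriv.mk_mul {ρ : Representation ℂ P V} {X : GroupLieAlgebra 𝓘(ℝ, E) G}
    {ν ν' : Module.Dual ℂ V} (h : HasDualDeriv E ρ X ν ν') (u : Ug E G) :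
    Verma.mk E ρ (u * toUg E X) ν = Verma.mk E ρ u ν' := by
  have h1 : Verma.mk E ρ (toUg E X) ν = Verma.mk E ρ 1 ν' :=
    (Submodule.Quotient.eq _).2 (Submodule.subset_span ⟨X, ν, ν', h, rfl⟩)
  rw [← Verma.smul_mk, h1, Verma.smul_mk, mul_one]

variable {ρ}

@[elab_as_elim]
lemma Verma.induction_mk {p : Verma E ρ → Prop} (mk : ∀ u ν, p (Verma.mk E ρ u ν))
    (add : ∀ m n, p m → p n → p (m + n)) (m : Verma E ρ) : p m := by
  obtain ⟨z, rfl⟩ := (vermaRel E ρ).mkQ_surjective m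
  induction z using TensorProduct.induction_on with
  | zero => simpa [Verma.mk] using mk 0 0
  | tmul u ν => exact mk u ν
  | add x y hx hy => rw [map_add]; exact add _ _ hx hy

@[elab_as_elim]
lemma Verma.induction {p : Verma E ρ → Prop} (mk_one : ∀ ν, p (Verma.mk E ρ 1 ν))
    (toUg_smul : ∀ (X : GroupLieAlgebra 𝓘(ℝ, E) G) m, p m → p (toUg E X • m))
    (add : ∀ m n, p m → p n → p (m + n))
    (smul : ∀ (c : ℂ) m, p m → p (c • m)) (m : Verma E ρ) : p m := by
  induction m using Verma.induction_mk with
  | add m n hm hn => exact add m n hm hn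
  | mk u ν =>
    induction u using Ug.induction with
    | one => exact mk_one ν
    | toUg_mul X u hu => rw [← Verma.smul_mk]; exact toUg_smul X _ hu
    | add u v hu hv =>
      rw [← vermaMk_apply, map_add, LinearMap.add_apply]; exact add _ _ hu hv
    | smul c u hu => rw [← vermaMk_apply, map_smul, LinearMap.smul_apply]; exact smul c _ hu

/-- By equivariance of `f`, right translation by `p⁻¹` is the action of `p` on values; it conjugates
`u` to `Ad(p) u`. Evaluating at `p` turns this into a left translation. -/
lemma vermaPair_act (p : P) (m : Verma E ρ) (f : Ind E ρ) :
    vermaPair ρ (Verma.act E ρ p m) f = vermaPair ρ m (Ind.translate E ρ (p : G)⁻¹ f) := by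
  induction m using Verma.induction_mk with
  | add m n hm hn => simp only [map_add, LinearMap.add_apply, hm, hn]
  | mk u ν =>
    rw [Verma.act_mk, vermaPair_mk, vermaPair_mk]
    have h1 := opU_mulRight (V := V) (p : G) u (Ind.toSmooth ρ f)
    have h2 : smoothFun.mulRight (p : G) (Ind.toSmooth ρ f) =
        smoothFun.mapValue (repL ρ p) (Ind.toSmooth ρ f) :=
      Subtype.ext (funext fun g => by
        have h := f.2.2 g p⁻¹
        rw [inv_inv] at h
        exact h)
    rw [h2, ← opU_mapValue] at h1
    have h3 : ρ p ((opU E G V u (Ind.toSmooth ρ f)).1 p) =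
        (opU E G V (AdU E (p : G) u) (Ind.toSmooth ρ f)).1 1 := by
      have h4 := congrFun (congrArg Subtype.val h1) (p : G)
      refine h4.trans ?_
      exact congrArg (opU E G V (AdU E (p : G) u) (Ind.toSmooth ρ f)).1 (mul_inv_cancel (p : G))
    have h5 := congrFun (congrArg Subtype.val (opU_mulLeft (p : G) u (Ind.toSmooth ρ f))) 1
    have h6 : smoothFun.mulLeft (p : G) (Ind.toSmooth ρ f) =
        Ind.toSmooth ρ (Ind.translate E ρ (p : G)⁻¹ f) :=
      Subtype.ext (funext fun g => congrArg (fun a => f.1 (a * g)) (inv_inv (p : G)).symm)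
    rw [← h6, ← h5, ← h3]
    have h7 : ∀ w : V, ρ.dual p ν (ρ p w) = ν w := fun w => by
      rw [Representation.dual_apply]
      change ν (ρ p⁻¹ (ρ p w)) = ν w
      simp
    rw [h7]
    exact congrArg (fun a => ν ((opU E G V u (Ind.toSmooth ρ f)).1 a)) (mul_one (p : G)).symm

lemma vermaPair_translate_mk (a : G) (u : Ug E G) (ν : Module.Dual ℂ V) (f : Ind E ρ) :
    vermaPair ρ (Verma.mk E ρ u ν) (Ind.translate E ρ a⁻¹ f) =
      ν ((opU E G V u (Ind.toSmooth ρ f)).1 a) := by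
  rw [vermaPair_mk]
  have h5 := congrFun (congrArg Subtype.val (opU_mulLeft a u (Ind.toSmooth ρ f))) 1
  have h6 : smoothFun.mulLeft a (Ind.toSmooth ρ f) =
      Ind.toSmooth ρ (Ind.translate E ρ a⁻¹ f) :=
    Subtype.ext (funext fun g => congrArg (fun a => f.1 (a * g)) (inv_inv a).symm)
  rw [← h6, ← h5]
  exact congrArg (fun a => ν ((opU E G V u (Ind.toSmooth ρ f)).1 a)) (mul_one a)

lemma contMDiff_vermaPair_translate (m : Verma E ρ) (f : Ind E ρ) :
    ContMDiff 𝓘(ℝ, E) 𝓘(ℝ, ℂ) ∞ fun a : G => vermaPair ρ m (Ind.translate E ρ a⁻¹ f) := by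
  induction m using Verma.induction_mk with
  | add m n hm hn => simpa only [map_add, LinearMap.add_apply] using! hm.add hn
  | mk u ν =>
    simp only [vermaPair_translate_mk]
    exact ((LinearMap.toContinuousLinearMap ν).restrictScalars ℝ).contDiff.contMDiff.comp
      (opU E G V u (Ind.toSmooth ρ f)).2

/-- The infinitesimal counterpart of `vermaPair_act`, valid for every `X` in `𝔤(ℝ)`. It converts
equivariance under translations into compatibility with the Lie algebra. -/
lemma IsOneParam.hasDerivAt_vermaPair {γ : ℝ → G} {X : GroupLieAlgebra 𝓘(ℝ, E) G}
    (h : IsOneParam E γ X) (m : Verma E ρ) (f : Ind E ρ) :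
    HasDerivAt (fun t => vermaPair ρ m (Ind.translate E ρ (γ t)⁻¹ f))
      (vermaPair ρ (toUg E X • m) f) 0 := by
  induction m using Verma.induction_mk with
  | add m n hm hn =>
    simp only [smul_add, _root_.map_add, LinearMap.add_apply]
    exact hm.add hn
  | mk u ν =>
    simp only [vermaPair_translate_mk]
    rw [Verma.smul_mk, vermaPair_mk, opU_toUg_mul]
    have h1 := h.hasDerivAt_zero (opU E G V u (Ind.toSmooth ρ f)).2 1
    simp only [one_mul] at h1
    exact ((LinearMap.toContinuousLinearMap ν).restrictScalars ℝ).hasFDerivAt.comp_hasDerivAt 0 h1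

end Pairing

/-! ### Filtration of the enveloping algebra by word length -/

section Words

variable {E : Type*} [NormedAddCommGroup E] [NormedSpace ℝ E] [FiniteDimensional ℝ E]
  {G : Type*} [TopologicalSpace G] [ChartedSpace E G] [Group G] [LieGroup 𝓘(ℝ, E) ∞ G]
  {J : Type*} [Fintype J] (b : Module.Basis J ℝ (GroupLieAlgebra 𝓘(ℝ, E) G))

/-- The span in `U(𝔤)` of the words of length at most `r` in a basis of `𝔤(ℝ)`. -/
def wordSpan (r : ℕ) : Submodule ℂ (Ug E G) :=
  Submodule.span ℂ ((fun js : List J => (js.map fun j => toUg E (b j)).prod) '' {js | js.length ≤ r})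

variable {b}

lemma prod_mem_wordSpan {js : List J} {r : ℕ} (h : js.length ≤ r) :
    (js.map fun j => toUg E (b j)).prod ∈ wordSpan b r :=
  Submodule.subset_span ⟨js, h, rfl⟩

lemma toUg_mul_mem_wordSpan (X : GroupLieAlgebra 𝓘(ℝ, E) G) {u : Ug E G} {r : ℕ}
    (hu : u ∈ wordSpan b r) : toUg E X * u ∈ wordSpan b (r + 1) := by
  induction hu using Submodule.span_induction with
  | mem u hu =>
    obtain ⟨js, hjs, rfl⟩ := hu
    have hX : toUg E X = ∑ j, (b.repr X j : ℂ) • toUg E (b j) := by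
      conv_lhs => rw [← b.sum_repr X]
      exact (map_sum toUgₗ _ _).trans (Finset.sum_congr rfl fun j _ => toUg_smul _ _)
    rw [hX, Finset.sum_mul]
    refine Submodule.sum_mem _ fun j _ => ?_
    rw [smul_mul_assoc]
    refine Submodule.smul_mem _ _ ?_
    exact prod_mem_wordSpan (js := j :: js) (Nat.succ_le_succ hjs)
  | zero => rw [mul_zero]; exact Submodule.zero_mem _
  | add x y _ _ hx hy => rw [mul_add]; exact Submodule.add_mem _ hx hy
  | smul c x _ hx => rw [mul_smul_comm]; exact Submodule.smul_mem _ _ hx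

/-- Asking for all large `s` builds monotonicity of the filtration into the induction. -/
lemma exists_mem_wordSpan (b : Module.Basis J ℝ (GroupLieAlgebra 𝓘(ℝ, E) G)) (u : Ug E G) :
    ∃ r, ∀ s, r ≤ s → u ∈ wordSpan b s := by
  induction u using Ug.induction with
  | one => exact ⟨0, fun s _ => prod_mem_wordSpan (js := []) (Nat.zero_le s)⟩
  | toUg_mul X u hu =>
    obtain ⟨r, hr⟩ := hu
    refine ⟨r + 1, fun s hs => ?_⟩
    obtain ⟨s, rfl⟩ := Nat.exists_eq_add_of_le' (Nat.one_le_of_lt hs)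
    exact toUg_mul_mem_wordSpan X (hr s (by omega))
  | add u v hu hv =>
    obtain ⟨r, hr⟩ := hu
    obtain ⟨r', hr'⟩ := hv
    exact ⟨max r r', fun s hs => Submodule.add_mem _ (hr s (le_of_max_le_left hs))
      (hr' s (le_of_max_le_right hs))⟩
  | smul c u hu =>
    obtain ⟨r, hr⟩ := hu
    exact ⟨r, fun s hs => Submodule.smul_mem _ _ (hr s hs)⟩

/-- Permuting the letters of a word changes it by shorter words. -/
lemma prod_sub_prod_mem_wordSpan {l l' : List J} (h : l.Perm l') : ∀ r, l.length = r + 1 →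
    (l.map fun j => toUg E (b j)).prod - (l'.map fun j => toUg E (b j)).prod ∈ wordSpan b r := by
  induction h with
  | nil => intro r hr; simp at hr
  | cons x h ih =>
    intro r hr
    rw [List.map_cons, List.map_cons, List.prod_cons, List.prod_cons, ← mul_sub]
    -- For `r = 0` the inductive hypothesis does not apply, but the tail is empty and the difference
    -- is zero.
    rcases r with _ | r
    · obtain rfl := List.eq_nil_of_length_eq_zero (Nat.succ_injective hr)
      rw [List.nil_perm.1 h, sub_self, mul_zero]
      exact Submodule.zero_mem _
    · exact toUg_mul_mem_wordSpan _ (ih r (Nat.succ_injective hr))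
  | swap x y l =>
    intro r hr
    obtain rfl : l.length + 1 = r := Nat.succ_injective hr
    simp only [List.map_cons, List.prod_cons]
    -- A transposition of two neighbours costs their bracket, a single letter.
    rw [← mul_assoc, ← mul_assoc, ← sub_mul, ← toUg_lie]
    exact toUg_mul_mem_wordSpan _ (prod_mem_wordSpan le_rfl)
  | trans h₁ _ ih₁ ih₂ =>
    intro r hr
    rw [← sub_add_sub_cancel]
    exact Submodule.add_mem _ (ih₁ r hr) (ih₂ r (h₁.length_eq ▸ hr))

lemma perm_monomialList {m : ℕ} (js : List (Fin m)) :
    js.Perm (monomialList id (fun i => js.count i) (List.finRange m)) := by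
  rw [List.perm_iff_count]
  intro i
  rw [monomialList, List.count_flatMap, ← Fin.sum_univ_def]
  simp [List.count_replicate]

lemma monomialList_map {L L' ι : Type*} (f : L → L') (Y : ι → L) (a : ι → ℕ) (l : List ι) :
    (monomialList Y a l).map f = monomialList (f ∘ Y) a l := by
  simp [monomialList, List.map_flatMap]

end Words

/-! ### Monomials span the Verma module, and the pairing is nondegenerate -/

section Nondegenerate

variable {E : Type*} [NormedAddCommGroup E] [NormedSpace ℝ E] [FiniteDimensional ℝ E]
  {G : Type*} [TopologicalSpace G] [ChartedSpace E G] [Group G] [LieGroup 𝓘(ℝ, E) ∞ G]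
  {V : Type*} [NormedAddCommGroup V] [NormedSpace ℂ V] [FiniteDimensional ℂ V]
  {P : Subgroup G} {ρ : Representation ℂ P V}

namespace Slice

variable (S : Slice (E := E) P)

/-- The ordered monomial with exponents `a` in the directions transversal to `P`. -/
def monomial (a : Fin S.m → ℕ) : List (GroupLieAlgebra 𝓘(ℝ, E) G) :=
  monomialList (fun j => S.basis (.inl j)) a (List.finRange S.m)

/-- The linear map from polynomials in the transversal directions, with values in `V^∨`, to the
generalized Verma module. -/
def monomialMap (ρ : Representation ℂ P V) :
    ((Fin S.m → ℕ) →₀ Module.Dual ℂ V) →ₗ[ℂ] Verma E ρ :=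
  Finsupp.lsum ℂ fun a => vermaMk ρ ((S.monomial a).map (toUg E)).prod

/-- The spanning half of Poincaré-Birkhoff-Witt, by induction on word length: letters may be
permuted modulo shorter words. A letter from `𝔭` is moved to the end and absorbed into `ν`; a word
without such letters is sorted into an ordered monomial. -/
lemma mk_mem_range_monomialMap (hρ : ∀ v, Continuous fun p => ρ p v) (r : ℕ) :
    ∀ u ∈ wordSpan S.basis r, ∀ ν, Verma.mk E ρ u ν ∈ LinearMap.range (S.monomialMap ρ) := by
  have hmon : ∀ (a : Fin S.m → ℕ) ν,
      Verma.mk E ρ ((S.monomial a).map (toUg E)).prod ν ∈ LinearMap.range (S.monomialMap ρ) :=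
    fun a ν => ⟨Finsupp.single a ν, by rw [monomialMap, Finsupp.lsum_single]; rfl⟩
  have hlin : ∀ r, (∀ js : List (Fin S.m ⊕ Fin S.n), js.length ≤ r → ∀ ν, Verma.mk E ρ
      (js.map fun j => toUg E (S.basis j)).prod ν ∈ LinearMap.range (S.monomialMap ρ)) →
      ∀ u ∈ wordSpan S.basis r, ∀ ν, Verma.mk E ρ u ν ∈ LinearMap.range (S.monomialMap ρ) := by
    intro r h u hu ν
    have h1 : wordSpan S.basis r ≤
        (LinearMap.range (S.monomialMap ρ)).comap ((vermaMk ρ).flip ν) := by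
      refine Submodule.span_le.2 ?_
      rintro _ ⟨js, hjs, rfl⟩
      exact h js hjs ν
    exact h1 hu
  induction r with
  | zero =>
    refine hlin 0 fun js hjs ν => ?_
    obtain rfl := List.eq_nil_of_length_eq_zero (Nat.le_zero.1 hjs)
    have h1 : S.monomial 0 = [] := by simp [monomial, monomialList]
    have h2 := hmon 0 ν
    rw [h1] at h2
    exact h2
  | succ r ih =>
    refine hlin (r + 1) fun js hjs ν => ?_
    rcases Nat.le_succ_iff.1 hjs with hjs | hjs
    · exact ih _ (prod_mem_wordSpan hjs) ν
    have hperm : ∀ js', js.Perm js' → Verma.mk E ρ (js'.map fun j => toUg E (S.basis j)).prod ν ∈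
        LinearMap.range (S.monomialMap ρ) → Verma.mk E ρ (js.map fun j => toUg E (S.basis j)).prod ν ∈
        LinearMap.range (S.monomialMap ρ) := by
      intro js' hp h
      have h1 := ih _ (prod_sub_prod_mem_wordSpan (b := S.basis) hp r hjs) ν
      rw [← vermaMk_apply, map_sub, LinearMap.sub_apply] at h1
      exact (Submodule.sub_mem_iff_left _ h).1 h1
    by_cases hk : ∃ k, Sum.inr k ∈ js
    · obtain ⟨k, hk⟩ := hk
      obtain ⟨l₁, l₂, rfl⟩ := List.append_of_mem hk
      have hp : (l₁ ++ .inr k :: l₂).Perm (l₁ ++ l₂ ++ [.inr k]) :=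
        List.perm_middle.trans (List.perm_append_singleton _ _).symm
      refine hperm _ hp ?_
      obtain ⟨ν', hν'⟩ := (S.isOneParam (.inr k)).exists_hasDualDeriv hρ (S.curve_mem k) ν
      rw [List.map_append, List.prod_append, List.map_singleton, List.prod_singleton, hν'.mk_mul]
      refine ih _ (prod_mem_wordSpan ?_) ν'
      simp only [List.length_append, List.length_cons] at hjs ⊢
      omega
    · obtain ⟨js, rfl⟩ : js ∈ range (List.map Sum.inl) := by
        rw [Set.range_list_map]
        rintro (j | k) hj
        · exact ⟨j, rfl⟩
        · exact absurd ⟨k, hj⟩ hk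
      refine hperm _ ((perm_monomialList js).map _) ?_
      have h1 := hmon (fun i => js.count i) ν
      rw [monomial, monomialList_map] at h1
      rw [monomialList_map, monomialList_map]
      exact h1

lemma range_monomialMap (hρ : ∀ v, Continuous fun p => ρ p v) :
    LinearMap.range (S.monomialMap ρ) = ⊤ := by
  rw [eq_top_iff]
  intro m _
  induction m using Verma.induction_mk with
  | mk u ν =>
    obtain ⟨r, hr⟩ := exists_mem_wordSpan S.basis u
    exact S.mk_mem_range_monomialMap hρ r u (hr r le_rfl) ν
  | add m n hm hn => exact Submodule.add_mem _ (hm trivial) (hn trivial)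

/-- There are sections which are given by a monomial in the coordinates on the slice. -/
lemma exists_ind_monomial (hρ : ∀ v, Continuous fun p => ρ p v) (b : Fin S.m → ℕ) (v : V) :
    ∃ f : Ind E ρ, ∀ᶠ y in 𝓝 0,
      f.1 (S.sect y) = ((List.finRange S.m).map fun j => y j ^ b j).prod • v := by
  obtain ⟨A, hA, hf⟩ := S.exists_ind hρ
  obtain ⟨ε, hε, hεA⟩ := Metric.nhds_basis_closedBall.mem_iff.1 hA
  -- The bump function is `1` near `0`, so the monomial is unchanged there, and its support, the
  -- closed ball of radius `ε`, lies in `A`.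
  let χ : ContDiffBump (0 : Fin S.m → ℝ) := ⟨ε / 2, ε, by positivity, by linarith⟩
  have hpoly : ContDiff ℝ ∞ fun y : Fin S.m → ℝ =>
      ((List.finRange S.m).map fun j => y j ^ b j).prod := by
    simp only [← Fin.prod_univ_def]
    exact contDiff_prod fun j _ => (contDiff_apply ℝ ℝ j).pow _
  have hsupp : HasCompactSupport fun y : Fin S.m → ℝ =>
      χ y • (((List.finRange S.m).map fun j => y j ^ b j).prod • v) := χ.hasCompactSupport.smul_right
  obtain ⟨f, hf⟩ := hf (fun y => χ y • (((List.finRange S.m).map fun j => y j ^ b j).prod • v))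
    (χ.contDiff.smul (hpoly.smul contDiff_const)) hsupp
    ((tsupport_smul_subset_left _ _).trans (χ.tsupport_eq.trans_subset hεA))
  refine ⟨f, ?_⟩
  filter_upwards [hA, χ.eventuallyEq_one] with y hy hχ
  rw [hf y hy, hχ, Pi.one_apply, one_smul]

/-- The pairing between the generalized Verma module and the induced representation is
nondegenerate in the first variable. -/
lemma eq_zero_of_vermaPair {P : Subgroup G} (S : Slice (E := E) P) {ρ : Representation ℂ P V}
    (hρ : ∀ v, Continuous fun p => ρ p v) {m : Verma E ρ}
    (hm : ∀ f, vermaPair ρ m f = 0) : m = 0 := by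
  obtain ⟨c, rfl⟩ : m ∈ LinearMap.range (S.monomialMap ρ) := by
    rw [S.range_monomialMap hρ]; exact Submodule.mem_top
  suffices hc : c = 0 by rw [hc, map_zero]
  ext b v
  -- Testing against the monomial section of exponent `b` and value `v` isolates the coefficient `c
  -- b v`, up to the nonzero factor `b!`.
  obtain ⟨f, hf⟩ := S.exists_ind_monomial hρ b v
  have h1 : ∀ a, (S.monomial a).foldr lder f.1 1 = ((List.finRange S.m).map fun j =>
      if a j = b j then ((b j).factorial : ℝ) else 0).prod • v := by
    intro a
    have h2 := (foldr_lder_monomialList (fun j => S.isOneParam (.inl j)) f.2.1 a b v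
      (List.finRange S.m) [] (List.nodup_finRange _) hf).self_of_nhds
    simpa [monomial] using h2
  have h3 := hm f
  rw [monomialMap, Finsupp.lsum_apply, Finsupp.sum, map_sum, LinearMap.sum_apply] at h3
  simp only [vermaMk_apply, vermaPair_mk_prod, h1] at h3
  rw [Finset.sum_eq_single b] at h3
  · rw [← Complex.coe_smul, map_smul, smul_eq_zero] at h3
    refine h3.resolve_left ?_
    rw [Complex.ofReal_eq_zero]
    refine List.prod_ne_zero fun h => ?_
    obtain ⟨j, -, hj⟩ := List.mem_map.1 h
    simp [Nat.factorial_ne_zero] at hj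
  · intro a _ hab
    obtain ⟨j, hj⟩ := Function.ne_iff.1 hab
    have : ((List.finRange S.m).map fun j =>
      if a j = b j then ((b j).factorial : ℝ) else 0).prod = 0 :=
      List.prod_eq_zero (List.mem_map.2 ⟨j, List.mem_finRange j, if_neg hj⟩)
    rw [this, zero_smul, map_zero]
  · intro h
    rw [Finsupp.notMem_support_iff.1 h, LinearMap.zero_apply]

end Slice

end Nondegenerate

/-! ### Vanishing to finite order -/

section VanishingOrder

variable {E A B F : Type*} [NormedAddCommGroup E] [NormedSpace ℝ E] [NormedAddCommGroup A]
  [NormedSpace ℝ A] [NormedAddCommGroup B] [NormedSpace ℝ B] [NormedAddCommGroup F]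
  [NormedSpace ℝ F]

/-- All the derivatives of order at most `k` of a function vanish at a point. -/
def VanishesTo (k : ℕ) (u : E → F) (x : E) : Prop := ∀ m ≤ k, iteratedFDeriv ℝ m u x = 0

lemma vanishesTo_zero {u : E → F} {x : E} : VanishesTo 0 u x ↔ u x = 0 := by
  simp only [VanishesTo, Nat.le_zero, forall_eq]
  rw [← norm_eq_zero, norm_iteratedFDeriv_zero, norm_eq_zero]

lemma vanishesTo_succ {k : ℕ} {u : E → F} {x : E} :
    VanishesTo (k + 1) u x ↔ u x = 0 ∧ VanishesTo k (fderiv ℝ u) x := by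
  constructor
  · refine fun h => ⟨vanishesTo_zero.1 fun m hm => h m (by omega), fun m hm => ?_⟩
    rw [← norm_eq_zero, norm_iteratedFDeriv_fderiv, h (m + 1) (by omega), norm_zero]
  · rintro ⟨h0, h⟩ (_ | m) hm
    · exact vanishesTo_zero.2 h0 0 le_rfl
    · rw [← norm_eq_zero, ← norm_iteratedFDeriv_fderiv, h m (by omega), norm_zero]

lemma VanishesTo.congr {k : ℕ} {u v : E → F} {x : E} (h : VanishesTo k u x) (e : v =ᶠ[𝓝 x] u) :
    VanishesTo k v x := fun m hm => ((e.iteratedFDeriv ℝ m).self_of_nhds).trans (h m hm)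

/-- In the Leibniz bound every term of the `m`-th derivative contains a derivative of `f` of order
at most `m`. -/
lemma VanishesTo.bilinear {k : ℕ} (T : A →L[ℝ] B →L[ℝ] F) {f : E → A} {g : E → B} {x : E}
    (hf : ContDiffAt ℝ ∞ f x) (hg : ContDiffAt ℝ ∞ g x) (h : VanishesTo k f x) :
    VanishesTo k (fun y => T (f y) (g y)) x := by
  intro m hm
  have hm' : ((m : ℕ) : WithTop ℕ∞) ≤ ∞ := by exact_mod_cast le_top
  obtain ⟨s₁, hs₁, h₁⟩ := (hf.of_le hm').contDiffOn le_rfl (by simp)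
  obtain ⟨s₂, hs₂, h₂⟩ := (hg.of_le hm').contDiffOn le_rfl (by simp)
  obtain ⟨s, hs, hso, hxs⟩ := mem_nhds_iff.1 (Filter.inter_mem hs₁ hs₂)
  have h3 := T.norm_iteratedFDerivWithin_le_of_bilinear (h₁.mono (hs.trans inter_subset_left))
    (h₂.mono (hs.trans inter_subset_right)) hso.uniqueDiffOn hxs le_rfl
  rw [iteratedFDerivWithin_of_isOpen m hso hxs, Finset.sum_eq_zero, mul_zero] at h3
  · exact norm_le_zero_iff.1 h3
  · intro i hi
    rw [iteratedFDerivWithin_of_isOpen i hso hxs,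
      h i ((Nat.lt_succ_iff.1 (Finset.mem_range.1 hi)).trans hm), norm_zero, mul_zero, zero_mul]

lemma VanishesTo.sum {k : ℕ} {J : Type*} {s : Finset J} {u : J → E → F} {x : E}
    (hu : ∀ j ∈ s, ContDiffAt ℝ ∞ (u j) x) (h : ∀ j ∈ s, VanishesTo k (u j) x) :
    VanishesTo k (fun y => ∑ j ∈ s, u j y) x := by
  intro m hm
  have hm' : ((m : ℕ) : WithTop ℕ∞) ≤ ∞ := by exact_mod_cast le_top
  rw [iteratedFDeriv_fun_sum_apply fun j hj => (hu j hj).of_le hm']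
  exact Finset.sum_eq_zero fun j hj => h j hj m hm

end VanishingOrder

/-! ### Jets at the identity in terms of left-invariant derivatives -/

section Jets

variable {E : Type*} [NormedAddCommGroup E] [NormedSpace ℝ E] [FiniteDimensional ℝ E]
  {G : Type*} [TopologicalSpace G] [ChartedSpace E G] [Group G] [LieGroup 𝓘(ℝ, E) ∞ G]
  {F : Type*} [NormedAddCommGroup F] [NormedSpace ℝ F]

lemma contDiffAt_comp_extChartAt_symm {f : G → F} (hf : ContMDiff 𝓘(ℝ, E) 𝓘(ℝ, F) ∞ f) :
    ContDiffAt ℝ ∞ (fun x => f ((extChartAt 𝓘(ℝ, E) (1 : G)).symm x))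
      (extChartAt 𝓘(ℝ, E) (1 : G) 1) := by
  have h := (contMDiffOn_extChartAt_symm (I := 𝓘(ℝ, E)) (n := ∞) (1 : G)).contMDiffAt
    (extChartAt_target_mem_nhds (I := 𝓘(ℝ, E)) (1 : G))
  exact (hf.contMDiffAt.comp _ h).contDiffAt

/-- The left-invariant derivative in the chart at the identity. -/
lemma lder_comp_extChartAt_symm {f₀ : G → E} (hf₀ : ContMDiff 𝓘(ℝ, E) 𝓘(ℝ, E) ∞ f₀)
    (he : f₀ =ᶠ[𝓝 1] extChartAt 𝓘(ℝ, E) (1 : G)) {f : G → F}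
    (hf : ContMDiff 𝓘(ℝ, E) 𝓘(ℝ, F) ∞ f) :
    ∀ᶠ x in 𝓝 (extChartAt 𝓘(ℝ, E) (1 : G) 1), ∀ X : GroupLieAlgebra 𝓘(ℝ, E) G,
      lder X f ((extChartAt 𝓘(ℝ, E) (1 : G)).symm x) =
      fderiv ℝ (fun x => f ((extChartAt 𝓘(ℝ, E) (1 : G)).symm x)) x
        (lder X f₀ ((extChartAt 𝓘(ℝ, E) (1 : G)).symm x)) := by
  set c := extChartAt 𝓘(ℝ, E) (1 : G) with hc
  have hcs : ContinuousAt c.symm (c 1) := continuousAt_extChartAt_symm (I := 𝓘(ℝ, E)) (1 : G)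
  have h1 : Tendsto c.symm (𝓝 (c 1)) (𝓝 1) := by
    have := hcs.tendsto
    rwa [extChartAt_to_inv (I := 𝓘(ℝ, E)) (1 : G)] at this
  have hsrc : ∀ᶠ g in 𝓝 (1 : G), g ∈ c.source :=
    (isOpen_extChartAt_source (I := 𝓘(ℝ, E)) (1 : G)).mem_nhds (mem_extChartAt_source (1 : G))
  have hd : ∀ᶠ x in 𝓝 (c 1), DifferentiableAt ℝ (fun x => f (c.symm x)) x := by
    have h2 := ((contDiffAt_comp_extChartAt_symm hf).of_le (m := 1)
      (by exact_mod_cast le_top)).eventually (by simp)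
    filter_upwards [h2] with x hx using hx.differentiableAt (by simp)
  filter_upwards [h1.eventually ((he.and hsrc).eventually_nhds), hd,
    extChartAt_target_mem_nhds (I := 𝓘(ℝ, E)) (1 : G)] with x hx hdx hxt X
  set g := c.symm x with hg
  have hgx : f₀ g = x := by
    rw [hx.self_of_nhds.1]; exact c.right_inv hxt
  obtain ⟨γ, hγ⟩ := exists_isOneParam X
  have h3 := hγ.hasDerivAt_zero hf₀ g
  have h4 : HasFDerivAt (fun x => f (c.symm x)) (fderiv ℝ (fun x => f (c.symm x)) x)
      (f₀ (g * γ 0)) := by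
    rw [hγ.map_zero, mul_one, hgx]; exact hdx.hasFDerivAt
  refine (hγ.hasDerivAt_zero hf g).unique ((h4.comp_hasDerivAt 0 h3).congr_of_eventuallyEq ?_)
  have := topologicalGroup_of_lieGroup 𝓘(ℝ, E) ∞ (G := G)
  have h5 : Tendsto (fun t => g * γ t) (𝓝 0) (𝓝 g) := by
    have h6 : Continuous fun t => g * γ t := continuous_const.mul hγ.smooth.continuous
    simpa [hγ.map_zero] using h6.tendsto 0
  filter_upwards [h5.eventually hx] with t ht
  simp only [Function.comp_apply]
  rw [ht.1, c.left_inv ht.2]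

lemma lder_one_of_eventuallyEq {f₀ : G → E} (he : f₀ =ᶠ[𝓝 1] extChartAt 𝓘(ℝ, E) (1 : G))
    (X : GroupLieAlgebra 𝓘(ℝ, E) G) : lder X f₀ 1 = X := by
  rw [lder_one, he.mfderiv_eq]
  exact mfderiv_extChartAt_self (E := E) (1 : G) X

variable {J : Type*} [Fintype J]

/-- The derivatives at the identity of order at most `k` of a function in a chart vanish if and only
if its iterated left-invariant derivatives of order at most `k` do. -/
lemma vanishesTo_iff_foldr_lder (b : Module.Basis J ℝ (GroupLieAlgebra 𝓘(ℝ, E) G)) (k : ℕ) :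
    ∀ {f : G → F}, ContMDiff 𝓘(ℝ, E) 𝓘(ℝ, F) ∞ f →
    (VanishesTo k (fun x => f ((extChartAt 𝓘(ℝ, E) (1 : G)).symm x))
      (extChartAt 𝓘(ℝ, E) (1 : G) 1) ↔
      ∀ js : List J, js.length ≤ k → (js.map b).foldr lder f 1 = 0) := by
  obtain ⟨f₀, hf₀, he⟩ := exists_contMDiff_eventuallyEq_extChartAt E G
  set c := extChartAt 𝓘(ℝ, E) (1 : G) with hc
  have hc1 : c.symm (c 1) = 1 := extChartAt_to_inv (I := 𝓘(ℝ, E)) (1 : G)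
  induction k with
  | zero =>
    intro f hf
    rw [vanishesTo_zero, hc1]
    constructor
    · intro h js hjs
      obtain rfl := List.eq_nil_of_length_eq_zero (Nat.le_zero.1 hjs)
      exact h
    · exact fun h => h [] le_rfl
  | succ k ih =>
    intro f hf
    have hu := contDiffAt_comp_extChartAt_symm hf
    have hdu : ContDiffAt ℝ ∞ (fderiv ℝ fun x => f (c.symm x)) (c 1) := hu.fderiv_right le_rfl
    have hlder := lder_comp_extChartAt_symm hf₀ he hf
    rw [vanishesTo_succ, hc1]
    have hw : ∀ X, ContDiffAt ℝ ∞ (fun x => lder X f₀ (c.symm x)) (c 1) := fun X =>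
      contDiffAt_comp_extChartAt_symm (lder_contMDiff X hf₀)
    have hl : ∀ X, ContDiffAt ℝ ∞ (fun x => lder X f (c.symm x)) (c 1) := fun X =>
      contDiffAt_comp_extChartAt_symm (lder_contMDiff X hf)
    have key : VanishesTo k (fderiv ℝ fun x => f (c.symm x)) (c 1) ↔
        ∀ j, VanishesTo k (fun x => lder (b j) f (c.symm x)) (c 1) := by
      constructor
      · intro h j
        refine (h.bilinear (ContinuousLinearMap.id ℝ (E →L[ℝ] F)) hdu (hw (b j))).congr ?_
        filter_upwards [hlder] with x hx
        exact hx (b j)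
      · intro h
        let b' : Module.Basis J ℝ E := b
        let co : J → E →L[ℝ] ℝ := fun j => LinearMap.toContinuousLinearMap (b'.coord j)
        -- `W` is the left-invariant frame in the chart and `L` collects the derivatives of `f`
        -- along it, so `L = df ∘ W` near the base point. There `W` is the identity, hence
        -- invertible nearby, and `df = L ∘ W⁻¹` inherits the vanishing of `L`.
        set W : E → E →L[ℝ] E := fun x =>
          ∑ j, ContinuousLinearMap.smulRightL ℝ E E (co j) (lder (b j) f₀ (c.symm x)) with hW
        set L : E → E →L[ℝ] F := fun x =>
          ∑ j, ContinuousLinearMap.smulRightL ℝ E F (co j) (lder (b j) f (c.symm x)) with hL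
        have hWs : ContDiffAt ℝ ∞ W (c 1) := ContDiffAt.sum fun j _ =>
          (ContinuousLinearMap.smulRightL ℝ E E (co j)).contDiff.contDiffAt.comp _ (hw (b j))
        have hLj : ∀ j, ContDiffAt ℝ ∞ (fun x => ContinuousLinearMap.smulRightL ℝ E F (co j)
            (lder (b j) f (c.symm x))) (c 1) := fun j =>
          (ContinuousLinearMap.smulRightL ℝ E F (co j)).contDiff.contDiffAt.comp _ (hl (b j))
        have hLs : ContDiffAt ℝ ∞ L (c 1) := ContDiffAt.sum fun j _ => hLj j
        have hLv : VanishesTo k L (c 1) := VanishesTo.sum (fun j _ => hLj j) fun j _ =>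
          (h j).bilinear (ContinuousLinearMap.smulRightL ℝ E F).flip (hl (b j))
            (contDiffAt_const (c := co j))
        have hW1 : W (c 1) = ContinuousLinearEquiv.refl ℝ E := by
          ext v
          have h1 : W (c 1) v = ∑ j, co j v • lder (b j) f₀ (c.symm (c 1)) := by
            simp [hW]
          rw [h1, hc1]
          simp only [lder_one_of_eventuallyEq he]
          exact b'.sum_repr v
        have hinv : ContDiffAt ℝ ∞ (fun x => ContinuousLinearMap.inverse (W x)) (c 1) := by
          have h1 : ContDiffAt ℝ ∞ (ContinuousLinearMap.inverse : (E →L[ℝ] E) → E →L[ℝ] E)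
              (W (c 1)) := by
            rw [hW1]
            exact contDiffAt_map_inverse _
          exact h1.comp (c 1) hWs
        refine (hLv.bilinear (ContinuousLinearMap.compL ℝ E E F) hLs hinv).congr ?_
        have hWe : ∀ᶠ x in 𝓝 (c 1), W x ∈ range ((↑) : (E ≃L[ℝ] E) → E →L[ℝ] E) :=
          hWs.continuousAt.eventually_mem (ContinuousLinearEquiv.isOpen.mem_nhds
            ⟨ContinuousLinearEquiv.refl ℝ E, hW1.symm⟩)
        filter_upwards [hlder, hWe] with x hx hWx
        obtain ⟨e, he⟩ := hWx
        have hLW : L x = (fderiv ℝ (fun x => f (c.symm x)) x).comp (W x) := by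
          ext v
          simp only [hL, hW, sum_apply, ContinuousLinearMap.comp_apply, map_sum,
            ContinuousLinearMap.smulRightL_apply_apply, ContinuousLinearMap.smulRight_apply,
            map_smul]
          exact Finset.sum_congr rfl fun j _ => congrArg (co j v • ·) (hx (b j))
        rw [hLW, ← he, ContinuousLinearMap.inverse_equiv]
        ext v
        simp
    rw [key]
    constructor
    -- The last letter of a word is the first to act on `f`, so words are split at the end.
    · rintro ⟨h0, h⟩ js hjs
      rcases List.eq_nil_or_concat js with rfl | ⟨js, j, rfl⟩
      · exact h0
      · rw [List.concat_eq_append] at hjs ⊢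
        rw [List.map_append, List.foldr_append]
        rw [List.length_append, List.length_singleton] at hjs
        exact (ih (lder_contMDiff (b j) hf)).1 (h j) js (by omega)
    · intro h
      refine ⟨h [] (Nat.zero_le _), fun j => (ih (lder_contMDiff (b j) hf)).2 fun js hjs => ?_⟩
      have h1 := h (js ++ [j]) (by rw [List.length_append, List.length_singleton]; omega)
      rwa [List.map_append, List.foldr_append] at h1

variable {V : Type*} [NormedAddCommGroup V] [NormedSpace ℂ V] [FiniteDimensional ℂ V]
  {P : Subgroup G} {ρ : Representation ℂ P V}

lemma mem_vanishJet_iff (b : Module.Basis J ℝ (GroupLieAlgebra 𝓘(ℝ, E) G)) {k : ℕ} {f : Ind E ρ} :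
    f ∈ vanishJet E ρ k ↔ ∀ js : List J, js.length ≤ k → (js.map b).foldr lder f.1 1 = 0 :=
  vanishesTo_iff_foldr_lder b k f.2.1

lemma vermaPair_eq_zero_of_mem_vanishJet {b : Module.Basis J ℝ (GroupLieAlgebra 𝓘(ℝ, E) G)} {k : ℕ}
    {u : Ug E G} (hu : u ∈ wordSpan b k) {f : Ind E ρ} (hf : f ∈ vanishJet E ρ k)
    (ν : Module.Dual ℂ V) : vermaPair ρ (Verma.mk E ρ u ν) f = 0 := by
  have h1 : wordSpan b k ≤ LinearMap.ker (((vermaPair ρ).flip f) ∘ₗ (vermaMk ρ).flip ν) := by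
    refine Submodule.span_le.2 ?_
    rintro _ ⟨js, hjs, rfl⟩
    have h2 := vermaPair_mk_prod ρ (js.map b) ν f
    rw [(mem_vanishJet_iff b).1 hf js hjs, map_zero, List.map_map] at h2
    exact h2
  exact h1 hu

/-- A functional on jets is the pairing with an element of the generalized Verma module. -/
lemma exists_vermaPair_eq {k : ℕ} {l : Ind E ρ →ₗ[ℂ] ℂ} (hl : ∀ f ∈ vanishJet E ρ k, l f = 0) :
    ∃ m, vermaPair ρ m = l := by
  let b := Module.finBasis ℝ (GroupLieAlgebra 𝓘(ℝ, E) G)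
  let bV := Module.finBasis ℂ V
  have : Finite {js : List (Fin (Module.finrank ℝ (GroupLieAlgebra 𝓘(ℝ, E) G))) // js.length ≤ k} :=
    List.finite_length_le _ k
  have h1 : l ∈ Submodule.span ℂ (range fun i :
      {js : List (Fin (Module.finrank ℝ (GroupLieAlgebra 𝓘(ℝ, E) G))) // js.length ≤ k} ×
        Fin (Module.finrank ℂ V) =>
      vermaPair ρ (Verma.mk E ρ ((i.1.1.map b).map (toUg E)).prod (bV.coord i.2))) := by
    -- Finitely many functionals, indexed by words of length at most `k` and coordinates of `V`,
    -- have common kernel inside `vanishJet`, where `l` vanishes; so `l` is a combination of them.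
    refine mem_span_of_iInf_ker_le_ker fun f hf => hl f ?_
    refine (mem_vanishJet_iff b).2 fun js hjs => ?_
    refine bV.ext_elem fun i => ?_
    have h2 := (Submodule.mem_iInf _).1 hf (⟨js, hjs⟩, i)
    rw [LinearMap.mem_ker, vermaPair_mk_prod] at h2
    simpa using h2
  have h2 : l ∈ LinearMap.range (vermaPair ρ) := by
    refine Submodule.span_le.2 ?_ h1
    rintro _ ⟨i, rfl⟩
    exact ⟨_, rfl⟩
  exact h2

end Jets

/-! ### Transposition between operators and homomorphisms -/

section Operators

variable {E : Type*} [NormedAddCommGroup E] [NormedSpace ℝ E] [FiniteDimensional ℝ E]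
  {G : Type*} [TopologicalSpace G] [ChartedSpace E G] [Group G] [LieGroup 𝓘(ℝ, E) ∞ G]
  {E' : Type*} [NormedAddCommGroup E'] [NormedSpace ℝ E'] [FiniteDimensional ℝ E']
  {G' : Type*} [TopologicalSpace G'] [ChartedSpace E' G'] [Group G'] [LieGroup 𝓘(ℝ, E') ∞ G']
  {i : G' →* G} {P : Subgroup G}
  {V : Type*} [NormedAddCommGroup V] [NormedSpace ℂ V] [FiniteDimensional ℂ V]
  {V' : Type*} [NormedAddCommGroup V'] [NormedSpace ℂ V'] [FiniteDimensional ℂ V']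
  {ρ : Representation ℂ P V} {ρ' : Representation ℂ (P.comap i) V'}

lemma IsOneParam.map_hom (hi : ContMDiff 𝓘(ℝ, E') 𝓘(ℝ, E) ∞ i) {γ : ℝ → G'}
    {X : GroupLieAlgebra 𝓘(ℝ, E') G'} (h : IsOneParam E' γ X) :
    IsOneParam E (fun t => i (γ t)) (dHom E E' i X) where
  smooth := hi.comp h.smooth
  map_add s t := by rw [h.map_add, map_mul]
  velocity := by
    have h1 := mfderiv_comp (I := 𝓘(ℝ, ℝ)) (I' := 𝓘(ℝ, E')) (I'' := 𝓘(ℝ, E)) (0 : ℝ)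
      (hi.mdifferentiable (by simp) (γ 0)) (h.smooth.mdifferentiable (by simp) 0)
    have h2 : ∀ g : G', g = 1 → ∀ v : E', (mfderiv 𝓘(ℝ, E') 𝓘(ℝ, E) i g v : E) =
        mfderiv 𝓘(ℝ, E') 𝓘(ℝ, E) i 1 v := by
      rintro g rfl v; rfl
    refine (congrArg (fun T : ℝ →L[ℝ] E => T 1) h1).trans ?_
    refine (h2 _ h.map_zero _).trans ?_
    exact congrArg (fun v : E' => (mfderiv 𝓘(ℝ, E') 𝓘(ℝ, E) i 1 v : E)) h.velocity

lemma Ind.translate_one (f : Ind E ρ) : Ind.translate E ρ 1 f = f :=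
  Subtype.ext (funext fun g => congrArg f.1 (by simp))

lemma Ind.translate_translate (a b : G) (f : Ind E ρ) :
    Ind.translate E ρ a (Ind.translate E ρ b f) = Ind.translate E ρ (a * b) f :=
  Subtype.ext (funext fun g => congrArg f.1 (by simp [mul_assoc]))

lemma equivariantDiffOp.translate_inv {D : Ind E ρ →ₗ[ℂ] Ind E' ρ'}
    (hD : D ∈ equivariantDiffOp E E' i ρ ρ') (a : G') (f : Ind E ρ) :
    D (Ind.translate E ρ (i a)⁻¹ f) = Ind.translate E' ρ' a⁻¹ (D f) := by
  rw [← map_inv]; exact hD.2 _ _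

/-- The pairing with the value of an equivariant differential operator is the pairing with an
element of the generalized Verma module. -/
lemma exists_vermaPair_comp_eq (hi : ContMDiff 𝓘(ℝ, E') 𝓘(ℝ, E) ∞ i) {D : Ind E ρ →ₗ[ℂ] Ind E' ρ'}
    (hD : D ∈ equivariantDiffOp E E' i ρ ρ') (m' : Verma E' ρ') :
    ∃ m : Verma E ρ, ∀ f, vermaPair ρ m f = vermaPair ρ' m' (D f) := by
  induction m' using Verma.induction with
  | mk_one ν =>
    obtain ⟨⟨k, q, hq, hDq⟩, -⟩ := hD
    -- The finite order of `D` enters here: `(D f)(1)` depends only on the `k`-jet of `f` at `1`.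
    obtain ⟨m, hm⟩ := exists_vermaPair_eq (ρ := ρ) (k := k)
      (l := vermaPair ρ' (Verma.mk E' ρ' 1 ν) ∘ₗ D) (fun f hf => by
        have h1 : jet E ρ k (Ind.translate E ρ (i 1)⁻¹ f) = 0 := by
          rw [map_one, inv_one, Ind.translate_one]
          exact (Submodule.Quotient.mk_eq_zero _).2 hf
        have h2 : (D f).1 1 = 0 := by rw [hDq, h1, map_zero]
        rw [LinearMap.comp_apply, vermaPair_mk, map_one]
        exact (congrArg ν h2).trans (map_zero ν))
    exact ⟨m, fun f => by rw [hm]; rfl⟩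
  | toUg_smul X m' h =>
    obtain ⟨m, hm⟩ := h
    obtain ⟨γ, hγ⟩ := exists_isOneParam X
    -- Translating `f` by `exp(tX)` passes through `D`, so differentiating the identity for `m'` at
    -- `t = 0` gives the one for `X • m'`.
    refine ⟨toUg E (dHom E E' i X) • m, fun f => ?_⟩
    refine ((hγ.map_hom hi).hasDerivAt_vermaPair m f).unique ?_
    simp only [hm, equivariantDiffOp.translate_inv hD]
    exact hγ.hasDerivAt_vermaPair m' (D f)
  | add m n hm hn =>
    obtain ⟨a, ha⟩ := hm
    obtain ⟨b, hb⟩ := hn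
    exact ⟨a + b, fun f => by simp only [map_add, LinearMap.add_apply, ha, hb]⟩
  | smul c m hm =>
    obtain ⟨a, ha⟩ := hm
    exact ⟨c • a, fun f => by simp only [map_smul, LinearMap.smul_apply, ha]⟩

lemma eq_of_vermaPair_eq (hnd : ∀ m : Verma E ρ, (∀ f, vermaPair ρ m f = 0) → m = 0)
    {m n : Verma E ρ} (h : ∀ f, vermaPair ρ m f = vermaPair ρ n f) : m = n :=
  sub_eq_zero.1 (hnd _ fun f => by rw [map_sub, LinearMap.sub_apply, h, sub_self])

/-- The homomorphism of generalized Verma modules defined by an equivariant differential operator,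
as the transpose of the operator. -/
lemma exists_gPHom (hi : ContMDiff 𝓘(ℝ, E') 𝓘(ℝ, E) ∞ i)
    (hnd : ∀ m : Verma E ρ, (∀ f, vermaPair ρ m f = 0) → m = 0) :
    ∃ Φ : equivariantDiffOp E E' i ρ ρ' →ₗ[ℂ] gPHom E E' i ρ ρ',
      ∀ D m' f, vermaPair ρ ((Φ D).1 m') f = vermaPair ρ' m' (D.1 f) := by
  choose φ hφ using fun D : equivariantDiffOp E E' i ρ ρ' => exists_vermaPair_comp_eq hi D.2
  refine ⟨
    { toFun := fun D => ⟨{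
        toFun := φ D
        map_add' := fun m n => eq_of_vermaPair_eq hnd fun f => by
          simp only [map_add, LinearMap.add_apply, hφ]
        map_smul' := fun c m => eq_of_vermaPair_eq hnd fun f => by
          simp only [map_smul, LinearMap.smul_apply, hφ, RingHom.id_apply] }, ?_, ?_⟩
      map_add' := fun D₁ D₂ => Subtype.ext (LinearMap.ext fun m' =>
        eq_of_vermaPair_eq hnd fun f => ?_)
      map_smul' := fun c D => Subtype.ext (LinearMap.ext fun m' =>
        eq_of_vermaPair_eq hnd fun f => ?_) }, fun D m' f => hφ D m' f⟩
  · intro X m'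
    refine eq_of_vermaPair_eq hnd fun f => ?_
    obtain ⟨γ, hγ⟩ := exists_isOneParam X
    refine (hφ D _ f).trans ?_
    refine (hγ.hasDerivAt_vermaPair m' (D.1 f)).unique ?_
    have h1 := (hγ.map_hom hi).hasDerivAt_vermaPair (φ D m') f
    simp only [hφ, equivariantDiffOp.translate_inv D.2] at h1
    exact h1
  · intro p' m'
    refine eq_of_vermaPair_eq hnd fun f => ?_
    refine (hφ D _ f).trans ?_
    rw [vermaPair_act, vermaPair_act, ← equivariantDiffOp.translate_inv D.2]
    exact (hφ D m' _).symm
  · refine (hφ _ _ f).trans ?_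
    change _ = vermaPair ρ (φ D₁ m' + φ D₂ m') f
    rw [map_add, LinearMap.add_apply, hφ, hφ, ← map_add]
    rfl
  · refine (hφ _ _ f).trans ?_
    change _ = vermaPair ρ (c • φ D m') f
    rw [map_smul, LinearMap.smul_apply, hφ, ← map_smul]
    rfl

lemma vermaPair_mk_one (ν : Module.Dual ℂ V) (f : Ind E ρ) :
    vermaPair ρ (Verma.mk E ρ 1 ν) f = ν (f.1 1) := by
  rw [vermaPair_mk, map_one]; rfl

/-- The value at the identity of the operator defined by a homomorphism of generalized Verma
modules. -/
def transposeAtOne (φ : Verma E' ρ' →ₗ[ℂ] Verma E ρ) : Ind E ρ →ₗ[ℂ] V' :=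
  (Module.evalEquiv ℂ V').symm.toLinearMap ∘ₗ
    ((vermaPair ρ ∘ₗ φ ∘ₗ vermaMk ρ' 1).flip : Ind E ρ →ₗ[ℂ] Module.Dual ℂ (Module.Dual ℂ V'))

lemma apply_transposeAtOne (φ : Verma E' ρ' →ₗ[ℂ] Verma E ρ) (ν : Module.Dual ℂ V') (f : Ind E ρ) :
    ν (transposeAtOne φ f) = vermaPair ρ (φ (Verma.mk E' ρ' 1 ν)) f :=
  Module.apply_evalEquiv_symm_apply ℂ V' ν _

/-- Tested against each `ν`, this is the `P'`-equivariance of `φ` on `1 ⊗ ν`, rewritten by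
`vermaPair_act`; it makes the transposed functions sections over `G'/P'`. -/
lemma transposeAtOne_translate {φ : Verma E' ρ' →ₗ[ℂ] Verma E ρ} (hφ : φ ∈ gPHom E E' i ρ ρ')
    (p' : P.comap i) (f : Ind E ρ) :
    transposeAtOne φ (Ind.translate E ρ (i p')⁻¹ f) = ρ' p'⁻¹ (transposeAtOne φ f) := by
  refine (Module.forall_dual_apply_eq_zero_iff ℂ _).1 ?_ |> sub_eq_zero.1
  intro ν
  have h1 := vermaPair_act (ρ := ρ) ⟨i p', p'.2⟩ (φ (Verma.mk E' ρ' 1 ν)) f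
  rw [← hφ.2, Verma.act_mk, map_one, ← apply_transposeAtOne, ← apply_transposeAtOne] at h1
  rw [map_sub, sub_eq_zero, ← h1]
  rfl

/-- Each element of the Verma module involves words of bounded length, and a finite basis of `V'^∨`
suffices. This is the finite order of the transposed operator. -/
lemma exists_transposeAtOne_eq_zero (φ : Verma E' ρ' →ₗ[ℂ] Verma E ρ) :
    ∃ k, ∀ f ∈ vanishJet E ρ k, transposeAtOne φ f = 0 := by
  let b := Module.finBasis ℝ (GroupLieAlgebra 𝓘(ℝ, E) G)
  have h1 : ∀ m : Verma E ρ, ∃ r, ∀ s, r ≤ s → ∀ f ∈ vanishJet E ρ s, vermaPair ρ m f = 0 := by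
    intro m
    induction m using Verma.induction_mk with
    | mk u ν =>
      obtain ⟨r, hr⟩ := exists_mem_wordSpan b u
      exact ⟨r, fun s hs f hf => vermaPair_eq_zero_of_mem_vanishJet (hr s hs) hf ν⟩
    | add m n hm hn =>
      obtain ⟨r, hr⟩ := hm
      obtain ⟨r', hr'⟩ := hn
      refine ⟨max r r', fun s hs f hf => ?_⟩
      rw [map_add, LinearMap.add_apply, hr s (le_of_max_le_left hs) f hf,
        hr' s (le_of_max_le_right hs) f hf, add_zero]
  let bV := Module.finBasis ℂ V'
  choose r hr using fun j => h1 (φ (Verma.mk E' ρ' 1 (bV.coord j)))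
  refine ⟨Finset.univ.sup r, fun f hf => bV.ext_elem fun j => ?_⟩
  have h2 := apply_transposeAtOne φ (bV.coord j) f
  rw [hr j _ (Finset.le_sup (Finset.mem_univ j)) f hf] at h2
  simpa using h2

lemma contMDiff_transposeAtOne (hi : ContMDiff 𝓘(ℝ, E') 𝓘(ℝ, E) ∞ i)
    (φ : Verma E' ρ' →ₗ[ℂ] Verma E ρ) (f : Ind E ρ) :
    ContMDiff 𝓘(ℝ, E') 𝓘(ℝ, V') ∞
      fun g' => transposeAtOne φ (Ind.translate E ρ (i g')⁻¹ f) := by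
  let bV := Module.finBasis ℂ V'
  have h1 : (fun g' => transposeAtOne φ (Ind.translate E ρ (i g')⁻¹ f)) = fun g' =>
      ∑ j, vermaPair ρ (φ (Verma.mk E' ρ' 1 (bV.coord j))) (Ind.translate E ρ (i g')⁻¹ f) •
        bV j := by
    ext g'
    simp only [← apply_transposeAtOne]
    exact (bV.sum_repr _).symm
  rw [h1]
  refine contMDiff_finsetSum fun j _ => ?_
  have h2 := (contMDiff_vermaPair_translate (φ (Verma.mk E' ρ' 1 (bV.coord j))) f).comp hi
  have h3 : ContDiff ℝ ∞ fun z : ℂ => z • bV j := contDiff_id.smul contDiff_const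
  exact h3.contMDiff.comp h2

/-- The equivariant differential operator defined by a homomorphism of generalized Verma
modules. -/
def transposeOp (hi : ContMDiff 𝓘(ℝ, E') 𝓘(ℝ, E) ∞ i) {φ : Verma E' ρ' →ₗ[ℂ] Verma E ρ}
    (hφ : φ ∈ gPHom E E' i ρ ρ') : Ind E ρ →ₗ[ℂ] Ind E' ρ' where
  toFun f := ⟨fun g' => transposeAtOne φ (Ind.translate E ρ (i g')⁻¹ f),
    contMDiff_transposeAtOne hi φ f, fun g' p' => by
      change transposeAtOne φ (Ind.translate E ρ (i (g' * p'))⁻¹ f) =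
        ρ' p'⁻¹ (transposeAtOne φ (Ind.translate E ρ (i g')⁻¹ f))
      rw [map_mul, mul_inv_rev, ← Ind.translate_translate, transposeAtOne_translate hφ]⟩
  map_add' f₁ f₂ := Subtype.ext (funext fun g' =>
    (congrArg (transposeAtOne φ) (map_add (Ind.translate E ρ (i g')⁻¹) f₁ f₂)).trans
      (map_add (transposeAtOne φ) _ _))
  map_smul' c f := Subtype.ext (funext fun g' =>
    (congrArg (transposeAtOne φ) (map_smul (Ind.translate E ρ (i g')⁻¹) c f)).trans
      (map_smul (transposeAtOne φ) c _))

lemma transposeOp_apply (hi : ContMDiff 𝓘(ℝ, E') 𝓘(ℝ, E) ∞ i) {φ : Verma E' ρ' →ₗ[ℂ] Verma E ρ}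
    (hφ : φ ∈ gPHom E E' i ρ ρ') (f : Ind E ρ) (g' : G') :
    (transposeOp hi hφ f).1 g' = transposeAtOne φ (Ind.translate E ρ (i g')⁻¹ f) := rfl

lemma transposeOp_mem (hi : ContMDiff 𝓘(ℝ, E') 𝓘(ℝ, E) ∞ i) {φ : Verma E' ρ' →ₗ[ℂ] Verma E ρ}
    (hφ : φ ∈ gPHom E E' i ρ ρ') : transposeOp hi hφ ∈ equivariantDiffOp E E' i ρ ρ' := by
  refine ⟨?_, fun a f => Subtype.ext (funext fun g' => ?_)⟩
  · obtain ⟨k, hk⟩ := exists_transposeAtOne_eq_zero φ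
    -- In the trivialization by left translations an equivariant operator has the same symbol at
    -- every point, so the bundle map is constant in `g'`.
    let q : Jet E ρ k →ₗ[ℂ] V' := (vanishJet E ρ k).liftQ (transposeAtOne φ) hk
    refine ⟨k, fun _ => q, ⟨fun j => contMDiff_const, fun g' p' f => ?_⟩, fun f g' => rfl⟩
    change transposeAtOne φ f = ρ' p'⁻¹ (transposeAtOne φ (Ind.translate E ρ (i p') f))
    rw [← transposeAtOne_translate hφ, Ind.translate_translate, inv_mul_cancel, Ind.translate_one]
  · have h1 : (i g')⁻¹ * i a = (i (a⁻¹ * g'))⁻¹ := by simp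
    have h2 : (Ind.translate E' ρ' a (transposeOp hi hφ f)).1 g' =
      (transposeOp hi hφ f).1 (a⁻¹ * g') := rfl
    rw [h2, transposeOp_apply, transposeOp_apply, Ind.translate_translate, h1]

lemma apply_transposeOp_one (hi : ContMDiff 𝓘(ℝ, E') 𝓘(ℝ, E) ∞ i)
    {φ : Verma E' ρ' →ₗ[ℂ] Verma E ρ} (hφ : φ ∈ gPHom E E' i ρ ρ') (ν : Module.Dual ℂ V')
    (f : Ind E ρ) :
    ν ((transposeOp hi hφ f).1 1) = vermaPair ρ (φ (Verma.mk E' ρ' 1 ν)) f := by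
  have h1 : Ind.translate E ρ (i 1)⁻¹ f = f := by rw [map_one i, inv_one, Ind.translate_one]
  exact (congrArg (fun f => ν (transposeAtOne φ f)) h1).trans (apply_transposeAtOne φ ν f)

/-- The value of `D f` at `g'` is the value at `1` of `D` on a translate of `f`. -/
lemma equivariantDiffOp.ext_one {D₁ D₂ : Ind E ρ →ₗ[ℂ] Ind E' ρ'}
    (h₁ : D₁ ∈ equivariantDiffOp E E' i ρ ρ') (h₂ : D₂ ∈ equivariantDiffOp E E' i ρ ρ')
    (h : ∀ (ν : Module.Dual ℂ V') f, ν ((D₁ f).1 1) = ν ((D₂ f).1 1)) : D₁ = D₂ := by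
  have h0 : ∀ f, (D₁ f).1 1 = (D₂ f).1 1 := fun f =>
    sub_eq_zero.1 ((Module.forall_dual_apply_eq_zero_iff ℂ _).1 fun ν =>
      (map_sub ν _ _).trans (sub_eq_zero.2 (h ν f)))
  refine LinearMap.ext fun f => Subtype.ext (funext fun g' => ?_)
  have h3 := h0 (Ind.translate E ρ (i g')⁻¹ f)
  rw [equivariantDiffOp.translate_inv h₁, equivariantDiffOp.translate_inv h₂] at h3
  have h4 : (D₁ f).1 (g'⁻¹⁻¹ * 1) = (D₂ f).1 (g'⁻¹⁻¹ * 1) := h3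
  rwa [inv_inv, mul_one] at h4

/-- The elements `1 ⊗ ν` generate the Verma module over `U(𝔤')`. -/
lemma gPHom.ext_mk_one {φ ψ : Verma E' ρ' →ₗ[ℂ] Verma E ρ} (hφ : φ ∈ gPHom E E' i ρ ρ')
    (hψ : ψ ∈ gPHom E E' i ρ ρ') (h : ∀ ν, φ (Verma.mk E' ρ' 1 ν) = ψ (Verma.mk E' ρ' 1 ν)) :
    φ = ψ := by
  refine LinearMap.ext fun m => ?_
  induction m using Verma.induction with
  | mk_one ν => exact h ν
  | toUg_smul X m hm => rw [hφ.1, hψ.1, hm]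
  | add m n hm hn => rw [map_add, map_add, hm, hn]
  | smul c m hm => rw [map_smul, map_smul, hm]

/-- Equivariant differential operators correspond to homomorphisms of generalized Verma modules. -/
lemma exists_linearEquiv_gPHom (hi : ContMDiff 𝓘(ℝ, E') 𝓘(ℝ, E) ∞ i)
    (hnd : ∀ m : Verma E ρ, (∀ f, vermaPair ρ m f = 0) → m = 0) :
    ∃ Φ : equivariantDiffOp E E' i ρ ρ' ≃ₗ[ℂ] gPHom E E' i ρ ρ', ∀ D (ν : Module.Dual ℂ V') f,
      vermaPair ρ ((Φ D).1 (Verma.mk E' ρ' 1 ν)) f = ν ((D.1 f).1 1) := by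
  obtain ⟨Φ, hΦ⟩ := exists_gPHom (ρ' := ρ') hi hnd
  have hΦ1 : ∀ D (ν : Module.Dual ℂ V') f,
      vermaPair ρ ((Φ D).1 (Verma.mk E' ρ' 1 ν)) f = ν ((D.1 f).1 1) :=
    fun D ν f => (hΦ D _ f).trans (vermaPair_mk_one ν (D.1 f))
  have hinj : Function.Injective Φ := by
    intro D₁ D₂ h
    refine Subtype.ext (equivariantDiffOp.ext_one D₁.2 D₂.2 fun ν f => ?_)
    rw [← hΦ1 D₁, ← hΦ1 D₂, h]
  have hsurj : Function.Surjective Φ := by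
    intro φ
    refine ⟨⟨transposeOp hi φ.2, transposeOp_mem hi φ.2⟩, Subtype.ext ?_⟩
    refine gPHom.ext_mk_one (Φ _).2 φ.2 fun ν => eq_of_vermaPair_eq hnd fun f => ?_
    exact (hΦ1 _ ν f).trans (apply_transposeOp_one hi φ.2 ν f)
  exact ⟨LinearEquiv.ofBijective Φ ⟨hinj, hsurj⟩, hΦ1⟩

end Operators

end FlagOperator

end

theorem mainTheorem4
    {E : Type*} [NormedAddCommGroup E] [NormedSpace ℝ E] [FiniteDimensional ℝ E]
    {G : Type*} [TopologicalSpace G] [ChartedSpace E G] [Group G] [LieGroup 𝓘(ℝ, E) ∞ G]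
    [ConnectedSpace G] [LieAlgebra.HasCentralRadical ℝ (GroupLieAlgebra 𝓘(ℝ, E) G)]
    {E' : Type*} [NormedAddCommGroup E'] [NormedSpace ℝ E'] [FiniteDimensional ℝ E']
    {G' : Type*} [TopologicalSpace G'] [ChartedSpace E' G'] [Group G'] [LieGroup 𝓘(ℝ, E') ∞ G']
    [LieAlgebra.HasCentralRadical ℝ (GroupLieAlgebra 𝓘(ℝ, E') G')]
    (i : G' →* G) (hi : ContMDiff 𝓘(ℝ, E') 𝓘(ℝ, E) ∞ i) (hinj : Function.Injective i)
    (P : Subgroup G) (hP : FlagOperator.IsParabolic E P)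
    (hP' : FlagOperator.IsParabolic E' (P.comap i))
    {V : Type*} [NormedAddCommGroup V] [NormedSpace ℂ V] [FiniteDimensional ℂ V]
    (ρ : Representation ℂ P V) (hρ : ∀ v, Continuous fun p => ρ p v)
    {V' : Type*} [NormedAddCommGroup V'] [NormedSpace ℂ V'] [FiniteDimensional ℂ V']
    (ρ' : Representation ℂ (P.comap i) V') (hρ' : ∀ v, Continuous fun p => ρ' p v) :
    ∃ pair : FlagOperator.Verma E ρ →ₗ[ℂ] FlagOperator.Ind E ρ →ₗ[ℂ] ℂ,
      (∀ (Xs : List (GroupLieAlgebra 𝓘(ℝ, E) G)) (ν : Module.Dual ℂ V) (f : FlagOperator.Ind E ρ),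
        pair (FlagOperator.Verma.mk E ρ (Xs.map (FlagOperator.toUg E)).prod ν) f =
          ν (Xs.foldr (FlagOperator.leftDeriv E) f.1 1)) ∧
      ∃ Φ : FlagOperator.equivariantDiffOp E E' i ρ ρ' ≃ₗ[ℂ] FlagOperator.gPHom E E' i ρ ρ',
        ∀ (D : FlagOperator.equivariantDiffOp E E' i ρ ρ') (ν : Module.Dual ℂ V')
          (f : FlagOperator.Ind E ρ),
          pair ((Φ D).1 (FlagOperator.Verma.mk E' ρ' 1 ν)) f = ν ((D.1 f).1 1) := by
  obtain ⟨S⟩ := hP.nonempty_slice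
  -- `leftDeriv` and `lder` unfold to the same expression, and the slice supplies nondegeneracy.
  exact ⟨FlagOperator.vermaPair ρ, fun Xs ν f => FlagOperator.vermaPair_mk_prod ρ Xs ν f,
    FlagOperator.exists_linearEquiv_gPHom hi fun _ => S.eq_zero_of_vermaPair hρ⟩
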